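/- **Setting.** Consider the scalar fading channel $y=\sqrt{snr}\,h\,x+n$, where $x,h,n$ are independent complex random variables, $n\sim\mathcal{CN}(0,1)$, $E|h|^2<\infty$, and $|h|$ has a probability density function $f_{|h|}$. For fixed $h_0\in\mathbb{C}$ put $$mmse_{h_0}(snr)=E\left\{\left|h_0x-E\{h_0x\mid y\}\right|^2\right\},\qquad y=\sqrt{snr}\,h_0x+n,$$ and let $\overline{mmse}(snr)=E_h\{mmse_h(snr)\}$ be the average MMSE. The input $x$ has one of four laws: $\infty$-PSK (uniform on the unit circle), $\infty$-PAM (uniform on the real segment $[-\sqrt3,\sqrt3]$), $\infty$-QAM (uniform on the square $[-\sqrt{3/2},\sqrt{3/2}]^2\subset\mathbb{C}$), or $\mathcal{CN}(0,1)$. Let $f(t)=\tfrac12\sqrt t\,f_{|h|}(\sqrt t)$ for $t>0$, let $M[f;w]=\int_0^\infty t^{w-1}f(t)\,dt$ be its Mellin transform, and let $$\gamma=\inf\{g\in\mathbb{R}:f(t)=O(t^{-g}),\,t\to0^+\},\quad \delta=\sup\{d\in\mathbb{R}:f(t)=O(t^{-d}),\,t\to+\infty\},\quad C=\,]0,1[\,\cap\,]1-\delta,1-\gamma[,$$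 where $\gamma,\delta$ are extended reals. **Hypotheses.** As $t\to0^+$, $$f(t)\sim e^{-qt^{-\mu}}\sum_{m=0}^{\infty}\sum_{n=0}^{N(m)}p_{mn}t^{a_m}(\log t)^n,$$ that is, for every $k\ge0$ the difference between $f(t)$ and $e^{-qt^{-\mu}}\sum_{m\le k}\sum_{n\le N(m)}p_{mn}t^{a_m}(\log t)^n$ is $O\big(e^{-qt^{-\mu}}t^{a_{k+1}}(\log t)^{N(k+1)}\big)$. Here $q\in\mathbb{C}$ with $\Re q\ge0$, $\mu>0$, $N(m)\in\mathbb{Z}_{\ge0}$, $p_{mn}\in\mathbb{C}$, the exponents $a_m\in\mathbb{C}$ are pairwise distinct, and $\Re a_m$ is non-decreasing and tends to $+\infty$. If $x\not\sim\mathcal{CN}(0,1)$ and $q=0$, then $\Re a_0>0$. Moreover $\gamma<\delta$, $C\ne\emptyset$, and there is $c\in C$ such that, for every $x\ge c$, $M[f;1-x-iy]=O(|y|^{-2})$ as $|y|\to\infty$, where $M[f;\cdot]$ also denotes the meromorphic continuation of the Mellin transform from the strip $\gamma<\Re w<\delta$ to the half-plane $\Re w<\delta$. **Conclusion.** This continuation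 exists, and as $snr\to+\infty$ the following holds. 1. Suppose $q=0$. - $\infty$-PSK: $\overline{mmse}(snr)=\dfrac{M[f;0]}{2\,snr}+O(snr^{-R})$ for every $R$ with $1<R<\min\{\Re a_0+1,\,2\}$. - $\infty$-PAM: $\overline{mmse}(snr)=\dfrac{M[f;0]}{2\,snr}+O(snr^{-R})$ for every $R$ with $1<R<\min\{\Re a_0+1,\,\tfrac32\}$. - $\infty$-QAM: $\overline{mmse}(snr)=\dfrac{M[f;0]}{snr}+O(snr^{-R})$ for every $R$ with $1<R<\min\{\Re a_0+1,\,\tfrac32\}$. - $\mathcal{CN}(0,1)$: $\overline{mmse}(snr)$ has the asymptotic expansion $$\sum_{m\in\mathcal R}\frac{(-1)^mM[f;-m]}{snr^{m+1}} +\sum_{m\in\mathcal A}\frac1{snr^{1+a_m}}\sum_{n=0}^{N(m)}p_{mn}\sum_{j=0}^n\binom nj(-\log snr)^j\left(\frac{d}{dz}\right)^{n-j}\left\{\frac{\pi}{\sin\pi z}\right\}\Bigg|_{z=1+a_m}$$ $$-\sum_{k\in\mathcal K}\frac1{snr^{1+a_k}}\sum_{j=0}^{N(k)+1}\frac{(-\log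 snr)^j}{j!\,(N(k)+1-j)!}\left(\frac{d}{dz}\right)^{N(k)+1-j}\left\{(z-1-a_k)^{N(k)+2}\,\frac{\pi M[f;1-z]}{\sin\pi z}\right\}\Bigg|_{z=1+a_k},$$ where $\mathcal R=\{m\in\mathbb{Z}_{\ge0}: m\ne a_n\ \forall n\}$, $\mathcal A=\{m\in\mathbb{Z}_{\ge0}: a_m\notin\mathbb{Z}_{\ge0}\}$, $\mathcal K=\{k\in\mathbb{Z}_{\ge0}: a_k\in\mathbb{Z}_{\ge0}\}$, and the removable singularity in the last braces is removed. This means that for every $X\in\mathbb{R}$ the sum of the finitely many terms with $m+1\le X$, $1+\Re a_m\le X$ and $1+a_k\le X$, respectively, differs from $\overline{mmse}(snr)$ by $o(snr^{-X})$. 2. Suppose $q\ne0$. - $\infty$-PSK: $\overline{mmse}(snr)=\dfrac{M[f;0]}{2\,snr}+O(snr^{-R})$ for every $R\in\,]1,2[$. - $\infty$-PAM: $\overline{mmse}(snr)=\dfrac{M[f;0]}{2\,snr}+O(snr^{-R})$ for every $R\in\,]1,\tfrac32[$. - $\infty$-QAM: $\overline{mmse}(snr)=\dfrac{M[f;0]}{snr}+O(snr^{-R})$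 for every $R\in\,]1,\tfrac32[$. - $\mathcal{CN}(0,1)$: for every $k\ge0$, $\overline{mmse}(snr)=\displaystyle\sum_{m=0}^{k}\frac{(-1)^mM[f;-m]}{snr^{m+1}}+O(snr^{-(k+2)})$. -/

import Mathlib

open Filter Topology Asymptotics MeasureTheory ProbabilityTheory

noncomputable section

/-- The law `CN(0,1)`: real and imaginary parts are independent and `N(0,1/2)`. -/
def stdComplexGaussian : Measure ℂ :=
  ((gaussianReal 0 (1 / 2)).prod (gaussianReal 0 (1 / 2))).map
    (fun p : ℝ × ℝ => (p.1 : ℂ) + (p.2 : ℂ) * Complex.I)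

/-- The `∞`-PSK input law: uniform on the unit circle. -/
def pskLaw : Measure ℂ :=
  (ProbabilityTheory.cond volume (Set.Ico (0 : ℝ) (2 * Real.pi))).map
    (fun θ : ℝ => Complex.exp ((θ : ℂ) * Complex.I))

/-- The `∞`-PAM input law: uniform on the real segment `[-√3, √3]`. -/
def pamLaw : Measure ℂ :=
  (ProbabilityTheory.cond volume (Set.Icc (-√3) √3)).map (fun r : ℝ => (r : ℂ))

/-- The `∞`-QAM input law: uniform on the square `[-√(3/2), √(3/2)] × [-√(3/2), √(3/2)]`. -/
def qamLaw : Measure ℂ :=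
  ProbabilityTheory.cond volume
    (Set.Icc (-√(3 / 2)) √(3 / 2) ×ℂ Set.Icc (-√(3 / 2)) √(3 / 2))

/-- The output `y = √snr h₀ x + n`, as a function of the pair `(x, n)`. -/
def channelOutput (h₀ : ℂ) (snr : ℝ) (xn : ℂ × ℂ) : ℂ :=
  ((√snr : ℝ) : ℂ) * h₀ * xn.1 + xn.2

/-- `mmse_{h₀}(snr) = E |h₀ x - E{h₀ x | y}|²` for `y = √snr h₀ x + n`, where `x ∼ PX` and
`n ∼ CN(0,1)` are independent. -/
def condMMSE (PX : Measure ℂ) (h₀ : ℂ) (snr : ℝ) : ℝ :=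
  ∫ xn, ‖h₀ * xn.1 -
      (condExp (MeasurableSpace.comap (channelOutput h₀ snr) inferInstance)
        (PX.prod stdComplexGaussian) (fun xn : ℂ × ℂ => h₀ * xn.1)) xn‖ ^ 2
    ∂(PX.prod stdComplexGaussian)

/-- The average MMSE `E_h {mmse_h(snr)}` for a fading gain of law `Ph`. -/
def avgMMSE (PX Ph : Measure ℂ) (snr : ℝ) : ℝ :=
  ∫ h₀, condMMSE PX h₀ snr ∂Ph

/-- `fh` is a probability density function of `|h|`, where `h ∼ Ph`. -/
def IsGainDensity (Ph : Measure ℂ) (fh : ℝ → ℝ) : Prop :=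
  Measurable fh ∧ (∀ r, 0 ≤ fh r) ∧
    Ph.map (fun z : ℂ => ‖z‖) = (volume : Measure ℝ).withDensity (fun r => ENNReal.ofReal (fh r))

/-- `f(t) = √t f_{|h|}(√t) / 2`. -/
def fadingFun (fh : ℝ → ℝ) (t : ℝ) : ℂ := ((√t * fh √t / 2 : ℝ) : ℂ)

/-- `γ = inf {γ* : f(t) = O(t^{-γ*}), t → 0⁺}`, an extended real. -/
def growthZero (f : ℝ → ℂ) : EReal :=
  sInf {e : EReal | ∃ g : ℝ, e = (g : EReal) ∧ f =O[𝓝[>] (0 : ℝ)] fun t : ℝ => t ^ (-g)}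

/-- `δ = sup {δ* : f(t) = O(t^{-δ*}), t → +∞}`, an extended real. -/
def decayInfty (f : ℝ → ℂ) : EReal :=
  sSup {e : EReal | ∃ d : ℝ, e = (d : EReal) ∧ f =O[atTop] fun t : ℝ => t ^ (-d)}

/-- `C = ]0,1[ ∩ ]1-δ, 1-γ[`. -/
def abscissae (f : ℝ → ℂ) : Set ℝ :=
  {c : ℝ | 0 < c ∧ c < 1 ∧ 1 - decayInfty f < (c : EReal) ∧ (c : EReal) < 1 - growthZero f}

/-- `F` is a meromorphic continuation of the Mellin transform `M[f; w]` from the strip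
`γ < Re w < δ` to the half-plane `Re w < δ`. Normal form (the analytic value at every regular
point, `0` at every pole) makes `F` unique on the half-plane. -/
def IsMellinContinuation (f : ℝ → ℂ) (F : ℂ → ℂ) : Prop :=
  MeromorphicNFOn F {w : ℂ | (w.re : EReal) < decayInfty f} ∧
    ∀ w : ℂ, growthZero f < (w.re : EReal) → (w.re : EReal) < decayInfty f → F w = mellin f w

/-- `M[f; w]`, continued analytically to `Re w < δ`. -/
def mellinCont (f : ℝ → ℂ) : ℂ → ℂ := Classical.epsilon (IsMellinContinuation f)

/-- `f(t) ∼ exp(-q t^{-μ}) ∑_{m ≥ 0} ∑_{n ≤ N m} p m n t^{a m} (log t)^n` as `t → 0⁺`. -/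
def HasFadingExpansion (f : ℝ → ℂ) (q : ℂ) (μ : ℝ) (N : ℕ → ℕ) (p : ℕ → ℕ → ℂ) (a : ℕ → ℂ) :
    Prop :=
  ∀ k : ℕ,
    (fun t : ℝ => f t - Complex.exp (-q * ((t ^ (-μ) : ℝ) : ℂ)) *
        ∑ m ∈ Finset.range (k + 1), ∑ n ∈ Finset.range (N m + 1),
          p m n * (t : ℂ) ^ a m * ((Real.log t : ℝ) : ℂ) ^ n)
      =O[𝓝[>] (0 : ℝ)]
    fun t : ℝ => Complex.exp (-q * ((t ^ (-μ) : ℝ) : ℂ)) * (t : ℂ) ^ a (k + 1) *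
      ((Real.log t : ℝ) : ℂ) ^ N (k + 1)

/-- Simple pole of `π / sin (π z)` at `z = m + 1`:  `(-1)^m M[f; -m] / snr^{m+1}`. -/
def regularTerm (f : ℝ → ℂ) (m : ℕ) (snr : ℝ) : ℂ :=
  (-1) ^ m * mellinCont f (-(m : ℂ)) / (snr : ℂ) ^ (m + 1)

/-- Contribution of `z = 1 + a m` when it is not a pole of `π / sin (π z)`. -/
def fadingTerm (N : ℕ → ℕ) (p : ℕ → ℕ → ℂ) (a : ℕ → ℂ) (m : ℕ) (snr : ℝ) : ℂ :=
  (snr : ℂ) ^ (-(1 + a m)) *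
    ∑ n ∈ Finset.range (N m + 1), p m n *
      ∑ j ∈ Finset.range (n + 1), (n.choose j : ℂ) * (-((Real.log snr : ℝ) : ℂ)) ^ j *
        iteratedDeriv (n - j) (fun z : ℂ => (Real.pi : ℂ) / Complex.sin (Real.pi * z)) (1 + a m)

/-- Contribution of `z = 1 + a k` when `a k` is a non-negative integer, so that the poles of
`π / sin (π z)` and of `M[f; 1 - z]` meet there. The function that is differentiated has a
removable singularity at `1 + a k`, which `toMeromorphicNFAt` removes. -/
def coincidentTerm (f : ℝ → ℂ) (N : ℕ → ℕ) (a : ℕ → ℂ) (k : ℕ) (snr : ℝ) : ℂ :=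
  -(snr : ℂ) ^ (-(1 + a k)) *
    ∑ j ∈ Finset.range (N k + 2),
      (-((Real.log snr : ℝ) : ℂ)) ^ j / ((j.factorial : ℂ) * ((N k + 1 - j).factorial : ℂ)) *
        iteratedDeriv (N k + 1 - j)
          (toMeromorphicNFAt
            (fun z : ℂ => (z - (1 + a k)) ^ (N k + 2) *
              ((Real.pi : ℂ) * mellinCont f (1 - z) / Complex.sin (Real.pi * z)))
            (1 + a k))
          (1 + a k)

/-- The sum of all terms of order `snr^{-x}`, up to powers of `log snr`, with `x ≤ X`: those of
`m ∈ R` (no `a n` equals `m`), of `m ∈ A` (`a m` is no non-negative integer), and of the indices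
`k` for which `a k` is a non-negative integer. -/
def gaussianPartialSum (f : ℝ → ℂ) (N : ℕ → ℕ) (p : ℕ → ℕ → ℂ) (a : ℕ → ℂ) (X snr : ℝ) : ℂ :=
  (∑ᶠ m ∈ {m : ℕ | (¬ ∃ n : ℕ, (m : ℂ) = a n) ∧ (m : ℝ) + 1 ≤ X}, regularTerm f m snr) +
  (∑ᶠ m ∈ {m : ℕ | (¬ ∃ l : ℕ, (l : ℂ) = a m) ∧ 1 + (a m).re ≤ X}, fadingTerm N p a m snr) +
  (∑ᶠ k ∈ {k : ℕ | (∃ l : ℕ, (l : ℂ) = a k) ∧ 1 + (a k).re ≤ X}, coincidentTerm f N a k snr)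

/-- `mmse(snr) = ζ M[f;0] / snr + O(snr^{-R})` as `snr → +∞`, for the average MMSE. -/
def OneTermExpansion (PX Ph : Measure ℂ) (f : ℝ → ℂ) (ζ : ℂ) (R : ℝ) : Prop :=
  (fun snr : ℝ => ((avgMMSE PX Ph snr : ℝ) : ℂ) - ζ * mellinCont f 0 / (snr : ℂ))
    =O[atTop] fun snr : ℝ => snr ^ (-R)

end

noncomputable section

/-! ### Conditional expectation as a projection in `L²` -/

/-! The bounded inputs and the Gaussian input are treated by different methods.

For PSK, PAM and QAM write `ρ = |h|² snr`. The key is a bound uniform in the gain, `|mmse_h(snr) -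
ζ/snr| ≤ K |h|² ρ^(-R)`, with `ζ = 1/2` or `1` (`pskLaw_error_bound`, `pamLaw_error_bound`,
`qamLaw_error_bound`). From above, an explicit estimator is inserted (`condMMSE_le`). From below,
any `V` whose conditional mean given `y` is zero is orthogonal to every estimator, so Cauchy–Schwarz
gives `|E V̄ h x|² ≤ E|V|² · mmse` (`le_condMMSE`). Such `V` come from integrating a total
derivative of a test function times the Gaussian density over the support of the input. On the
circle there is no boundary. On a segment or square the test function must vanish at the boundary,
and this costs a relative error of order `ρ^(-1/2)`, whence the limit `3/2`. For `ρ < 1` trivial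
bounds suffice. Averaging produces `∫ t^(-R) f(t) dt`, finite because `f = O(t^b)` with `b > R - 1`,
and `M[f; 0] = 1` is the total mass of the law of `|h|²`.

For the Gaussian input the error is `|h|²/(1 + |h|² snr)`, so its average is the Stieltjes-type
integral `∫ f(t)/(1 + snr t) dt`. When `q = 0`, finitely many terms of the expansion of `f` are
removed on `(0, 1]`. The remainder has enough negative moments for the geometric series of the
kernel. A removed term `t^a (log t)^n` leads to an `n`-th derivative at `1 + a` of the truncated
Mellin transform of the kernel, which is continued by the identity theorem from `s^(-z) π / sin(πz)`
(`truncatedMoment_add`). The polar terms of this continuation recombine with the moments of the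
remainder into the continued transform `M[f; -m]`
(`HasLogExpansion.integral_mul_stieltjesKernel_sub_isBigO`). Where an exponent is a nonnegative
integer, the two kinds of contribution merge into the residue at a multiple pole
(`coincidentTerm_eq`).

When `q ≠ 0`, `f` is smaller than every power at the origin. This is plain for `Re q > 0`. For
imaginary `q` it holds because `f` is real: the phase oscillates rapidly while its amplitude varies
slowly, so their product can agree with its own conjugate only if the amplitude is negligible
(`isBigO_of_phase_mul_sub_conj`). All negative moments of `f` then exist, and its Mellin transform
is its own continuation. -/

lemma integral_norm_sq_eq_norm_toLp {Ω : Type*} [MeasurableSpace Ω] {μ : Measure Ω} {X : Ω → ℂ}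
    (hX : MemLp X 2 μ) : ∫ ω, ‖X ω‖ ^ 2 ∂μ = ‖hX.toLp‖ ^ 2 := by
  have h := L2.inner_def (𝕜 := ℂ) hX.toLp hX.toLp
  rw [inner_self_eq_norm_sq_to_K] at h
  have h2 : ∫ ω, inner ℂ ((hX.toLp X : Lp ℂ 2 μ) ω) ((hX.toLp X : Lp ℂ 2 μ) ω) ∂μ = ((∫ ω, ‖X ω‖ ^ 2 ∂μ : ℝ) : ℂ) := by
    rw [← integral_complex_ofReal]
    refine integral_congr_ae ?_
    filter_upwards [hX.coeFn_toLp] with ω hω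
    rw [hω, inner_self_eq_norm_sq_to_K]
    norm_cast
  rw [h2] at h
  refine Complex.ofReal_injective ?_
  rw [← h]
  push_cast
  rfl

lemma integral_conj_mul_eq_inner_toLp {Ω : Type*} [MeasurableSpace Ω] {μ : Measure Ω}
    {V X : Ω → ℂ} (hV : MemLp V 2 μ) (hX : MemLp X 2 μ) :
    ∫ ω, starRingEnd ℂ (V ω) * X ω ∂μ = inner ℂ hV.toLp hX.toLp := by
  rw [L2.inner_def]
  refine integral_congr_ae ?_
  filter_upwards [hV.coeFn_toLp, hX.coeFn_toLp] with ω h1 h2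
  rw [h1, h2, RCLike.inner_apply']

lemma toLp_sub_condExp {Ω : Type*} {m m0 : MeasurableSpace Ω} {μ : Measure Ω}
    [IsFiniteMeasure μ] (hm : m ≤ m0) {X : Ω → ℂ} (hX : MemLp X 2 μ) :
    (hX.sub (hX.condExp (m := m) one_le_two)).toLp
      = hX.toLp - (condExpL2 ℂ ℂ hm hX.toLp : Lp ℂ 2 μ) := by
  rw [MemLp.toLp_sub hX (hX.condExp one_le_two)]
  congr 1
  refine Lp.ext ?_
  refine (MemLp.coeFn_toLp _).trans ?_
  exact (hX.condExpL2_ae_eq_condExp (𝕜 := ℂ) hm).symm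

/-- The conditional expectation has the least mean square error among the `L²` estimators. -/
lemma integral_norm_sq_sub_condExp_le {Ω : Type*} {m m0 : MeasurableSpace Ω} {μ : Measure Ω}
    [IsFiniteMeasure μ] (hm : m ≤ m0) {X e : Ω → ℂ} (hX : MemLp X 2 μ) (he : MemLp e 2 μ)
    (hem : StronglyMeasurable[m] e) :
    ∫ ω, ‖X ω - (μ[X|m]) ω‖ ^ 2 ∂μ ≤ ∫ ω, ‖X ω - e ω‖ ^ 2 ∂μ := by
  have h1 := integral_norm_sq_eq_norm_toLp (hX.sub (hX.condExp (m := m) one_le_two))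
  have h2 := integral_norm_sq_eq_norm_toLp (hX.sub he)
  simp only [Pi.sub_apply] at h1 h2
  rw [h1, h2, toLp_sub_condExp hm hX, MemLp.toLp_sub hX he]
  gcongr
  have hmem : he.toLp ∈ lpMeas ℂ ℂ m 2 μ := by
    rw [mem_lpMeas_iff_aestronglyMeasurable]
    exact hem.aestronglyMeasurable.congr he.coeFn_toLp.symm
  have : Fact (m ≤ m0) := ⟨hm⟩
  have h3 := (lpMeas ℂ ℂ m 2 μ).starProjection_minimal hX.toLp
  have h4 : (condExpL2 ℂ ℂ hm hX.toLp : Lp ℂ 2 μ)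
      = (lpMeas ℂ ℂ m 2 μ).starProjection hX.toLp := rfl
  rw [h4, h3]
  exact ciInf_le ⟨0, by rintro _ ⟨x, rfl⟩; positivity⟩ (⟨_, hmem⟩ : lpMeas ℂ ℂ m 2 μ)

/-- Lower bound of van Trees type for the mean square error of the conditional expectation. -/
lemma norm_sq_integral_le_of_condExp_eq_zero {Ω : Type*} {m m0 : MeasurableSpace Ω}
    {μ : Measure Ω} [IsFiniteMeasure μ] (hm : m ≤ m0) {V X : Ω → ℂ} (hV : MemLp V 2 μ)
    (hX : MemLp X 2 μ) (h0 : μ[V|m] =ᵐ[μ] 0) :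
    ‖∫ ω, starRingEnd ℂ (V ω) * X ω ∂μ‖ ^ 2
      ≤ (∫ ω, ‖V ω‖ ^ 2 ∂μ) * ∫ ω, ‖X ω - (μ[X|m]) ω‖ ^ 2 ∂μ := by
  have h1 := integral_norm_sq_eq_norm_toLp (hX.sub (hX.condExp (m := m) one_le_two))
  simp only [Pi.sub_apply] at h1
  rw [h1, integral_norm_sq_eq_norm_toLp hV, toLp_sub_condExp hm,
    integral_conj_mul_eq_inner_toLp hV hX, ← mul_pow]
  have hV0 : (condExpL2 ℂ ℂ hm hV.toLp : Lp ℂ 2 μ) = 0 := by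
    refine Lp.ext ?_
    exact ((hV.condExpL2_ae_eq_condExp (𝕜 := ℂ) hm).trans h0).trans (Lp.coeFn_zero _ _ _).symm
  -- The projection is self-adjoint and kills `V`, so the projection of `X` may be subtracted for
  -- free before Cauchy–Schwarz.
  have h2 : inner ℂ hV.toLp hX.toLp
      = inner ℂ hV.toLp (hX.toLp - (condExpL2 ℂ ℂ hm hX.toLp : Lp ℂ 2 μ)) := by
    rw [inner_sub_right, ← inner_condExpL2_left_eq_right, hV0, inner_zero_left, sub_zero]
  rw [h2]
  gcongr
  exact norm_inner_le_norm _ _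

/-! ### The standard complex Gaussian law -/

/-- The density of `CN(0,1)`. -/
def complexGaussianDensity (z : ℂ) : ℝ := Real.pi⁻¹ * Real.exp (-‖z‖ ^ 2)

lemma complexGaussianDensity_nonneg (z : ℂ) : 0 ≤ complexGaussianDensity z := by
  unfold complexGaussianDensity; positivity

lemma complexGaussianDensity_pos (z : ℂ) : 0 < complexGaussianDensity z := by
  unfold complexGaussianDensity; positivity

lemma complexGaussianDensity_le_one (z : ℂ) : complexGaussianDensity z ≤ 1 := by
  unfold complexGaussianDensity
  have h1 : Real.pi⁻¹ ≤ 1 := inv_le_one_of_one_le₀ (by linarith [Real.pi_gt_three])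
  have h2 : Real.exp (-‖z‖ ^ 2) ≤ 1 := Real.exp_le_one_iff.2 (by simp)
  exact mul_le_one₀ h1 (by positivity) h2

@[fun_prop]
lemma continuous_complexGaussianDensity : Continuous complexGaussianDensity := by
  unfold complexGaussianDensity; fun_prop

@[fun_prop]
lemma measurable_complexGaussianDensity : Measurable complexGaussianDensity :=
  continuous_complexGaussianDensity.measurable

lemma ofReal_add_mul_I_eq_symm : (fun p : ℝ × ℝ => (p.1 : ℂ) + (p.2 : ℂ) * Complex.I)
    = Complex.measurableEquivRealProd.symm := by
  ext p
  apply Complex.ext <;> simp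

lemma stdComplexGaussian_eq_withDensity :
    stdComplexGaussian
      = (volume : Measure ℂ).withDensity (fun z => ENNReal.ofReal (complexGaussianDensity z)) := by
  have hv : (1 / 2 : NNReal) ≠ 0 := by norm_num
  unfold stdComplexGaussian
  rw [gaussianReal_of_var_ne_zero _ hv, prod_withDensity (by fun_prop) (by fun_prop),
    ofReal_add_mul_I_eq_symm]
  refine Measure.ext_of_lintegral _ fun φ hφ => ?_
  rw [lintegral_map hφ (by fun_prop), lintegral_withDensity_eq_lintegral_mul _ (by fun_prop) (by fun_prop),
    lintegral_withDensity_eq_lintegral_mul _ (by fun_prop) hφ,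
    ← Complex.volume_preserving_equiv_real_prod.symm.lintegral_comp_emb
      (MeasurableEquiv.measurableEmbedding _)]
  refine lintegral_congr fun p => ?_
  simp only [Pi.mul_apply, gaussianPDF]
  rw [← ENNReal.ofReal_mul (gaussianPDFReal_nonneg _ _ _)]
  congr 2
  unfold gaussianPDFReal complexGaussianDensity
  have h1 : ((1 / 2 : NNReal) : ℝ) = 1 / 2 := by norm_num
  rw [h1]
  have h2 : ‖Complex.measurableEquivRealProd.symm p‖ ^ 2 = p.1 ^ 2 + p.2 ^ 2 := by
    rw [← Complex.normSq_eq_norm_sq, Complex.normSq_apply]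
    simp [sq]
  rw [h2]
  have h3 : 2 * Real.pi * (1 / 2) = Real.pi := by ring
  rw [h3]
  have h4 : (√Real.pi)⁻¹ * (√Real.pi)⁻¹ = Real.pi⁻¹ := by
    rw [← mul_inv, Real.mul_self_sqrt Real.pi_pos.le]
  rw [mul_mul_mul_comm, h4, ← Real.exp_add]
  congr 2
  ring

instance : IsProbabilityMeasure stdComplexGaussian := by
  unfold stdComplexGaussian
  exact Measure.isProbabilityMeasure_map (by fun_prop)

/-- A random variable whose weighted average over the posterior vanishes has zero conditional
expectation given the channel output. -/
lemma condExp_eq_zero_of_posterior (PX : Measure ℂ) [IsProbabilityMeasure PX] (κ : ℂ)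
    (V : ℂ × ℂ → ℂ) (hVm : Measurable V) (hV : Integrable V (PX.prod stdComplexGaussian))
    (h : ∀ y, ∫ x, (complexGaussianDensity (y - κ * x) : ℂ) * V (x, y - κ * x) ∂PX = 0) :
    (PX.prod stdComplexGaussian)[V | MeasurableSpace.comap
      (fun xn : ℂ × ℂ => κ * xn.1 + xn.2) inferInstance] =ᵐ[PX.prod stdComplexGaussian] 0 := by
  set Y : ℂ × ℂ → ℂ := fun xn => κ * xn.1 + xn.2 with hYdef
  have hY : Measurable Y := by fun_prop
  have hprod : PX.prod stdComplexGaussian = (PX.prod (volume : Measure ℂ)).withDensity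
      (fun z => ENNReal.ofReal (complexGaussianDensity z.2)) := by
    rw [stdComplexGaussian_eq_withDensity, prod_withDensity_right (by fun_prop)]
  symm
  refine ae_eq_condExp_of_forall_setIntegral_eq hY.comap_le hV (fun s _ _ => by
    exact (integrable_zero _ _ _).integrableOn) ?_ aestronglyMeasurable_zero
  rintro s ⟨B, hB, rfl⟩ -
  rw [Pi.zero_def, integral_zero, ← integral_indicator (hY hB)]
  have hF : Integrable ((Y ⁻¹' B).indicator V) (PX.prod stdComplexGaussian) :=
    hV.indicator (hY hB)
  have hFm : Measurable ((Y ⁻¹' B).indicator V) := hVm.indicator (hY hB)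
  set F := (Y ⁻¹' B).indicator V with hFdef
  rw [hprod] at hF ⊢
  have hlt : ∀ᵐ z : ℂ × ℂ ∂(PX.prod volume),
    ENNReal.ofReal (complexGaussianDensity z.2) < ⊤ := ae_of_all _ fun _ => ENNReal.ofReal_lt_top
  have hdm : Measurable fun z : ℂ × ℂ => ENNReal.ofReal (complexGaussianDensity z.2) := by fun_prop
  rw [integrable_withDensity_iff_integrable_smul' hdm hlt] at hF
  rw [integral_withDensity_eq_integral_toReal_smul hdm hlt]
  set G : ℂ × ℂ → ℂ := fun z => (ENNReal.ofReal (complexGaussianDensity z.2)).toReal • F z with hG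
  -- This shear replaces the noise by the output `y` as second coordinate. The conditioning event
  -- then depends on `y` alone, and the inner integral over `x` is the one assumed to vanish.
  have hT : MeasurePreserving (fun z : ℂ × ℂ => (z.1, z.2 - κ * z.1))
      (PX.prod (volume : Measure ℂ)) (PX.prod volume) := by
    refine (MeasurePreserving.id PX).skew_product (g := fun x y => y - κ * x)
      (by fun_prop) ?_
    refine ae_of_all _ fun x => ?_
    exact (measurePreserving_sub_right volume (κ * x)).map_eq
  have h1 : ∫ z, G z ∂(PX.prod volume) = ∫ z : ℂ × ℂ, G (z.1, z.2 - κ * z.1) ∂(PX.prod volume) := by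
    conv_lhs => rw [← hT.map_eq]
    rw [integral_map hT.aemeasurable]
    rw [hT.map_eq]
    exact hF.aestronglyMeasurable
  have h2 : Integrable (fun z : ℂ × ℂ => G (z.1, z.2 - κ * z.1)) (PX.prod volume) :=
    hT.integrable_comp_of_integrable hF
  rw [h1, integral_prod_symm _ h2]
  have h3 : ∀ y, ∫ x, G (x, y - κ * x) ∂PX = 0 := by
    intro y
    have h4 : ∀ x, G (x, y - κ * x)
        = B.indicator (fun _ => (1 : ℂ)) y *
          ((complexGaussianDensity (y - κ * x) : ℂ) * V (x, y - κ * x)) := by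
      intro x
      have : Y (x, y - κ * x) = y := by simp [hYdef]
      by_cases hy : y ∈ B
      · simp [hG, hFdef, Set.indicator, this, hy,
          ENNReal.toReal_ofReal (complexGaussianDensity_nonneg _)]
      · simp [hG, hFdef, Set.indicator, this, hy]
    simp_rw [h4]
    rw [integral_const_mul, h y, mul_zero]
  simp [h3]

/-! ### Moments of the standard complex Gaussian law -/

lemma map_re_stdComplexGaussian :
    stdComplexGaussian.map Complex.re = gaussianReal 0 (1 / 2) := by
  unfold stdComplexGaussian
  rw [Measure.map_map (by fun_prop) (by fun_prop)]
  have : Complex.re ∘ (fun p : ℝ × ℝ => (p.1 : ℂ) + (p.2 : ℂ) * Complex.I) = Prod.fst := by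
    ext p; simp
  rw [this, ← Measure.fst, Measure.fst_prod]

lemma map_im_stdComplexGaussian :
    stdComplexGaussian.map Complex.im = gaussianReal 0 (1 / 2) := by
  unfold stdComplexGaussian
  rw [Measure.map_map (by fun_prop) (by fun_prop)]
  have : Complex.im ∘ (fun p : ℝ × ℝ => (p.1 : ℂ) + (p.2 : ℂ) * Complex.I) = Prod.snd := by
    ext p; simp
  rw [this, ← Measure.snd, Measure.snd_prod]

lemma integrable_abs_pow_gaussianReal (v : NNReal) (k : ℕ) :
    Integrable (fun x : ℝ => |x| ^ k) (gaussianReal 0 v) := by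
  have h := (memLp_id_gaussianReal (μ := 0) (v := v) (k : NNReal)).integrable_norm_pow'
  simpa using h

lemma integrable_norm_pow_stdComplexGaussian (k : ℕ) :
    Integrable (fun z : ℂ => ‖z‖ ^ k) stdComplexGaussian := by
  have h1 : Integrable (fun z : ℂ => |z.re| ^ k) stdComplexGaussian := by
    have := integrable_abs_pow_gaussianReal (1 / 2) k
    rw [← map_re_stdComplexGaussian] at this
    exact this.comp_measurable (by fun_prop)
  have h2 : Integrable (fun z : ℂ => |z.im| ^ k) stdComplexGaussian := by
    have := integrable_abs_pow_gaussianReal (1 / 2) k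
    rw [← map_im_stdComplexGaussian] at this
    exact this.comp_measurable (by fun_prop)
  refine ((h1.add h2).const_mul (2 ^ k)).mono' (by fun_prop) (ae_of_all _ fun z => ?_)
  rw [Real.norm_of_nonneg (by positivity)]
  simp only [Pi.add_apply]
  calc ‖z‖ ^ k ≤ (|z.re| + |z.im|) ^ k := by gcongr; exact Complex.norm_le_abs_re_add_abs_im z
    _ ≤ 2 ^ (k - 1) * (|z.re| ^ k + |z.im| ^ k) :=
        add_pow_le (abs_nonneg _) (abs_nonneg _) k
    _ ≤ 2 ^ k * (|z.re| ^ k + |z.im| ^ k) := by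
        gcongr
        · norm_num
        · omega

lemma map_neg_stdComplexGaussian :
    stdComplexGaussian.map (fun z => -z) = stdComplexGaussian := by
  refine Measure.ext_of_lintegral _ fun φ hφ => ?_
  rw [lintegral_map hφ (by fun_prop), stdComplexGaussian_eq_withDensity,
    lintegral_withDensity_eq_lintegral_mul _ (by fun_prop) (by fun_prop),
    lintegral_withDensity_eq_lintegral_mul _ (by fun_prop) hφ,
    ← lintegral_neg_eq_self]
  refine lintegral_congr fun z => ?_
  simp [complexGaussianDensity]

lemma integral_odd_stdComplexGaussian {g : ℂ → ℝ} (hodd : ∀ z, g (-z) = -g z) :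
    ∫ z, g z ∂stdComplexGaussian = 0 := by
  have h : ∫ z, g z ∂stdComplexGaussian = ∫ z, g (-z) ∂stdComplexGaussian := by
    conv_lhs => rw [← map_neg_stdComplexGaussian]
    exact (Homeomorph.neg ℂ).isClosedEmbedding.measurableEmbedding.integral_map g
  simp_rw [hodd, integral_neg] at h
  exact self_eq_neg.1 h

lemma integral_sq_gaussianReal : ∫ x, x ^ 2 ∂(gaussianReal 0 (1 / 2)) = 1 / 2 := by
  have h := variance_id_gaussianReal (μ := 0) (v := 1 / 2)
  rw [variance_of_integral_eq_zero (by fun_prop) (by simp)] at h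
  simpa using h

lemma integral_re_sq_stdComplexGaussian : ∫ z : ℂ, z.re ^ 2 ∂stdComplexGaussian = 1 / 2 := by
  rw [← integral_sq_gaussianReal, ← map_re_stdComplexGaussian,
    integral_map (by fun_prop) (by fun_prop)]

lemma integral_im_sq_stdComplexGaussian : ∫ z : ℂ, z.im ^ 2 ∂stdComplexGaussian = 1 / 2 := by
  rw [← integral_sq_gaussianReal, ← map_im_stdComplexGaussian,
    integral_map (by fun_prop) (by fun_prop)]

lemma integral_re_mul_im_stdComplexGaussian :
    ∫ z : ℂ, z.re * z.im ∂stdComplexGaussian = 0 := by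
  unfold stdComplexGaussian
  rw [integral_map (by fun_prop) (by fun_prop)]
  simp only [Complex.add_re, Complex.ofReal_re, Complex.mul_re, Complex.I_re, mul_zero,
    Complex.ofReal_im, Complex.I_im, mul_one, sub_self, add_zero, Complex.add_im, Complex.mul_im,
    zero_add]
  rw [integral_prod_mul (fun x : ℝ => x) (fun x : ℝ => x)]
  simp

lemma abs_re_mul_le (c z : ℂ) : |(c * z).re| ≤ ‖c‖ * ‖z‖ :=
  (Complex.abs_re_le_norm _).trans_eq (norm_mul _ _)

lemma integrable_re_mul (c : ℂ) : Integrable (fun z : ℂ => (c * z).re) stdComplexGaussian :=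
  ((integrable_norm_pow_stdComplexGaussian 1).const_mul ‖c‖).mono'
    (by fun_prop) (ae_of_all _ fun z => by simpa using abs_re_mul_le c z)

lemma integrable_re_mul_sq (c : ℂ) :
    Integrable (fun z : ℂ => (c * z).re ^ 2) stdComplexGaussian := by
  refine ((integrable_norm_pow_stdComplexGaussian 2).const_mul (‖c‖ ^ 2)).mono'
    (by fun_prop) (ae_of_all _ fun z => ?_)
  rw [norm_pow, ← mul_pow]
  gcongr
  exact abs_re_mul_le c z

lemma integral_re_mul (c : ℂ) : ∫ z : ℂ, (c * z).re ∂stdComplexGaussian = 0 :=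
  integral_odd_stdComplexGaussian fun z => by simp

lemma integral_re_mul_sq (c : ℂ) :
    ∫ z : ℂ, (c * z).re ^ 2 ∂stdComplexGaussian = ‖c‖ ^ 2 / 2 := by
  have h : ∀ z : ℂ, (c * z).re ^ 2
      = c.re ^ 2 * z.re ^ 2 + c.im ^ 2 * z.im ^ 2 - 2 * c.re * c.im * (z.re * z.im) := by
    intro z; rw [Complex.mul_re]; ring
  simp_rw [h]
  have i1 : Integrable (fun z : ℂ => z.re ^ 2) stdComplexGaussian := by
    simpa using integrable_re_mul_sq 1
  have i2 : Integrable (fun z : ℂ => z.im ^ 2) stdComplexGaussian := by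
    simpa using integrable_re_mul_sq Complex.I
  have i3 : Integrable (fun z : ℂ => z.re * z.im) stdComplexGaussian := by
    refine (integrable_norm_pow_stdComplexGaussian 2).mono' (by fun_prop) (ae_of_all _ fun z => ?_)
    rw [norm_mul, sq]
    gcongr
    · exact Complex.abs_re_le_norm z
    · exact Complex.abs_im_le_norm z
  rw [integral_sub, integral_add, integral_const_mul, integral_const_mul, integral_const_mul,
    integral_re_sq_stdComplexGaussian, integral_im_sq_stdComplexGaussian,
    integral_re_mul_im_stdComplexGaussian, ← Complex.normSq_eq_norm_sq, Complex.normSq_apply]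
  · ring
  · exact i1.const_mul _
  · exact i2.const_mul _
  · exact (i1.const_mul _).add (i2.const_mul _)
  · exact i3.const_mul _

lemma affine_sq_eq (a b : ℝ) (c z : ℂ) : (a + b * (c * z).re) ^ 2
    = a ^ 2 + 2 * a * b * (c * z).re + b ^ 2 * (c * z).re ^ 2 := by ring

lemma integrable_affine_sq (a b : ℝ) (c : ℂ) :
    Integrable (fun z : ℂ => (a + b * (c * z).re) ^ 2) stdComplexGaussian := by
  simp_rw [affine_sq_eq]
  exact ((integrable_const _).add ((integrable_re_mul c).const_mul _)).add
    ((integrable_re_mul_sq c).const_mul _)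

/-- Evaluates the noise average of `|V|²` for the test variables below, whose real and imaginary
parts are affine in real-linear functions of the noise. -/
lemma integral_affine_sq (a b : ℝ) (c : ℂ) :
    ∫ z : ℂ, (a + b * (c * z).re) ^ 2 ∂stdComplexGaussian = a ^ 2 + b ^ 2 * (‖c‖ ^ 2 / 2) := by
  simp_rw [affine_sq_eq]
  have i1 := (integrable_re_mul c).const_mul (2 * a * b)
  have i2 := (integrable_re_mul_sq c).const_mul (b ^ 2)
  have i0 : Integrable (fun z : ℂ => a ^ 2 + 2 * a * b * (c * z).re) stdComplexGaussian :=
    (integrable_const _).add i1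
  rw [integral_add i0 i2, integral_add (integrable_const _) i1,
    integral_const_mul, integral_const_mul, integral_re_mul, integral_re_mul_sq]
  simp

lemma integral_norm_sq_mul (c : ℂ) :
    ∫ z : ℂ, ‖c * z‖ ^ 2 ∂stdComplexGaussian = ‖c‖ ^ 2 := by
  have h : ∀ z : ℂ, ‖c * z‖ ^ 2 = (c * z).re ^ 2 + (-Complex.I * c * z).re ^ 2 := by
    intro z
    rw [← Complex.normSq_eq_norm_sq, Complex.normSq_apply]
    simp
    ring
  simp_rw [h]
  rw [integral_add (integrable_re_mul_sq c) (integrable_re_mul_sq _), integral_re_mul_sq,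
    integral_re_mul_sq]
  simp

/-! ### Mean square error of the channel -/

lemma measurable_channelOutput (h₀ : ℂ) (snr : ℝ) : Measurable (channelOutput h₀ snr) := by
  unfold channelOutput; fun_prop

lemma channelOutput_eq (h₀ : ℂ) (snr : ℝ) :
    channelOutput h₀ snr = fun xn => ((√snr : ℝ) : ℂ) * h₀ * xn.1 + xn.2 := rfl

lemma condMMSE_nonneg (PX : Measure ℂ) (h₀ : ℂ) (snr : ℝ) : 0 ≤ condMMSE PX h₀ snr :=
  integral_nonneg fun _ => by positivity

lemma memLp_two_of_integrable_norm_sq {Ω : Type*} [MeasurableSpace Ω] {μ : Measure Ω} {g : Ω → ℂ}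
    (hg : AEStronglyMeasurable g μ) (h : Integrable (fun ω => ‖g ω‖ ^ 2) μ) : MemLp g 2 μ :=
  (memLp_two_iff_integrable_sq_norm hg).2 h

lemma memLp_fst_prod {PX : Measure ℂ} [IsProbabilityMeasure PX] (hX : MemLp id 2 PX) (h₀ : ℂ) :
    MemLp (fun xn : ℂ × ℂ => h₀ * xn.1) 2 (PX.prod stdComplexGaussian) :=
  (hX.comp_fst stdComplexGaussian).const_mul h₀

lemma memLp_snd_prod (PX : Measure ℂ) [IsProbabilityMeasure PX] (c : ℂ) :
    MemLp (fun xn : ℂ × ℂ => c * xn.2) 2 (PX.prod stdComplexGaussian) := by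
  have h : MemLp (id : ℂ → ℂ) 2 stdComplexGaussian :=
    memLp_two_of_integrable_norm_sq (by fun_prop) (integrable_norm_pow_stdComplexGaussian 2)
  exact (h.comp_snd PX).const_mul c

lemma condMMSE_le {PX : Measure ℂ} [IsProbabilityMeasure PX] (hX : MemLp id 2 PX) (h₀ : ℂ)
    (snr : ℝ) {e : ℂ → ℂ} (he : Measurable e)
    (he2 : MemLp (fun xn => e (channelOutput h₀ snr xn)) 2 (PX.prod stdComplexGaussian)) :
    condMMSE PX h₀ snr ≤ ∫ xn : ℂ × ℂ, ‖h₀ * xn.1 - e (channelOutput h₀ snr xn)‖ ^ 2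
      ∂(PX.prod stdComplexGaussian) := by
  refine integral_norm_sq_sub_condExp_le (measurable_channelOutput h₀ snr).comap_le
    (memLp_fst_prod hX h₀) he2 ?_
  exact (he.comp (comap_measurable _)).stronglyMeasurable

lemma le_condMMSE {PX : Measure ℂ} [IsProbabilityMeasure PX] (hX : MemLp id 2 PX) (h₀ : ℂ)
    (snr : ℝ) {V : ℂ × ℂ → ℂ} (hVm : Measurable V) (hV : MemLp V 2 (PX.prod stdComplexGaussian))
    (h : ∀ y, ∫ x, (complexGaussianDensity (y - (√snr : ℝ) * h₀ * x) : ℂ)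
      * V (x, y - (√snr : ℝ) * h₀ * x) ∂PX = 0) :
    ‖∫ xn, starRingEnd ℂ (V xn) * (h₀ * xn.1) ∂(PX.prod stdComplexGaussian)‖ ^ 2
      ≤ (∫ xn, ‖V xn‖ ^ 2 ∂(PX.prod stdComplexGaussian)) * condMMSE PX h₀ snr := by
  refine norm_sq_integral_le_of_condExp_eq_zero (measurable_channelOutput h₀ snr).comap_le
    hV (memLp_fst_prod hX h₀) ?_
  exact condExp_eq_zero_of_posterior PX _ V hVm (hV.integrable one_le_two) h

/-- Gaussian inputs: the estimator is linear. -/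
lemma condMMSE_stdComplexGaussian (h₀ : ℂ) {snr : ℝ} (hs : 0 ≤ snr) :
    condMMSE stdComplexGaussian h₀ snr = ‖h₀‖ ^ 2 / (1 + ‖h₀‖ ^ 2 * snr) := by
  set κ : ℂ := (√snr : ℝ) * h₀ with hκ
  have hρ : ‖κ‖ ^ 2 = ‖h₀‖ ^ 2 * snr := by
    rw [hκ, norm_mul, mul_pow, Complex.norm_real, Real.norm_of_nonneg (by positivity),
      Real.sq_sqrt hs, mul_comm]
  -- `V` is uncorrelated with the output `κ x + n`, hence for Gaussian variables its posterior mean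
  -- is zero.
  set V : ℂ × ℂ → ℂ := fun xn => xn.1 - starRingEnd ℂ κ * xn.2 with hV
  have hX : MemLp (id : ℂ → ℂ) 2 stdComplexGaussian :=
    memLp_two_of_integrable_norm_sq (by fun_prop) (integrable_norm_pow_stdComplexGaussian 2)
  have hVm : Measurable V := by fun_prop
  have hVL : MemLp V 2 (stdComplexGaussian.prod stdComplexGaussian) := by
    have := (memLp_fst_prod hX 1).sub (memLp_snd_prod stdComplexGaussian (starRingEnd ℂ κ))
    simpa [hV, Pi.sub_def] using this
  have hd : (1 + ‖κ‖ ^ 2 : ℝ) ≠ 0 := by positivity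
  have hdC : (1 + (‖κ‖ : ℂ) ^ 2) ≠ 0 := by exact_mod_cast hd
  have hκκ : starRingEnd ℂ κ * κ = (‖κ‖ : ℂ) ^ 2 := by
    rw [mul_comm, Complex.mul_conj, Complex.normSq_eq_norm_sq]; norm_cast
  have hcond : (stdComplexGaussian.prod stdComplexGaussian)[V | MeasurableSpace.comap
      (channelOutput h₀ snr) inferInstance]
      =ᵐ[stdComplexGaussian.prod stdComplexGaussian] 0 := by
    refine condExp_eq_zero_of_posterior stdComplexGaussian κ V hVm (hVL.integrable one_le_two) ?_
    intro y
    have hden : Measurable fun z => ENNReal.ofReal (complexGaussianDensity z) := by fun_prop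
    conv_lhs => rw [stdComplexGaussian_eq_withDensity]
    rw [integral_withDensity_eq_integral_toReal_smul hden (ae_of_all _ fun _ => ENNReal.ofReal_lt_top)]
    -- Completing the square in `|x|² + |y - κ x|²` centres the posterior at `c`. About this centre
    -- the posterior density is even and `V` is odd.
    set c : ℂ := starRingEnd ℂ κ * y / (1 + (‖κ‖ : ℂ) ^ 2) with hc
    set K : ℂ → ℂ := fun x => (ENNReal.ofReal (complexGaussianDensity x)).toReal •
      ((complexGaussianDensity (y - κ * x) : ℂ) * V (x, y - κ * x)) with hK
    have hKodd : ∀ x, K (-x + c) = - K (x + c) := by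
      intro x
      have h1 : ∀ x, complexGaussianDensity (x + c) * complexGaussianDensity (y - κ * (x + c))
          = Real.pi⁻¹ * Real.pi⁻¹ * Real.exp (-((1 + ‖κ‖ ^ 2) * ‖x‖ ^ 2)
            - (‖y‖ ^ 2 - (1 + ‖κ‖ ^ 2) * ‖c‖ ^ 2)) := by
        intro x
        unfold complexGaussianDensity
        rw [mul_mul_mul_comm, ← Real.exp_add]
        congr 2
        have hcy : starRingEnd ℂ κ * y = c * (1 + (‖κ‖ : ℂ) ^ 2) := by
          rw [hc]; field_simp
        have hre := congrArg Complex.re hcy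
        have him := congrArg Complex.im hcy
        have hk2 : ‖κ‖ ^ 2 = κ.re * κ.re + κ.im * κ.im := by
          rw [← Complex.normSq_eq_norm_sq, Complex.normSq_apply]
        have hk2' : (1 + (‖κ‖ : ℂ) ^ 2) = ((1 + (κ.re * κ.re + κ.im * κ.im) : ℝ) : ℂ) := by
          rw [← hk2]; push_cast; ring
        rw [hk2'] at hre him
        rw [Complex.re_mul_ofReal] at hre
        rw [Complex.im_mul_ofReal] at him
        simp only [Complex.mul_re, Complex.conj_re, Complex.conj_im, Complex.mul_im] at hre him
        rw [hk2]
        simp only [← Complex.normSq_eq_norm_sq, Complex.normSq_apply, Complex.add_re,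
          Complex.add_im, Complex.sub_re, Complex.sub_im, Complex.mul_re, Complex.mul_im]
        linear_combination (2 * (x.re + c.re)) * hre + (2 * (x.im + c.im)) * him
      have h2 : ∀ x, V (x + c, y - κ * (x + c)) = (1 + (‖κ‖ : ℂ) ^ 2) * x := by
        intro x
        have hcy : starRingEnd ℂ κ * y = c * (1 + (‖κ‖ : ℂ) ^ 2) := by
          rw [hc]; field_simp
        simp only [hV]
        linear_combination (x + c) * hκκ - hcy
      have h3 : ∀ x, K (x + c) = ((complexGaussianDensity (x + c)
          * complexGaussianDensity (y - κ * (x + c)) : ℝ) : ℂ) * ((1 + (‖κ‖ : ℂ) ^ 2) * x) := by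
        intro x
        simp only [hK]
        rw [h2, ENNReal.toReal_ofReal (complexGaussianDensity_nonneg _)]
        push_cast
        rw [Complex.real_smul]
        ring
      rw [h3, h3, h1, h1, norm_neg]
      ring
    have h4 : ∫ x, K x = ∫ x, K (x + c) := (integral_add_right_eq_self K c).symm
    have h5 : ∫ x, K (x + c) = ∫ x, K (-x + c) :=
      (integral_neg_eq_self (fun x => K (x + c)) volume).symm
    have h6 : ∫ x, K (-x + c) = - ∫ x, K (x + c) := by
      simp_rw [hKodd, integral_neg]
    rw [h6] at h5
    rw [h4]
    exact self_eq_neg.1 h5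
  -- `A` and `D` are the coefficients in `h₀ x = A y + D V`. The first summand is the estimate and
  -- the second the error.
  set A : ℂ := h₀ * starRingEnd ℂ κ / (1 + (‖κ‖ : ℂ) ^ 2) with hA
  set D : ℂ := h₀ / (1 + (‖κ‖ : ℂ) ^ 2) with hD
  have hdecomp : (fun xn : ℂ × ℂ => h₀ * xn.1)
      = (fun xn => A * channelOutput h₀ snr xn) + fun xn => D * V xn := by
    ext xn
    simp only [Pi.add_apply, channelOutput_eq, hA, hD, hV, ← hκ]
    field_simp
    linear_combination (-h₀ * xn.1) * hκκ
  have hYL : MemLp (fun xn => A * channelOutput h₀ snr xn) 2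
      (stdComplexGaussian.prod stdComplexGaussian) := by
    have := (memLp_fst_prod hX (A * κ)).add (memLp_snd_prod stdComplexGaussian A)
    refine this.ae_eq (ae_of_all _ fun xn => ?_)
    simp only [Pi.add_apply, channelOutput_eq, ← hκ]
    ring
  have hle := (measurable_channelOutput h₀ snr).comap_le
  have hce : (stdComplexGaussian.prod stdComplexGaussian)[fun xn : ℂ × ℂ => h₀ * xn.1 |
      MeasurableSpace.comap (channelOutput h₀ snr) inferInstance]
      =ᵐ[stdComplexGaussian.prod stdComplexGaussian] fun xn => A * channelOutput h₀ snr xn := by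
    rw [hdecomp]
    refine (condExp_add (hYL.integrable one_le_two)
      ((hVL.const_mul D).integrable one_le_two) _).trans ?_
    have e1 := condExp_of_stronglyMeasurable (μ := stdComplexGaussian.prod stdComplexGaussian) hle
      ((comap_measurable (channelOutput h₀ snr)).const_mul A).stronglyMeasurable
      (hYL.integrable one_le_two)
    have e2 := condExp_smul (μ := stdComplexGaussian.prod stdComplexGaussian) D V
      (MeasurableSpace.comap (channelOutput h₀ snr) inferInstance)
    have e3 : (fun xn => D * V xn) = D • V := rfl
    rw [e1, e3]
    filter_upwards [e2, hcond] with xn h1 h2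
    simp [h1, h2]
  unfold condMMSE
  have hint : ∫ xn : ℂ × ℂ, ‖h₀ * xn.1 -
      (condExp (MeasurableSpace.comap (channelOutput h₀ snr) inferInstance)
        (stdComplexGaussian.prod stdComplexGaussian) (fun xn : ℂ × ℂ => h₀ * xn.1)) xn‖ ^ 2
      ∂(stdComplexGaussian.prod stdComplexGaussian)
      = ∫ xn : ℂ × ℂ, ‖D * V xn‖ ^ 2 ∂(stdComplexGaussian.prod stdComplexGaussian) := by
    refine integral_congr_ae ?_
    filter_upwards [hce] with xn h1
    have := congrFun hdecomp xn
    simp only [Pi.add_apply] at this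
    rw [h1, this, add_sub_cancel_left]
  rw [hint, integral_prod _ ((hVL.const_mul D).integrable_norm_pow (by norm_num))]
  have hin : ∀ x : ℂ, ∫ n, ‖D * V (x, n)‖ ^ 2 ∂stdComplexGaussian
      = ‖D‖ ^ 2 * (‖x‖ ^ 2 + ‖κ‖ ^ 2) := by
    intro x
    have : ∀ n, ‖D * V (x, n)‖ ^ 2 = ‖D‖ ^ 2 * ((x.re + (-1) * (starRingEnd ℂ κ * n).re) ^ 2
        + (x.im + 1 * ((Complex.I * starRingEnd ℂ κ) * n).re) ^ 2) := by
      intro n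
      rw [norm_mul, mul_pow]
      congr 1
      rw [← Complex.normSq_eq_norm_sq, Complex.normSq_apply]
      simp [hV]
      ring
    simp_rw [this]
    rw [integral_const_mul, integral_add (integrable_affine_sq _ _ _) (integrable_affine_sq _ _ _), integral_affine_sq,
      integral_affine_sq]
    have : ‖x‖ ^ 2 = x.re ^ 2 + x.im ^ 2 := by
      rw [← Complex.normSq_eq_norm_sq, Complex.normSq_apply]; ring
    rw [this, norm_mul, Complex.norm_I, RCLike.norm_conj]
    ring
  simp_rw [hin]
  rw [integral_const_mul, integral_add (integrable_norm_pow_stdComplexGaussian 2)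
    (integrable_const _)]
  have h1 : ∫ z : ℂ, ‖z‖ ^ 2 ∂stdComplexGaussian = 1 := by
    simpa using integral_norm_sq_mul 1
  rw [h1]
  have hDn : ‖D‖ ^ 2 = ‖h₀‖ ^ 2 / (1 + ‖κ‖ ^ 2) ^ 2 := by
    have : (1 + (‖κ‖ : ℂ) ^ 2) = ((1 + ‖κ‖ ^ 2 : ℝ) : ℂ) := by push_cast; ring
    rw [hD, norm_div, div_pow, this, Complex.norm_real, Real.norm_of_nonneg (by positivity)]
  rw [hDn, ← hρ]
  simp
  field_simp

/-! ### Bayes formula for bounded inputs and measurability in the channel gain -/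

/-- Posterior mean of the input. -/
def posteriorMean (PX : Measure ℂ) (κy : ℂ × ℂ) : ℂ :=
  (∫ x, (complexGaussianDensity (κy.2 - κy.1 * x) : ℂ) * x ∂PX) /
    ((∫ x, complexGaussianDensity (κy.2 - κy.1 * x) ∂PX : ℝ) : ℂ)

lemma measurable_posteriorMean (PX : Measure ℂ) [IsProbabilityMeasure PX] :
    Measurable (posteriorMean PX) := by
  have h1 : StronglyMeasurable fun κy : ℂ × ℂ =>
      ∫ x, (complexGaussianDensity (κy.2 - κy.1 * x) : ℂ) * x ∂PX := by
    refine StronglyMeasurable.integral_prod_right'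
      (f := fun p : (ℂ × ℂ) × ℂ => (complexGaussianDensity (p.1.2 - p.1.1 * p.2) : ℂ) * p.2) ?_
    have : Continuous fun p : (ℂ × ℂ) × ℂ =>
      (complexGaussianDensity (p.1.2 - p.1.1 * p.2) : ℂ) * p.2 := by fun_prop
    exact this.stronglyMeasurable
  have h2 : StronglyMeasurable fun κy : ℂ × ℂ =>
      ∫ x, complexGaussianDensity (κy.2 - κy.1 * x) ∂PX := by
    refine StronglyMeasurable.integral_prod_right'
      (f := fun p : (ℂ × ℂ) × ℂ => complexGaussianDensity (p.1.2 - p.1.1 * p.2)) ?_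
    have : Continuous fun p : (ℂ × ℂ) × ℂ => complexGaussianDensity (p.1.2 - p.1.1 * p.2) := by
      fun_prop
    exact this.stronglyMeasurable
  exact h1.measurable.div (Complex.measurable_ofReal.comp h2.measurable)

section Bounded

variable {PX : Measure ℂ} [IsProbabilityMeasure PX]

/-- The constant 2 is a common bound for the three bounded constellations, whose points have modulus
at most `√3`. -/
lemma memLp_id_of_bounded (hb : ∀ᵐ x ∂PX, ‖x‖ ≤ 2) : MemLp (id : ℂ → ℂ) 2 PX :=
  MemLp.of_bound (by fun_prop) 2 hb

lemma integrable_density (κ y : ℂ) :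
    Integrable (fun x => complexGaussianDensity (y - κ * x)) PX := by
  refine (integrable_const (1 : ℝ)).mono' (by fun_prop) (ae_of_all _ fun x => ?_)
  rw [Real.norm_of_nonneg (complexGaussianDensity_nonneg _)]
  exact complexGaussianDensity_le_one _

lemma integral_density_pos (κ y : ℂ) : 0 < ∫ x, complexGaussianDensity (y - κ * x) ∂PX := by
  rw [integral_pos_iff_support_of_nonneg (fun _ => complexGaussianDensity_nonneg _)
    (integrable_density κ y)]
  have : Function.support (fun x => complexGaussianDensity (y - κ * x)) = Set.univ := by
    ext x; simp [(complexGaussianDensity_pos _).ne']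
  simp [this]

lemma integrable_density_mul (hb : ∀ᵐ x ∂PX, ‖x‖ ≤ 2) (κ y : ℂ) :
    Integrable (fun x => (complexGaussianDensity (y - κ * x) : ℂ) * x) PX := by
  refine (integrable_const (2 : ℝ)).mono' (by fun_prop) ?_
  filter_upwards [hb] with x hx
  rw [norm_mul, Complex.norm_real, Real.norm_of_nonneg (complexGaussianDensity_nonneg _)]
  calc _ ≤ 1 * (2 : ℝ) := by
        gcongr
        exact complexGaussianDensity_le_one _
    _ = 2 := one_mul _

lemma norm_posteriorMean_le (hb : ∀ᵐ x ∂PX, ‖x‖ ≤ 2) (κy : ℂ × ℂ) :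
    ‖posteriorMean PX κy‖ ≤ 2 := by
  have hpos := integral_density_pos (PX := PX) κy.1 κy.2
  unfold posteriorMean
  rw [norm_div, Complex.norm_real, Real.norm_of_nonneg hpos.le, div_le_iff₀ hpos,
    ← integral_const_mul]
  refine (norm_integral_le_integral_norm _).trans ?_
  refine integral_mono_ae (integrable_density_mul hb _ _).norm
    ((integrable_density _ _).const_mul _) ?_
  filter_upwards [hb] with x hx
  rw [norm_mul, Complex.norm_real, Real.norm_of_nonneg (complexGaussianDensity_nonneg _), mul_comm]
  gcongr
  exact complexGaussianDensity_nonneg _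

/-- Conditional expectations are chosen separately for each `h₀`, up to null sets. Bayes' formula
supplies a version that is jointly measurable in gain and output, which makes the error measurable
in `h₀`. -/
lemma condMMSE_eq_posteriorMean (hb : ∀ᵐ x ∂PX, ‖x‖ ≤ 2) (h₀ : ℂ) (snr : ℝ) :
    condMMSE PX h₀ snr = ∫ xn : ℂ × ℂ, ‖h₀ * xn.1 -
      h₀ * posteriorMean PX ((√snr : ℝ) * h₀, channelOutput h₀ snr xn)‖ ^ 2
      ∂(PX.prod stdComplexGaussian) := by
  set κ : ℂ := (√snr : ℝ) * h₀ with hκ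
  set e : ℂ → ℂ := fun y => posteriorMean PX (κ, y) with he
  have hem : Measurable e := (measurable_posteriorMean PX).comp (by fun_prop)
  have hYm := measurable_channelOutput h₀ snr
  set V : ℂ × ℂ → ℂ := fun xn => xn.1 - e (channelOutput h₀ snr xn) with hV
  have heYm : Measurable fun xn => e (channelOutput h₀ snr xn) := hem.comp hYm
  have heY : Integrable (fun xn => e (channelOutput h₀ snr xn)) (PX.prod stdComplexGaussian) :=
    Integrable.of_bound heYm.aestronglyMeasurable 2
      (ae_of_all _ fun xn => norm_posteriorMean_le hb _)
  have hX1 : Integrable (fun xn : ℂ × ℂ => xn.1) (PX.prod stdComplexGaussian) := by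
    simpa using (memLp_fst_prod (memLp_id_of_bounded hb) 1).integrable one_le_two
  have hVm : Measurable V := measurable_fst.sub heYm
  have hVi : Integrable V (PX.prod stdComplexGaussian) := hX1.sub heY
  have hcond : (PX.prod stdComplexGaussian)[V | MeasurableSpace.comap
      (channelOutput h₀ snr) inferInstance] =ᵐ[PX.prod stdComplexGaussian] 0 := by
    refine condExp_eq_zero_of_posterior PX κ V hVm hVi ?_
    intro y
    have h1 : ∀ x, V (x, y - κ * x) = x - e y := by
      intro x
      simp only [hV, channelOutput_eq, ← hκ]
      congr 2
      ring
    simp_rw [h1, mul_sub]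
    have i2 : Integrable (fun x => (complexGaussianDensity (y - κ * x) : ℂ)) PX :=
      (integrable_density κ y).ofReal
    rw [integral_sub (integrable_density_mul hb κ y) (i2.mul_const _),
      integral_mul_const, integral_complex_ofReal]
    have hne : ((∫ x, complexGaussianDensity (y - κ * x) ∂PX : ℝ) : ℂ) ≠ 0 :=
      Complex.ofReal_ne_zero.2 (integral_density_pos κ y).ne'
    simp only [he, posteriorMean]
    rw [mul_div_cancel₀ _ hne, sub_self]
  have hle := hYm.comap_le
  have hdecomp : (fun xn : ℂ × ℂ => h₀ * xn.1)
      = (fun xn => h₀ * e (channelOutput h₀ snr xn)) + h₀ • V := by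
    ext xn
    simp [hV]
    ring
  have hce : (PX.prod stdComplexGaussian)[fun xn : ℂ × ℂ => h₀ * xn.1 |
      MeasurableSpace.comap (channelOutput h₀ snr) inferInstance]
      =ᵐ[PX.prod stdComplexGaussian] fun xn => h₀ * e (channelOutput h₀ snr xn) := by
    rw [hdecomp]
    refine (condExp_add (heY.const_mul h₀) (hVi.smul h₀) _).trans ?_
    have e1 := condExp_of_stronglyMeasurable (μ := PX.prod stdComplexGaussian) hle
      ((hem.comp (comap_measurable (channelOutput h₀ snr))).const_mul h₀).stronglyMeasurable
      (heY.const_mul h₀)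
    have e2 := condExp_smul (μ := PX.prod stdComplexGaussian) h₀ V
      (MeasurableSpace.comap (channelOutput h₀ snr) inferInstance)
    simp only [Function.comp_def] at e1
    rw [e1]
    filter_upwards [e2, hcond] with xn h1 h2
    simp [h1, h2]
  unfold condMMSE
  refine integral_congr_ae ?_
  filter_upwards [hce] with xn h1
  rw [h1]

lemma measurable_condMMSE (hb : ∀ᵐ x ∂PX, ‖x‖ ≤ 2) (snr : ℝ) :
    Measurable fun h₀ => condMMSE PX h₀ snr := by
  simp_rw [condMMSE_eq_posteriorMean hb]
  refine StronglyMeasurable.measurable (StronglyMeasurable.integral_prod_right'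
    (f := fun p : ℂ × (ℂ × ℂ) => ‖p.1 * p.2.1 -
      p.1 * posteriorMean PX ((√snr : ℝ) * p.1, channelOutput p.1 snr p.2)‖ ^ 2) ?_)
  refine Measurable.stronglyMeasurable ?_
  have h1 : Measurable fun p : ℂ × (ℂ × ℂ) =>
      posteriorMean PX ((√snr : ℝ) * p.1, channelOutput p.1 snr p.2) := by
    refine (measurable_posteriorMean PX).comp ?_
    unfold channelOutput
    fun_prop
  fun_prop

/-- The zero estimator achieves this. The bound serves both for integrability over the gain and for
the regime of small `|h₀|² snr`. -/
lemma condMMSE_le_four_mul (hb : ∀ᵐ x ∂PX, ‖x‖ ≤ 2) (h₀ : ℂ) (snr : ℝ) :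
    condMMSE PX h₀ snr ≤ 4 * ‖h₀‖ ^ 2 := by
  have h := condMMSE_le (memLp_id_of_bounded hb) h₀ snr (e := fun _ => 0) measurable_const
    MemLp.zero
  refine h.trans ?_
  have hb' : ∀ᵐ xn : ℂ × ℂ ∂(PX.prod stdComplexGaussian), ‖xn.1‖ ≤ 2 :=
    Measure.quasiMeasurePreserving_fst.ae hb
  calc _ ≤ ∫ xn : ℂ × ℂ, 4 * ‖h₀‖ ^ 2 ∂(PX.prod stdComplexGaussian) := by
        refine integral_mono_of_nonneg (ae_of_all _ fun _ => by positivity)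
          (integrable_const _) ?_
        filter_upwards [hb'] with xn hx
        simp only [sub_zero, norm_mul, mul_pow]
        nlinarith [norm_nonneg xn.1, sq_nonneg ‖h₀‖, mul_nonneg (sq_nonneg ‖h₀‖) (norm_nonneg xn.1),
          mul_le_mul_of_nonneg_left (pow_le_pow_left₀ (norm_nonneg xn.1) hx 2) (sq_nonneg ‖h₀‖)]
    _ = _ := by simp

end Bounded

/-! ### Derivatives of the Gaussian density along curves -/

/-- The real factor is the logarithmic derivative of the density along the curve. It is the score
from which all test variables `V` of the lower bounds are built. -/
lemma hasDerivAt_density {γ : ℝ → ℂ} {γ' : ℂ} {t : ℝ} (hγ : HasDerivAt γ γ' t) (y κ : ℂ) :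
    HasDerivAt (fun t => (complexGaussianDensity (y - κ * γ t) : ℂ))
      ((complexGaussianDensity (y - κ * γ t) : ℂ)
        * (2 * (starRingEnd ℂ (κ * γ') * (y - κ * γ t)).re : ℝ)) t := by
  have h1 : HasDerivAt (fun t => y - κ * γ t) (-(κ * γ')) t := by
    simpa using (hγ.const_mul κ).const_sub y
  have h2 := h1.norm_sq
  have h3 := (h2.neg.exp.const_mul Real.pi⁻¹).ofReal_comp
  refine h3.congr_deriv ?_
  unfold complexGaussianDensity
  rw [← Complex.ofReal_mul]
  congr 1
  rw [Complex.inner]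
  simp only [Pi.neg_apply, Complex.mul_re, Complex.conj_re, Complex.conj_im, Complex.neg_re, Complex.neg_im,
    Complex.sub_re, Complex.sub_im]
  ring

/-! ### The uniform law on the circle -/

instance : IsProbabilityMeasure pskLaw := by
  unfold pskLaw
  have : IsProbabilityMeasure (cond (volume : Measure ℝ) (Set.Ico (0 : ℝ) (2 * Real.pi))) :=
    cond_isProbabilityMeasure_of_finite (by simp [Real.pi_pos])
      (by rw [Real.volume_Ico]; exact ENNReal.ofReal_ne_top)
  exact Measure.isProbabilityMeasure_map (by fun_prop)

lemma norm_eq_one_ae_pskLaw : ∀ᵐ x ∂pskLaw, ‖x‖ = 1 := by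
  unfold pskLaw
  rw [ae_map_iff (by fun_prop) (measurableSet_eq_fun (by fun_prop) (by fun_prop))]
  exact ae_of_all _ fun θ => Complex.norm_exp_ofReal_mul_I θ

lemma integral_pskLaw {E : Type*} [NormedAddCommGroup E] [NormedSpace ℝ E] {g : ℂ → E}
    (hg : AEStronglyMeasurable g pskLaw) :
    ∫ x, g x ∂pskLaw
      = (2 * Real.pi)⁻¹ • ∫ θ in (0 : ℝ)..(2 * Real.pi), g (Complex.exp ((θ : ℂ) * Complex.I)) := by
  unfold pskLaw at hg ⊢
  rw [integral_map (by fun_prop) hg, ProbabilityTheory.cond, integral_smul_measure,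
    intervalIntegral.integral_of_le (by positivity), integral_Ico_eq_integral_Ioo,
    integral_Ioc_eq_integral_Ioo]
  congr 1
  simp [Real.pi_pos.le]

lemma bounded_pskLaw : ∀ᵐ x ∂pskLaw, ‖x‖ ≤ 2 := by
  filter_upwards [norm_eq_one_ae_pskLaw] with x hx
  rw [hx]; norm_num

lemma norm_gain_sq (h₀ : ℂ) {snr : ℝ} (hs : 0 ≤ snr) :
    ‖((√snr : ℝ) : ℂ) * h₀‖ ^ 2 = ‖h₀‖ ^ 2 * snr := by
  rw [norm_mul, mul_pow, Complex.norm_real, Real.norm_of_nonneg (by positivity),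
      Real.sq_sqrt hs, mul_comm]

/-- With `x = e^(iθ)`, the density times `V` is the `θ`-derivative of the `2π`-periodic function `i
x` times the density, so `V` has posterior mean zero. Since `E V̄ h₀ x = -h₀` and `E|V|² = 1 + 2ρ`,
Cauchy–Schwarz gives the bound. -/
lemma le_condMMSE_pskLaw (h₀ : ℂ) {snr : ℝ} (hs : 0 ≤ snr) :
    ‖h₀‖ ^ 2 / (1 + 2 * (‖h₀‖ ^ 2 * snr)) ≤ condMMSE pskLaw h₀ snr := by
  set κ : ℂ := (√snr : ℝ) * h₀ with hκ
  have hρ : ‖κ‖ ^ 2 = ‖h₀‖ ^ 2 * snr := norm_gain_sq h₀ hs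
  have hXL := memLp_id_of_bounded bounded_pskLaw
  set V : ℂ × ℂ → ℂ := fun xn => xn.1 * ((-1 : ℂ) + Complex.I *
    ((2 * (starRingEnd ℂ (κ * (Complex.I * xn.1)) * xn.2).re : ℝ) : ℂ)) with hV
  have hVc : Continuous V := by fun_prop
  have hVm : Measurable V := hVc.measurable
  have hone : ∀ᵐ xn : ℂ × ℂ ∂(pskLaw.prod stdComplexGaussian), ‖xn.1‖ = 1 :=
    Measure.quasiMeasurePreserving_fst.ae norm_eq_one_ae_pskLaw
  have hVn : ∀ x n, ‖V (x, n)‖ ^ 2 = ‖x‖ ^ 2 *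
      (1 + (0 + 2 * (starRingEnd ℂ (κ * (Complex.I * x)) * n).re) ^ 2) := by
    intro x n
    simp only [hV, norm_mul, mul_pow]
    congr 1
    rw [← Complex.normSq_eq_norm_sq, Complex.normSq_apply]
    simp only [Complex.add_re, Complex.add_im, Complex.mul_re, Complex.I_re, Complex.I_im,
      Complex.ofReal_re, Complex.ofReal_im, Complex.mul_im, Complex.neg_re, Complex.neg_im,
      Complex.one_re, Complex.one_im]
    ring
  have hVi : Integrable (fun xn => ‖V xn‖ ^ 2) (pskLaw.prod stdComplexGaussian) := by
    have : Integrable (fun xn : ℂ × ℂ => 1 + 4 * ‖κ * xn.2‖ ^ 2) (pskLaw.prod stdComplexGaussian) :=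
      (integrable_const _).add (((memLp_snd_prod pskLaw κ).integrable_norm_pow (by norm_num)).const_mul 4)
    refine this.mono' (by fun_prop) ?_
    filter_upwards [hone] with xn hx
    rw [Real.norm_of_nonneg (by positivity), show xn = (xn.1, xn.2) from rfl, hVn, hx]
    have h1 := abs_re_mul_le (starRingEnd ℂ (κ * (Complex.I * xn.1))) xn.2
    rw [RCLike.norm_conj, norm_mul κ, norm_mul Complex.I, hx, Complex.norm_I, ← sq_le_sq₀ (abs_nonneg _) (by positivity),
      sq_abs] at h1
    simp only [norm_mul]
    nlinarith
  have hVL : MemLp V 2 (pskLaw.prod stdComplexGaussian) :=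
    memLp_two_of_integrable_norm_sq hVm.aestronglyMeasurable hVi
  have hpost : ∀ y, ∫ x, (complexGaussianDensity (y - κ * x) : ℂ) * V (x, y - κ * x) ∂pskLaw = 0 := by
    intro y
    rw [integral_pskLaw (by fun_prop)]
    have hexp : ∀ θ : ℝ, HasDerivAt (fun θ : ℝ => Complex.exp ((θ : ℂ) * Complex.I))
        (Complex.I * Complex.exp ((θ : ℂ) * Complex.I)) θ := by
      intro θ
      have := ((hasDerivAt_id (θ : ℂ)).mul_const Complex.I).cexp.comp_ofReal
      refine this.congr_deriv ?_
      simp; ring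
    have hder : ∀ θ : ℝ, HasDerivAt (fun θ : ℝ => (Complex.I * Complex.exp ((θ : ℂ) * Complex.I)) *
        (complexGaussianDensity (y - κ * Complex.exp ((θ : ℂ) * Complex.I)) : ℂ))
        ((complexGaussianDensity (y - κ * Complex.exp ((θ : ℂ) * Complex.I)) : ℂ) *
          V (Complex.exp ((θ : ℂ) * Complex.I), y - κ * Complex.exp ((θ : ℂ) * Complex.I))) θ := by
      intro θ
      refine (((hexp θ).const_mul Complex.I).mul (hasDerivAt_density (hexp θ) y κ)).congr_deriv ?_
      simp only [hV]
      linear_combination (complexGaussianDensity (y - κ * Complex.exp ((θ : ℂ) * Complex.I)) : ℂ)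
        * Complex.exp ((θ : ℂ) * Complex.I) * Complex.I_sq
    rw [intervalIntegral.integral_eq_sub_of_hasDerivAt (fun θ _ => hder θ)]
    · simp [Complex.exp_two_pi_mul_I]
    · refine Continuous.intervalIntegrable ?_ _ _
      fun_prop
  have key := le_condMMSE hXL h₀ snr hVm hVL hpost
  have hR0 : ∀ x : ℂ, ∫ n : ℂ, (2 * (starRingEnd ℂ (κ * (Complex.I * x)) * n).re : ℝ)
      ∂stdComplexGaussian = 0 := by
    intro x; rw [integral_const_mul, integral_re_mul, mul_zero]
  have hA : ∫ xn, starRingEnd ℂ (V xn) * (h₀ * xn.1) ∂(pskLaw.prod stdComplexGaussian) = -h₀ := by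
    have hi : Integrable (fun xn : ℂ × ℂ => starRingEnd ℂ (V xn) * (h₀ * xn.1))
        (pskLaw.prod stdComplexGaussian) := by
      have := MemLp.integrable_mul (hVL.star) (memLp_fst_prod hXL h₀)
      exact this
    rw [integral_prod _ hi]
    have hin : ∀ᵐ x ∂pskLaw, ∫ n, starRingEnd ℂ (V (x, n)) * (h₀ * x) ∂stdComplexGaussian = -h₀ := by
      filter_upwards [norm_eq_one_ae_pskLaw] with x hx
      have hxx : starRingEnd ℂ x * x = 1 := by
        rw [mul_comm, Complex.mul_conj, Complex.normSq_eq_norm_sq, hx]; simp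
      have : ∀ n, starRingEnd ℂ (V (x, n)) * (h₀ * x) = -h₀ + (-h₀ * Complex.I) *
          ((2 * (starRingEnd ℂ (κ * (Complex.I * x)) * n).re : ℝ) : ℂ) := by
        intro n
        simp only [hV]
        generalize (2 * (starRingEnd ℂ (κ * (Complex.I * x)) * n).re : ℝ) = r
        simp only [map_mul, map_add, map_neg, map_one, Complex.conj_I, Complex.conj_ofReal]
        linear_combination (h₀ * (-1 - Complex.I * r)) * hxx
      simp_rw [this]
      have i1 : Integrable (fun n : ℂ => ((2 * (starRingEnd ℂ (κ * (Complex.I * x)) * n).re : ℝ) : ℂ))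
        stdComplexGaussian := ((integrable_re_mul _).const_mul 2).ofReal
      rw [integral_add (integrable_const _) (i1.const_mul _), integral_const_mul,
        integral_complex_ofReal, hR0]
      simp
    rw [integral_congr_ae hin]
    simp
  have hB : ∫ xn, ‖V xn‖ ^ 2 ∂(pskLaw.prod stdComplexGaussian) = 1 + 2 * ‖κ‖ ^ 2 := by
    rw [integral_prod _ hVi]
    have hin : ∀ᵐ x ∂pskLaw, ∫ n, ‖V (x, n)‖ ^ 2 ∂stdComplexGaussian = 1 + 2 * ‖κ‖ ^ 2 := by
      filter_upwards [norm_eq_one_ae_pskLaw] with x hx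
      simp_rw [hVn, hx]
      rw [integral_const_mul, integral_add (integrable_const _) (integrable_affine_sq _ _ _),
        integral_affine_sq, RCLike.norm_conj, norm_mul κ, norm_mul Complex.I, hx, Complex.norm_I]
      simp
      ring
    rw [integral_congr_ae hin]
    simp
  rw [hA, hB, norm_neg, hρ] at key
  rw [div_le_iff₀ (by positivity), mul_comm]
  exact key

/-- The error of the cubic estimator `z (3 - |z|²) / 2` of a point of the unit circle. -/
lemma norm_sq_one_sub_cubic_le (η : ℂ) :
    ‖1 - (1 + η) * (3 - ((‖1 + η‖ ^ 2 : ℝ) : ℂ)) / 2‖ ^ 2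
      ≤ η.im ^ 2 - 2 * η.re * η.im ^ 2 + 9 / 2 * ‖η‖ ^ 4 + ‖η‖ ^ 6 / 2 := by
  have h1 : ‖η‖ ^ 2 = η.re ^ 2 + η.im ^ 2 := by
    rw [← Complex.normSq_eq_norm_sq, Complex.normSq_apply]; ring
  have h2 : ‖1 + η‖ ^ 2 = (1 + η.re) ^ 2 + η.im ^ 2 := by
    rw [← Complex.normSq_eq_norm_sq, Complex.normSq_apply]; simp; ring
  have e4 : ‖η‖ ^ 4 = (η.re ^ 2 + η.im ^ 2) ^ 2 := by rw [← h1]; ring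
  have e6 : ‖η‖ ^ 6 = (η.re ^ 2 + η.im ^ 2) ^ 3 := by rw [← h1]; ring
  rw [e4, e6, h2, ← Complex.normSq_eq_norm_sq, Complex.normSq_apply]
  set a := η.re
  set b := η.im
  have er : (1 - (1 + η) * (3 - (((1 + a) ^ 2 + b ^ 2 : ℝ) : ℂ)) / 2).re
      = 1 - (1 + a) * (3 - ((1 + a) ^ 2 + b ^ 2)) / 2 := by
    have : (1 + η) * (3 - (((1 + a) ^ 2 + b ^ 2 : ℝ) : ℂ)) / 2
      = (1 + η) * (((3 - ((1 + a) ^ 2 + b ^ 2)) / 2 : ℝ) : ℂ) := by push_cast; ring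
    rw [this, Complex.sub_re, Complex.re_mul_ofReal, Complex.add_re]
    simp only [Complex.one_re]
    ring
  have ei : (1 - (1 + η) * (3 - (((1 + a) ^ 2 + b ^ 2 : ℝ) : ℂ)) / 2).im
      = - b * (3 - ((1 + a) ^ 2 + b ^ 2)) / 2 := by
    have : (1 + η) * (3 - (((1 + a) ^ 2 + b ^ 2 : ℝ) : ℂ)) / 2
      = (1 + η) * (((3 - ((1 + a) ^ 2 + b ^ 2)) / 2 : ℝ) : ℂ) := by push_cast; ring
    rw [this, Complex.sub_im, Complex.im_mul_ofReal, Complex.add_im]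
    simp only [Complex.one_im]
    ring
  rw [er, ei]
  -- The real part is `(3a² + b² + a(a² + b²))/2` and the imaginary part `-b + ab + b(a² + b²)/2`.
  -- Below order four only `b² - 2ab²` survives, and the hints dominate the rest.
  nlinarith [sq_nonneg (a ^ 2 + b ^ 2), sq_nonneg a, sq_nonneg b, mul_nonneg (sq_nonneg a) (sq_nonneg b),
    sq_nonneg (a * (a ^ 2 + b ^ 2) - (3 * a ^ 2 + b ^ 2)), sq_nonneg (b * (a ^ 2 + b ^ 2) - 2 * a * b),
    mul_nonneg (sq_nonneg b) (sq_nonneg b), mul_nonneg (sq_nonneg a) (sq_nonneg a)]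

/-- The factor `(3 - |z|²)/2` is the polynomial approximation of `1/|z|` at `|z| = 1`, so the
estimator imitates the projection of `y/κ` to the circle while keeping all moments finite. To first
order it removes the radial noise and leaves the tangential one, of mean square `1/(2ρ)`. The
third-order term is odd in the noise and averages to zero, so the next contribution is of order
`ρ^(-2)`. -/
lemma condMMSE_pskLaw_le : ∃ K : ℝ, 0 ≤ K ∧ ∀ (h₀ : ℂ) (snr : ℝ), h₀ ≠ 0 → 0 < snr →
    1 ≤ ‖h₀‖ ^ 2 * snr →
    condMMSE pskLaw h₀ snr
      ≤ ‖h₀‖ ^ 2 * (1 / (2 * (‖h₀‖ ^ 2 * snr)) + K * ((‖h₀‖ ^ 2 * snr) ^ 2)⁻¹) := by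
  set M4 := ∫ z : ℂ, ‖z‖ ^ 4 ∂stdComplexGaussian with hM4
  set M6 := ∫ z : ℂ, ‖z‖ ^ 6 ∂stdComplexGaussian with hM6
  have hM4' : 0 ≤ M4 := integral_nonneg fun _ => by positivity
  have hM6' : 0 ≤ M6 := integral_nonneg fun _ => by positivity
  refine ⟨9 / 2 * M4 + M6 / 2, by positivity, ?_⟩
  intro h₀ snr hh hs hρ1
  set κ : ℂ := (√snr : ℝ) * h₀ with hκ
  have hρ : ‖κ‖ ^ 2 = ‖h₀‖ ^ 2 * snr := norm_gain_sq h₀ hs.le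
  have hκ0 : κ ≠ 0 := by
    simp [hκ, hh, Real.sqrt_ne_zero'.2 hs]
  rw [← hρ] at hρ1 ⊢
  set e : ℂ → ℂ := fun y => h₀ * ((y / κ) * (3 - ((‖y / κ‖ ^ 2 : ℝ) : ℂ)) / 2) with he
  have hec : Continuous e := by fun_prop
  have hXL := memLp_id_of_bounded bounded_pskLaw
  have hone : ∀ᵐ xn : ℂ × ℂ ∂(pskLaw.prod stdComplexGaussian), ‖xn.1‖ = 1 :=
    Measure.quasiMeasurePreserving_fst.ae norm_eq_one_ae_pskLaw
  have hkey : ∀ x n : ℂ, ‖x‖ = 1 → ‖h₀ * x - e (channelOutput h₀ snr (x, n))‖ ^ 2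
      = ‖h₀‖ ^ 2 * ‖1 - (1 + starRingEnd ℂ x / κ * n) *
        (3 - ((‖1 + starRingEnd ℂ x / κ * n‖ ^ 2 : ℝ) : ℂ)) / 2‖ ^ 2 := by
    intro x n hx
    have hxx : starRingEnd ℂ x * x = 1 := by
      rw [mul_comm, Complex.mul_conj, Complex.normSq_eq_norm_sq, hx]; simp
    have h1 : channelOutput h₀ snr (x, n) / κ = x * (1 + starRingEnd ℂ x / κ * n) := by
      simp only [channelOutput_eq, ← hκ]
      field_simp
      linear_combination (-n) * hxx
    have h2 : ‖channelOutput h₀ snr (x, n) / κ‖ = ‖1 + starRingEnd ℂ x / κ * n‖ := by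
      rw [h1, norm_mul, hx, one_mul]
    simp only [he]
    rw [h2, h1]
    have h3 : h₀ * x - h₀ * (x * (1 + starRingEnd ℂ x / κ * n) *
        (3 - ((‖1 + starRingEnd ℂ x / κ * n‖ ^ 2 : ℝ) : ℂ)) / 2)
        = h₀ * x * (1 - (1 + starRingEnd ℂ x / κ * n) *
        (3 - ((‖1 + starRingEnd ℂ x / κ * n‖ ^ 2 : ℝ) : ℂ)) / 2) := by ring
    rw [h3, norm_mul, norm_mul, hx, mul_one, mul_pow]
  have hbound : ∀ x n : ℂ, ‖x‖ = 1 → ‖h₀ * x - e (channelOutput h₀ snr (x, n))‖ ^ 2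
      ≤ ‖h₀‖ ^ 2 * ((starRingEnd ℂ x / κ * n).im ^ 2
        - 2 * (starRingEnd ℂ x / κ * n).re * (starRingEnd ℂ x / κ * n).im ^ 2
        + 9 / 2 * ‖starRingEnd ℂ x / κ * n‖ ^ 4 + ‖starRingEnd ℂ x / κ * n‖ ^ 6 / 2) := by
    intro x n hx
    rw [hkey x n hx]
    gcongr
    exact norm_sq_one_sub_cubic_le _
  have hint2 : Integrable (fun xn : ℂ × ℂ => ‖h₀ * xn.1 - e (channelOutput h₀ snr xn)‖ ^ 2)
      (pskLaw.prod stdComplexGaussian) := by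
    have hcY : Continuous fun xn : ℂ × ℂ => channelOutput h₀ snr xn := by
      unfold channelOutput; fun_prop
    have hk : ∀ k : ℕ, Integrable (fun xn : ℂ × ℂ => ‖xn.2‖ ^ k) (pskLaw.prod stdComplexGaussian) :=
      fun k => (integrable_norm_pow_stdComplexGaussian k).comp_snd pskLaw
    have hdom : Integrable (fun xn : ℂ × ℂ => ‖h₀‖ ^ 2 * (‖κ‖⁻¹ ^ 2 * ‖xn.2‖ ^ 2
        + 2 * (‖κ‖⁻¹ ^ 3 * ‖xn.2‖ ^ 3) + 9 / 2 * (‖κ‖⁻¹ ^ 4 * ‖xn.2‖ ^ 4)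
        + 1 / 2 * (‖κ‖⁻¹ ^ 6 * ‖xn.2‖ ^ 6))) (pskLaw.prod stdComplexGaussian) :=
      ((((((hk 2).const_mul _).add (((hk 3).const_mul _).const_mul _))).add
        (((hk 4).const_mul _).const_mul _)).add (((hk 6).const_mul _).const_mul _)).const_mul _
    refine hdom.mono' (by fun_prop) ?_
    filter_upwards [hone] with xn hx
    rw [Real.norm_of_nonneg (by positivity)]
    refine (hbound xn.1 xn.2 hx).trans ?_
    have hn : ‖starRingEnd ℂ xn.1 / κ * xn.2‖ = ‖κ‖⁻¹ * ‖xn.2‖ := by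
      rw [norm_mul, norm_div, RCLike.norm_conj, hx, one_div]
    have hre := Complex.abs_re_le_norm (starRingEnd ℂ xn.1 / κ * xn.2)
    have him := Complex.abs_im_le_norm (starRingEnd ℂ xn.1 / κ * xn.2)
    simp only [← mul_pow, ← hn]
    set η := starRingEnd ℂ xn.1 / κ * xn.2
    have him2 : η.im ^ 2 ≤ ‖η‖ ^ 2 := by rw [← sq_abs]; gcongr
    have h3 : -(η.re * η.im ^ 2) ≤ ‖η‖ ^ 3 := by
      calc -(η.re * η.im ^ 2) ≤ |η.re| * η.im ^ 2 := by
            nlinarith [neg_abs_le η.re, sq_nonneg η.im]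
        _ ≤ ‖η‖ * ‖η‖ ^ 2 := by gcongr
        _ = ‖η‖ ^ 3 := by ring
    refine mul_le_mul_of_nonneg_left ?_ (by positivity)
    linarith
  have he2 : MemLp (fun xn => e (channelOutput h₀ snr xn)) 2 (pskLaw.prod stdComplexGaussian) := by
    have hcY : Continuous fun xn : ℂ × ℂ => channelOutput h₀ snr xn := by
      unfold channelOutput; fun_prop
    have h1 : MemLp (fun xn : ℂ × ℂ => h₀ * xn.1 - e (channelOutput h₀ snr xn)) 2
      (pskLaw.prod stdComplexGaussian) :=
      memLp_two_of_integrable_norm_sq (by fun_prop) hint2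
    have := (memLp_fst_prod hXL h₀).sub h1
    refine this.ae_eq (ae_of_all _ fun xn => ?_)
    simp
  refine (condMMSE_le hXL h₀ snr hec.measurable he2).trans ?_
  rw [integral_prod _ hint2]
  have hin : ∀ᵐ x ∂pskLaw, ∫ n, ‖h₀ * x - e (channelOutput h₀ snr (x, n))‖ ^ 2 ∂stdComplexGaussian
      ≤ ‖h₀‖ ^ 2 * (1 / (2 * ‖κ‖ ^ 2) + (9 / 2 * M4 + M6 / 2) * ((‖κ‖ ^ 2) ^ 2)⁻¹) := by
    filter_upwards [norm_eq_one_ae_pskLaw] with x hx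
    set c : ℂ := starRingEnd ℂ x / κ with hc
    have hcn : ‖c‖ = ‖κ‖⁻¹ := by rw [hc, norm_div, RCLike.norm_conj, hx, one_div]
    have him : ∀ n : ℂ, (c * n).im = (-Complex.I * c * n).re := by intro n; simp
    have i1 : Integrable (fun n : ℂ => (c * n).im ^ 2) stdComplexGaussian := by
      simp_rw [him]; exact integrable_re_mul_sq _
    have i2 : Integrable (fun n : ℂ => 2 * (c * n).re * (c * n).im ^ 2) stdComplexGaussian := by
      refine ((integrable_norm_pow_stdComplexGaussian 3).const_mul (2 * ‖c‖ ^ 3)).mono'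
        (by fun_prop) (ae_of_all _ fun n => ?_)
      rw [norm_mul, norm_mul, norm_pow, Real.norm_eq_abs, Real.norm_eq_abs, Real.norm_eq_abs]
      calc |2| * |(c * n).re| * |(c * n).im| ^ 2 ≤ 2 * ‖c * n‖ * ‖c * n‖ ^ 2 := by
            gcongr
            · simp
            · exact Complex.abs_re_le_norm _
            · exact Complex.abs_im_le_norm _
        _ = 2 * ‖c‖ ^ 3 * ‖n‖ ^ 3 := by rw [norm_mul]; ring
    have i4 : Integrable (fun n : ℂ => 9 / 2 * ‖c * n‖ ^ 4) stdComplexGaussian := by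
      simp_rw [norm_mul, mul_pow]
      exact ((integrable_norm_pow_stdComplexGaussian 4).const_mul _).const_mul _
    have i6 : Integrable (fun n : ℂ => ‖c * n‖ ^ 6 / 2) stdComplexGaussian := by
      simp_rw [norm_mul, mul_pow]
      exact ((integrable_norm_pow_stdComplexGaussian 6).const_mul _).div_const _
    have i12 : Integrable (fun n : ℂ => (c * n).im ^ 2 - 2 * (c * n).re * (c * n).im ^ 2)
      stdComplexGaussian := i1.sub i2
    have i124 : Integrable (fun n : ℂ => (c * n).im ^ 2 - 2 * (c * n).re * (c * n).im ^ 2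
      + 9 / 2 * ‖c * n‖ ^ 4) stdComplexGaussian := i12.add i4
    calc ∫ n, ‖h₀ * x - e (channelOutput h₀ snr (x, n))‖ ^ 2 ∂stdComplexGaussian
        ≤ ∫ n, ‖h₀‖ ^ 2 * ((c * n).im ^ 2 - 2 * (c * n).re * (c * n).im ^ 2
          + 9 / 2 * ‖c * n‖ ^ 4 + ‖c * n‖ ^ 6 / 2) ∂stdComplexGaussian :=
          integral_mono_of_nonneg (ae_of_all _ fun _ => by positivity)
            ((i124.add i6).const_mul _) (ae_of_all _ fun n => hbound x n hx)
      _ = ‖h₀‖ ^ 2 * (‖c‖ ^ 2 / 2 + 9 / 2 * (‖c‖ ^ 4 * M4) + ‖c‖ ^ 6 * M6 / 2) := by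
          rw [integral_const_mul, integral_add i124 i6, integral_add i12 i4, integral_sub i1 i2]
          have e2 : ∫ n : ℂ, 2 * (c * n).re * (c * n).im ^ 2 ∂stdComplexGaussian = 0 :=
            integral_odd_stdComplexGaussian fun z => by simp; ring
          have e1 : ∫ n : ℂ, (c * n).im ^ 2 ∂stdComplexGaussian = ‖c‖ ^ 2 / 2 := by
            simp_rw [him]
            rw [integral_re_mul_sq]
            simp
          rw [e1, e2, sub_zero, integral_const_mul, integral_div]
          simp_rw [norm_mul, mul_pow]
          rw [integral_const_mul, integral_const_mul]
      _ ≤ _ := by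
          rw [hcn]
          have hle : ‖κ‖⁻¹ ^ 6 ≤ ‖κ‖⁻¹ ^ 4 := by
            refine pow_le_pow_of_le_one (by positivity) (inv_le_one_of_one_le₀ ?_) (by norm_num)
            nlinarith [norm_nonneg κ]
          have hmul : ‖κ‖⁻¹ ^ 6 * M6 ≤ ‖κ‖⁻¹ ^ 4 * M6 := by gcongr
          have e2 : 1 / (2 * ‖κ‖ ^ 2) = ‖κ‖⁻¹ ^ 2 / 2 := by
            rw [inv_pow, one_div, mul_inv]; ring
          have e4 : ((‖κ‖ ^ 2) ^ 2)⁻¹ = ‖κ‖⁻¹ ^ 4 := by rw [inv_pow]; ring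
          rw [e2, e4]
          refine mul_le_mul_of_nonneg_left ?_ (by positivity)
          linarith
  calc _ ≤ ∫ x, ‖h₀‖ ^ 2 * (1 / (2 * ‖κ‖ ^ 2) + (9 / 2 * M4 + M6 / 2) * ((‖κ‖ ^ 2) ^ 2)⁻¹) ∂pskLaw :=
        integral_mono_of_nonneg (ae_of_all _ fun _ => integral_nonneg fun _ => by positivity)
          (integrable_const _) hin
    _ = _ := by simp

/-! ### The uniform law on a symmetric segment and its test functions -/

/-- The uniform law on `[-c, c]`. -/
def symmUniform (c : ℝ) : Measure ℝ := ProbabilityTheory.cond volume (Set.Icc (-c) c)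

lemma isProbabilityMeasure_symmUniform {c : ℝ} (hc : 0 < c) :
    IsProbabilityMeasure (symmUniform c) :=
  cond_isProbabilityMeasure_of_finite (by simp [hc])
    (by rw [Real.volume_Icc]; exact ENNReal.ofReal_ne_top)

lemma symmUniform_eq_smul {c : ℝ} :
    symmUniform c = (ENNReal.ofReal (2 * c))⁻¹ • volume.restrict (Set.Icc (-c) c) := by
  unfold symmUniform ProbabilityTheory.cond
  rw [Real.volume_Icc]
  congr 3
  ring

lemma integral_symmUniform {E : Type*} [NormedAddCommGroup E] [NormedSpace ℝ E] {c : ℝ}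
    (hc : 0 < c) (g : ℝ → E) :
    ∫ r, g r ∂(symmUniform c) = (2 * c)⁻¹ • ∫ r in (-c)..c, g r := by
  rw [symmUniform_eq_smul, integral_smul_measure, integral_Icc_eq_integral_Ioc,
    intervalIntegral.integral_of_le (by linarith), ENNReal.toReal_inv,
    ENNReal.toReal_ofReal (by positivity)]

lemma ae_abs_le_symmUniform (c : ℝ) : ∀ᵐ r ∂(symmUniform c), |r| ≤ c := by
  have h := ae_cond_mem (μ := (volume : Measure ℝ)) (s := Set.Icc (-c) c) measurableSet_Icc
  filter_upwards [h] with r hr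
  exact abs_le.2 hr

lemma integrable_symmUniform {E : Type*} [NormedAddCommGroup E] {c : ℝ} (hc : 0 < c) {g : ℝ → E}
    (hg : Continuous g) : Integrable g (symmUniform c) := by
  rw [symmUniform_eq_smul]
  exact (hg.continuousOn.integrableOn_Icc).smul_measure (by simp [hc])

/-- Test function vanishing at the end points of `[-c, c]`. -/
def bump (c : ℝ) (k : ℕ) (r : ℝ) : ℝ := 1 - (r / c) ^ (2 * k)

/-- The derivative of `bump`. -/
def bumpDeriv (c : ℝ) (k : ℕ) (r : ℝ) : ℝ := -((2 * k : ℕ) * (r / c) ^ (2 * k - 1) * c⁻¹)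

@[fun_prop]
lemma continuous_bump (c : ℝ) (k : ℕ) : Continuous (bump c k) := by unfold bump; fun_prop

@[fun_prop]
lemma continuous_bumpDeriv (c : ℝ) (k : ℕ) : Continuous (bumpDeriv c k) := by
  unfold bumpDeriv; fun_prop

lemma hasDerivAt_bump (c : ℝ) (k : ℕ) (r : ℝ) : HasDerivAt (bump c k) (bumpDeriv c k r) r := by
  have h := (((hasDerivAt_id r).div_const c).pow (2 * k)).const_sub 1
  refine h.congr_deriv ?_
  simp [bumpDeriv]

lemma bump_right {c : ℝ} (hc : 0 < c) (k : ℕ) : bump c k c = 0 := by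
  simp [bump, hc.ne']

lemma bump_left {c : ℝ} (hc : 0 < c) (k : ℕ) : bump c k (-c) = 0 := by
  simp [bump, hc.ne']

lemma bump_sq_le_one {c : ℝ} (hc : 0 < c) (k : ℕ) {r : ℝ} (hr : |r| ≤ c) : bump c k r ^ 2 ≤ 1 := by
  have h1 : 0 ≤ (r / c) ^ (2 * k) := by rw [pow_mul]; positivity
  have h2 : (r / c) ^ (2 * k) ≤ 1 := by
    rw [pow_mul]
    refine pow_le_one₀ (by positivity) ?_
    rw [sq_le_one_iff_abs_le_one, abs_div, abs_of_pos hc]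
    exact div_le_one_of_le₀ hr hc.le
  unfold bump
  nlinarith

lemma integral_symmUniform_div_pow {c : ℝ} (hc : 0 < c) (k : ℕ) :
    ∫ r, (r / c) ^ (2 * k) ∂(symmUniform c) = 1 / (2 * k + 1) := by
  rw [integral_symmUniform hc, intervalIntegral.integral_comp_div (fun u => u ^ (2 * k)) hc.ne',
    neg_div, div_self hc.ne', integral_pow]
  have : (-1 : ℝ) ^ (2 * k + 1) = -1 := by rw [pow_succ, pow_mul]; simp
  rw [this]
  simp
  field_simp
  norm_num

lemma integral_mul_bumpDeriv {c : ℝ} (hc : 0 < c) {k : ℕ} (hk : 1 ≤ k) :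
    ∫ r, r * bumpDeriv c k r ∂(symmUniform c) = -(2 * k / (2 * k + 1)) := by
  have h : ∀ r, r * bumpDeriv c k r = -(2 * k) * (r / c) ^ (2 * k) := by
    intro r
    obtain ⟨j, rfl⟩ : ∃ j, k = j + 1 := ⟨k - 1, by omega⟩
    have : 2 * (j + 1) - 1 = 2 * j + 1 := by omega
    unfold bumpDeriv
    rw [this, show (r / c) ^ (2 * (j + 1)) = (r / c) ^ (2 * j + 1) * (r / c) by ring]
    push_cast
    generalize (r / c) ^ (2 * j + 1) = z
    field_simp
  simp_rw [h]
  rw [integral_const_mul, integral_symmUniform_div_pow hc]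
  ring

lemma integral_bumpDeriv_sq {c : ℝ} (hc : 0 < c) {k : ℕ} (hk : 1 ≤ k) :
    ∫ r, bumpDeriv c k r ^ 2 ∂(symmUniform c) = 4 * k ^ 2 / (c ^ 2 * (4 * k - 1)) := by
  have h : ∀ r, bumpDeriv c k r ^ 2 = (4 * k ^ 2 / c ^ 2) * (r / c) ^ (2 * (2 * k - 1)) := by
    intro r
    unfold bumpDeriv
    push_cast
    field_simp
    ring
  simp_rw [h]
  rw [integral_const_mul, integral_symmUniform_div_pow hc, Nat.cast_sub (by omega)]
  push_cast
  rw [div_mul_div_comm]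
  congr 1 <;> ring

lemma integral_bumpDeriv {c : ℝ} (hc : 0 < c) (k : ℕ) :
    ∫ r, bumpDeriv c k r ∂(symmUniform c) = 0 := by
  rw [integral_symmUniform hc, intervalIntegral.integral_eq_sub_of_hasDerivAt
    (fun r _ => hasDerivAt_bump c k r) ((continuous_bumpDeriv c k).intervalIntegrable _ _),
    bump_right hc, bump_left hc]
  simp

lemma integral_bump_sq_le {c : ℝ} (hc : 0 < c) (k : ℕ) :
    ∫ r, bump c k r ^ 2 ∂(symmUniform c) ≤ 1 := by
  have := isProbabilityMeasure_symmUniform hc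
  calc _ ≤ ∫ r, (1 : ℝ) ∂(symmUniform c) := by
        refine integral_mono_ae (integrable_symmUniform hc (by fun_prop)) (integrable_const _) ?_
        filter_upwards [ae_abs_le_symmUniform c] with r hr
        exact bump_sq_le_one hc k hr
    _ = 1 := by simp

/-- Integration by parts against the Gaussian density along a segment. -/
lemma integral_density_mul_bump_eq_zero {c : ℝ} (hc : 0 < c) (k : ℕ) {γ : ℝ → ℂ} {γ' : ℂ}
    (hγ : ∀ r, HasDerivAt γ γ' r) (y κ : ℂ) :
    ∫ r, (complexGaussianDensity (y - κ * γ r) : ℂ) * ((bumpDeriv c k r + bump c k r *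
      (2 * (starRingEnd ℂ (κ * γ') * (y - κ * γ r)).re) : ℝ) : ℂ) ∂(symmUniform c) = 0 := by
  have hγc : Continuous γ := continuous_iff_continuousAt.2 fun r => (hγ r).continuousAt
  have hd : ∀ r, HasDerivAt (fun r => (bump c k r : ℂ) * (complexGaussianDensity (y - κ * γ r) : ℂ))
      ((complexGaussianDensity (y - κ * γ r) : ℂ) * ((bumpDeriv c k r + bump c k r *
      (2 * (starRingEnd ℂ (κ * γ') * (y - κ * γ r)).re) : ℝ) : ℂ)) r := by
    intro r
    refine ((hasDerivAt_bump c k r).ofReal_comp.mul (hasDerivAt_density (hγ r) y κ)).congr_deriv ?_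
    push_cast
    ring
  rw [integral_symmUniform hc, intervalIntegral.integral_eq_sub_of_hasDerivAt (fun r _ => hd r),
    bump_right hc, bump_left hc]
  · simp
  · refine Continuous.intervalIntegrable ?_ _ _
    fun_prop

/-! ### The uniform law on a real segment -/

lemma sqrt_three_pos : (0 : ℝ) < √3 := by positivity

lemma pamLaw_eq_map : pamLaw = (symmUniform √3).map (fun r : ℝ => (r : ℂ)) := rfl

instance : IsProbabilityMeasure pamLaw := by
  have := isProbabilityMeasure_symmUniform sqrt_three_pos
  rw [pamLaw_eq_map]
  exact Measure.isProbabilityMeasure_map (by fun_prop)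

lemma integral_pamLaw {E : Type*} [NormedAddCommGroup E] [NormedSpace ℝ E] (g : ℂ → E) :
    ∫ x, g x ∂pamLaw = ∫ r : ℝ, g (r : ℂ) ∂(symmUniform √3) := by
  rw [pamLaw_eq_map]
  exact Complex.isometry_ofReal.isClosedEmbedding.measurableEmbedding.integral_map g

lemma ae_pamLaw : ∀ᵐ x ∂pamLaw, x.im = 0 ∧ ‖x‖ ≤ √3 := by
  rw [pamLaw_eq_map, ae_map_iff (by fun_prop) (by measurability)]
  filter_upwards [ae_abs_le_symmUniform √3] with r hr
  simpa using hr

lemma bounded_pamLaw : ∀ᵐ x ∂pamLaw, ‖x‖ ≤ 2 := by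
  filter_upwards [ae_pamLaw] with x hx
  refine hx.2.trans ?_
  rw [Real.sqrt_le_iff]; norm_num

lemma memLp_fst_mul_snd {PX : Measure ℂ} [IsProbabilityMeasure PX] {A L : ℂ → ℂ}
    (hA : MemLp A 2 PX) (hL : MemLp L 2 stdComplexGaussian) :
    MemLp (fun xn : ℂ × ℂ => A xn.1 * L xn.2) 2 (PX.prod stdComplexGaussian) := by
  refine memLp_two_of_integrable_norm_sq
    (hA.aestronglyMeasurable.comp_fst.mul hL.aestronglyMeasurable.comp_snd) ?_
  have := (hA.integrable_norm_pow (by norm_num)).mul_prod (hL.integrable_norm_pow (by norm_num))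
  simpa [mul_pow] using this

lemma memLp_re_mul (c : ℂ) : MemLp (fun n : ℂ => ((c * n).re : ℂ)) 2 stdComplexGaussian := by
  refine memLp_two_of_integrable_norm_sq (by fun_prop) ?_
  simp_rw [Complex.norm_real, Real.norm_eq_abs, sq_abs]
  exact integrable_re_mul_sq c

lemma memLp_pamLaw {g : ℝ → ℝ} (hg : Continuous g) : MemLp (fun x : ℂ => (g x.re : ℂ)) 2 pamLaw := by
  refine memLp_two_of_integrable_norm_sq (by fun_prop) ?_
  have hm : MeasurableEmbedding (fun r : ℝ => (r : ℂ)) :=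
    Complex.isometry_ofReal.isClosedEmbedding.measurableEmbedding
  rw [pamLaw_eq_map, hm.integrable_map_iff]
  refine integrable_symmUniform sqrt_three_pos ?_
  fun_prop

/-- The test variable is `w' + w · score` with `w(r) = 1 - (r/√3)^(2k)`. It gives `|E V̄ h₀ x| =
|h₀| · 2k/(2k+1)` and `E|V|² = ∫ w'² + 2ρ ∫ w²`. The degree `k` is left free: a larger `k` brings
`w` closer to 1 inside the segment but increases `∫ w'²` linearly. -/
lemma le_condMMSE_pamLaw (h₀ : ℂ) {snr : ℝ} (hs : 0 ≤ snr) {k : ℕ} (hk : 1 ≤ k) :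
    ‖h₀‖ ^ 2 * (2 * k / (2 * k + 1)) ^ 2
      ≤ (4 * k ^ 2 / (3 * (4 * k - 1)) + 2 * (‖h₀‖ ^ 2 * snr)) * condMMSE pamLaw h₀ snr := by
  set κ : ℂ := (√snr : ℝ) * h₀ with hκ
  have hρ : ‖κ‖ ^ 2 = ‖h₀‖ ^ 2 * snr := norm_gain_sq h₀ hs
  have hXL := memLp_id_of_bounded bounded_pamLaw
  set w := bump √3 k with hw
  set w' := bumpDeriv √3 k with hw'
  set V : ℂ × ℂ → ℂ := fun xn => ((w' xn.1.re + w xn.1.re *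
    (2 * (starRingEnd ℂ κ * xn.2).re) : ℝ) : ℂ) with hV
  have hVc : Continuous V := by simp only [hV, hw, hw']; fun_prop
  have hVL : MemLp V 2 (pamLaw.prod stdComplexGaussian) := by
    have h1 : MemLp (fun x : ℂ => (w' x.re : ℂ)) 2 pamLaw := memLp_pamLaw (continuous_bumpDeriv _ _)
    have h2 : MemLp (fun x : ℂ => (w x.re : ℂ)) 2 pamLaw := memLp_pamLaw (continuous_bump _ _)
    have h3 := (h1.comp_fst stdComplexGaussian).add
      (memLp_fst_mul_snd h2 ((memLp_re_mul (starRingEnd ℂ κ)).const_mul 2))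
    refine h3.ae_eq (ae_of_all _ fun xn => ?_)
    simp [hV]
  have hpost : ∀ y, ∫ x, (complexGaussianDensity (y - κ * x) : ℂ) * V (x, y - κ * x) ∂pamLaw = 0 := by
    intro y
    rw [integral_pamLaw]
    have := integral_density_mul_bump_eq_zero sqrt_three_pos k (γ := fun r => (r : ℂ)) (γ' := 1)
      (fun r => by simpa using (hasDerivAt_id r).ofReal_comp) y κ
    rw [← this]
    simp [hV, hw, hw']
  have key := le_condMMSE hXL h₀ snr hVc.measurable hVL hpost
  have hA : ∫ xn, starRingEnd ℂ (V xn) * (h₀ * xn.1) ∂(pamLaw.prod stdComplexGaussian)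
      = -(h₀ * ((2 * k / (2 * k + 1) : ℝ) : ℂ)) := by
    have hi : Integrable (fun xn : ℂ × ℂ => starRingEnd ℂ (V xn) * (h₀ * xn.1))
        (pamLaw.prod stdComplexGaussian) := MemLp.integrable_mul hVL.star (memLp_fst_prod hXL h₀)
    rw [integral_prod _ hi, integral_pamLaw]
    have hin : ∀ r : ℝ, ∫ n, starRingEnd ℂ (V ((r : ℂ), n)) * (h₀ * (r : ℂ)) ∂stdComplexGaussian
        = h₀ * ((r * w' r : ℝ) : ℂ) := by
      intro r
      simp only [hV, Complex.conj_ofReal, Complex.ofReal_re]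
      rw [integral_mul_const, integral_complex_ofReal, integral_add (integrable_const _)
        (((integrable_re_mul _).const_mul _).const_mul _), integral_const_mul, integral_const_mul,
        integral_re_mul]
      simp
      ring
    simp_rw [hin]
    rw [integral_const_mul, integral_complex_ofReal, integral_mul_bumpDeriv sqrt_three_pos hk]
    push_cast
    ring
  have hB : ∫ xn, ‖V xn‖ ^ 2 ∂(pamLaw.prod stdComplexGaussian)
      ≤ 4 * k ^ 2 / (3 * (4 * k - 1)) + 2 * ‖κ‖ ^ 2 := by
    rw [integral_prod _ (hVL.integrable_norm_pow (by norm_num)), integral_pamLaw]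
    have hin : ∀ r : ℝ, ∫ n, ‖V ((r : ℂ), n)‖ ^ 2 ∂stdComplexGaussian
        = w' r ^ 2 + (2 * ‖κ‖ ^ 2) * w r ^ 2 := by
      intro r
      have : ∀ n, ‖V ((r : ℂ), n)‖ ^ 2 = (w' r + (2 * w r) * (starRingEnd ℂ κ * n).re) ^ 2 := by
        intro n
        simp only [hV]
        rw [Complex.norm_real, Real.norm_eq_abs, sq_abs, Complex.ofReal_re]
        ring
      simp_rw [this]
      rw [integral_affine_sq, RCLike.norm_conj]
      ring
    simp_rw [hin]
    rw [integral_add (integrable_symmUniform sqrt_three_pos (by fun_prop))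
      ((integrable_symmUniform sqrt_three_pos (by fun_prop)).const_mul _), integral_const_mul,
      integral_bumpDeriv_sq sqrt_three_pos hk]
    have h3 : (√3 : ℝ) ^ 2 = 3 := by norm_num
    rw [h3]
    have := integral_bump_sq_le sqrt_three_pos k
    nlinarith [sq_nonneg ‖κ‖, mul_le_mul_of_nonneg_left this (sq_nonneg ‖κ‖)]
  rw [hA, norm_neg, norm_mul, mul_pow, Complex.norm_real, Real.norm_eq_abs, sq_abs] at key
  refine key.trans ?_
  rw [← hρ]
  exact mul_le_mul_of_nonneg_right hB (condMMSE_nonneg _ _ _)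

/-- The input is real, so taking the real part of `y/κ` discards half of the noise power and
introduces no bias. -/
lemma condMMSE_pamLaw_le {h₀ : ℂ} {snr : ℝ} (hh : h₀ ≠ 0) (hs : 0 < snr) :
    condMMSE pamLaw h₀ snr ≤ 1 / (2 * snr) := by
  set κ : ℂ := (√snr : ℝ) * h₀ with hκ
  have hρ : ‖κ‖ ^ 2 = ‖h₀‖ ^ 2 * snr := norm_gain_sq h₀ hs.le
  have hκ0 : κ ≠ 0 := by simp [hκ, hh, Real.sqrt_ne_zero'.2 hs]
  have hXL := memLp_id_of_bounded bounded_pamLaw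
  set e : ℂ → ℂ := fun y => h₀ * ((y / κ).re : ℂ) with he
  have hec : Continuous e := by fun_prop
  have hreal : ∀ᵐ xn : ℂ × ℂ ∂(pamLaw.prod stdComplexGaussian), xn.1.im = 0 ∧ ‖xn.1‖ ≤ √3 :=
    Measure.quasiMeasurePreserving_fst.ae ae_pamLaw
  have hYe : ∀ x n : ℂ, x.im = 0 → e (channelOutput h₀ snr (x, n))
      = h₀ * x + h₀ * ((κ⁻¹ * n).re : ℂ) := by
    intro x n hx
    have h1 : channelOutput h₀ snr (x, n) / κ = x + κ⁻¹ * n := by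
      simp only [channelOutput_eq, ← hκ]
      field_simp
    have h2 : ((x.re : ℝ) : ℂ) = x := by apply Complex.ext <;> simp [hx]
    simp only [he]
    rw [h1, Complex.add_re, Complex.ofReal_add, h2]
    ring
  have he2 : MemLp (fun xn => e (channelOutput h₀ snr xn)) 2 (pamLaw.prod stdComplexGaussian) := by
    have := (memLp_fst_prod hXL h₀).add
      (((memLp_re_mul κ⁻¹).const_mul h₀).comp_snd pamLaw)
    refine this.ae_eq ?_
    filter_upwards [hreal] with xn hx
    rw [show xn = (xn.1, xn.2) from rfl, hYe _ _ hx.1]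
    simp
  refine (condMMSE_le hXL h₀ snr hec.measurable he2).trans_eq ?_
  have h1 : ∫ xn : ℂ × ℂ, ‖h₀ * xn.1 - e (channelOutput h₀ snr xn)‖ ^ 2
      ∂(pamLaw.prod stdComplexGaussian)
      = ∫ xn : ℂ × ℂ, ‖h₀‖ ^ 2 * (κ⁻¹ * xn.2).re ^ 2 ∂(pamLaw.prod stdComplexGaussian) := by
    refine integral_congr_ae ?_
    filter_upwards [hreal] with xn hx
    rw [show xn = (xn.1, xn.2) from rfl, hYe _ _ hx.1, sub_add_cancel_left, norm_neg, norm_mul,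
      mul_pow, Complex.norm_real, Real.norm_eq_abs, sq_abs]
  rw [h1, integral_prod _ (((integrable_re_mul_sq κ⁻¹).const_mul _).comp_snd pamLaw)]
  simp only [integral_const_mul, integral_re_mul_sq]
  rw [norm_inv, inv_pow, hρ]
  have : ‖h₀‖ ≠ 0 := norm_ne_zero_iff.2 hh
  simp
  field_simp

/-! ### The uniform law on a square -/

lemma sqrt_three_half_pos : (0 : ℝ) < √(3 / 2) := by positivity

/-- The product form allows integration by parts in one coordinate with the other fixed. -/
lemma qamLaw_eq_map : qamLaw = ((symmUniform √(3 / 2)).prod (symmUniform √(3 / 2))).map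
    (fun p : ℝ × ℝ => (p.1 : ℂ) + (p.2 : ℂ) * Complex.I) := by
  set c := √(3 / 2) with hc
  have hc0 : 0 < c := sqrt_three_half_pos
  rw [ofReal_add_mul_I_eq_symm, symmUniform_eq_smul, Measure.prod_smul_left,
    Measure.prod_smul_right, Measure.prod_restrict, Measure.map_smul, Measure.map_smul]
  have hpre : Set.Icc (-c) c ×ˢ Set.Icc (-c) c = Complex.measurableEquivRealProd.symm ⁻¹'
      (Set.Icc (-c) c ×ℂ Set.Icc (-c) c) := by
    ext p; exact Iff.rfl
  have hmeas : MeasurableSet (Set.Icc (-c) c ×ℂ Set.Icc (-c) c) :=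
    (Complex.measurable_re measurableSet_Icc).inter (Complex.measurable_im measurableSet_Icc)
  have hmp := Complex.volume_preserving_equiv_real_prod.symm
  have hr := hmp.restrict_preimage hmeas
  rw [hpre]
  have hvol : (volume : Measure ℂ) (Set.Icc (-c) c ×ℂ Set.Icc (-c) c)
      = ENNReal.ofReal (2 * c) * ENNReal.ofReal (2 * c) := by
    rw [← hmp.measure_preimage hmeas.nullMeasurableSet, ← hpre, Measure.volume_eq_prod,
      Measure.prod_prod, Real.volume_Icc]
    congr 2 <;> ring
  have hprod : (volume : Measure ℝ).prod volume = (volume : Measure (ℝ × ℝ)) :=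
    (Measure.volume_eq_prod ℝ ℝ).symm
  rw [hprod, hr.map_eq, smul_smul]
  unfold qamLaw ProbabilityTheory.cond
  rw [← hc, hvol, ENNReal.mul_inv]
  · left; simp [hc0]
  · left; exact ENNReal.ofReal_ne_top

instance : IsProbabilityMeasure qamLaw := by
  have := isProbabilityMeasure_symmUniform sqrt_three_half_pos
  rw [qamLaw_eq_map]
  exact Measure.isProbabilityMeasure_map (by fun_prop)

lemma measurableEmbedding_ofReal_add_mul_I :
    MeasurableEmbedding (fun p : ℝ × ℝ => (p.1 : ℂ) + (p.2 : ℂ) * Complex.I) := by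
  rw [ofReal_add_mul_I_eq_symm]
  exact MeasurableEquiv.measurableEmbedding _

lemma integral_qamLaw {E : Type*} [NormedAddCommGroup E] [NormedSpace ℝ E] (g : ℂ → E) :
    ∫ x, g x ∂qamLaw = ∫ p : ℝ × ℝ, g ((p.1 : ℂ) + (p.2 : ℂ) * Complex.I)
      ∂((symmUniform √(3 / 2)).prod (symmUniform √(3 / 2))) := by
  rw [qamLaw_eq_map]
  exact measurableEmbedding_ofReal_add_mul_I.integral_map g

lemma ae_symmUniform_prod {c : ℝ} (hc : 0 < c) :
    ∀ᵐ p ∂((symmUniform c).prod (symmUniform c)), |p.1| ≤ c ∧ |p.2| ≤ c := by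
  have := isProbabilityMeasure_symmUniform hc
  have h1 : ∀ᵐ p ∂((symmUniform c).prod (symmUniform c)), |p.1| ≤ c :=
    Measure.quasiMeasurePreserving_fst.ae (ae_abs_le_symmUniform c)
  have h2 : ∀ᵐ p ∂((symmUniform c).prod (symmUniform c)), |p.2| ≤ c :=
    Measure.quasiMeasurePreserving_snd.ae (ae_abs_le_symmUniform c)
  filter_upwards [h1, h2] with p a b using ⟨a, b⟩

lemma integrable_symmUniform_prod {E : Type*} [NormedAddCommGroup E] [SecondCountableTopologyEither (ℝ × ℝ) E]
    {c : ℝ} (hc : 0 < c) {g : ℝ × ℝ → E} (hg : Continuous g) :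
    Integrable g ((symmUniform c).prod (symmUniform c)) := by
  have := isProbabilityMeasure_symmUniform hc
  have hcomp : IsCompact (Set.Icc (-c) c ×ˢ Set.Icc (-c) c) := isCompact_Icc.prod isCompact_Icc
  obtain ⟨C, hC⟩ := hcomp.exists_bound_of_continuousOn hg.continuousOn
  refine Integrable.of_bound hg.aestronglyMeasurable C ?_
  filter_upwards [ae_symmUniform_prod hc] with p hp
  exact hC p ⟨abs_le.1 hp.1, abs_le.1 hp.2⟩

lemma bounded_qamLaw : ∀ᵐ x ∂qamLaw, ‖x‖ ≤ 2 := by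
  rw [qamLaw_eq_map, ae_map_iff (by fun_prop) (by measurability)]
  filter_upwards [ae_symmUniform_prod sqrt_three_half_pos] with p hp
  have h1 : ‖(p.1 : ℂ) + (p.2 : ℂ) * Complex.I‖ ^ 2 = p.1 ^ 2 + p.2 ^ 2 := by
    rw [← Complex.normSq_eq_norm_sq, Complex.normSq_apply]; simp; ring
  have h2 : (√(3 / 2) : ℝ) ^ 2 = 3 / 2 := Real.sq_sqrt (by norm_num)
  have h3 : p.1 ^ 2 ≤ 3 / 2 := by rw [← h2, ← sq_abs]; gcongr; exact hp.1
  have h4 : p.2 ^ 2 ≤ 3 / 2 := by rw [← h2, ← sq_abs p.2]; gcongr; exact hp.2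
  nlinarith [norm_nonneg ((p.1 : ℂ) + (p.2 : ℂ) * Complex.I)]

lemma memLp_qamLaw {g : ℂ → ℂ} (hg : Continuous g) : MemLp g 2 qamLaw := by
  refine memLp_two_of_integrable_norm_sq (by fun_prop) ?_
  rw [qamLaw_eq_map, measurableEmbedding_ofReal_add_mul_I.integrable_map_iff]
  refine integrable_symmUniform_prod sqrt_three_half_pos ?_
  fun_prop

/-- The test variables of the two coordinates are combined as `V = V₁ + i V₂`. The cross terms in `E
V̄ h₀ x` vanish because `w'` has mean zero, so the correlation is twice that of one coordinate. Its
square carries a factor 4 that cancels against the one in the bound for `E|V|²`. -/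
lemma le_condMMSE_qamLaw (h₀ : ℂ) {snr : ℝ} (hs : 0 ≤ snr) {k : ℕ} (hk : 1 ≤ k) :
    ‖h₀‖ ^ 2 * (2 * k / (2 * k + 1)) ^ 2
      ≤ (4 * k ^ 2 / (3 * (4 * k - 1)) + ‖h₀‖ ^ 2 * snr) * condMMSE qamLaw h₀ snr := by
  set κ : ℂ := (√snr : ℝ) * h₀ with hκ
  have hρ : ‖κ‖ ^ 2 = ‖h₀‖ ^ 2 * snr := norm_gain_sq h₀ hs
  have hXL := memLp_id_of_bounded bounded_qamLaw
  have hc0 := sqrt_three_half_pos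
  set c := √(3 / 2) with hc
  have hU := isProbabilityMeasure_symmUniform hc0
  set w := bump c k with hw
  set w' := bumpDeriv c k with hw'
  set V : ℂ × ℂ → ℂ := fun xn =>
    ((w' xn.1.re + w xn.1.re * (2 * (starRingEnd ℂ (κ * 1) * xn.2).re) : ℝ) : ℂ)
    + Complex.I * ((w' xn.1.im + w xn.1.im *
      (2 * (starRingEnd ℂ (κ * Complex.I) * xn.2).re) : ℝ) : ℂ) with hV
  have hVc : Continuous V := by simp only [hV, hw, hw']; fun_prop
  have hVL : MemLp V 2 (qamLaw.prod stdComplexGaussian) := by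
    have h1 : MemLp (fun x : ℂ => (w' x.re : ℂ) + Complex.I * (w' x.im : ℂ)) 2 qamLaw :=
      memLp_qamLaw (by simp only [hw']; fun_prop)
    have h2 : MemLp (fun x : ℂ => (w x.re : ℂ)) 2 qamLaw :=
      memLp_qamLaw (by simp only [hw]; fun_prop)
    have h2' : MemLp (fun x : ℂ => Complex.I * (w x.im : ℂ)) 2 qamLaw :=
      memLp_qamLaw (by simp only [hw]; fun_prop)
    have h3 := ((h1.comp_fst stdComplexGaussian).add
      (memLp_fst_mul_snd h2 ((memLp_re_mul (starRingEnd ℂ (κ * 1))).const_mul 2))).add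
      (memLp_fst_mul_snd h2' ((memLp_re_mul (starRingEnd ℂ (κ * Complex.I))).const_mul 2))
    refine h3.ae_eq (ae_of_all _ fun xn => ?_)
    simp only [hV, Pi.add_apply]
    push_cast
    ring
  have hpost : ∀ y, ∫ x, (complexGaussianDensity (y - κ * x) : ℂ) * V (x, y - κ * x) ∂qamLaw = 0 := by
    intro y
    rw [integral_qamLaw]
    set A : ℝ × ℝ → ℂ := fun p =>
      (complexGaussianDensity (y - κ * ((p.1 : ℂ) + (p.2 : ℂ) * Complex.I)) : ℂ) *
        ((w' p.1 + w p.1 * (2 * (starRingEnd ℂ (κ * 1) *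
          (y - κ * ((p.1 : ℂ) + (p.2 : ℂ) * Complex.I))).re) : ℝ) : ℂ) with hA
    set B : ℝ × ℝ → ℂ := fun p =>
      (complexGaussianDensity (y - κ * ((p.1 : ℂ) + (p.2 : ℂ) * Complex.I)) : ℂ) *
        ((w' p.2 + w p.2 * (2 * (starRingEnd ℂ (κ * Complex.I) *
          (y - κ * ((p.1 : ℂ) + (p.2 : ℂ) * Complex.I))).re) : ℝ) : ℂ) with hB
    have hAi : Integrable A ((symmUniform c).prod (symmUniform c)) :=
      integrable_symmUniform_prod hc0 (by simp only [hA, hw, hw']; fun_prop)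
    have hBi : Integrable B ((symmUniform c).prod (symmUniform c)) :=
      integrable_symmUniform_prod hc0 (by simp only [hB, hw, hw']; fun_prop)
    have hsplit : ∀ p : ℝ × ℝ,
        (complexGaussianDensity (y - κ * ((p.1 : ℂ) + (p.2 : ℂ) * Complex.I)) : ℂ) *
        V ((p.1 : ℂ) + (p.2 : ℂ) * Complex.I, y - κ * ((p.1 : ℂ) + (p.2 : ℂ) * Complex.I))
        = A p + Complex.I * B p := by
      intro p
      have hre : ((p.1 : ℂ) + (p.2 : ℂ) * Complex.I).re = p.1 := by simp
      have him : ((p.1 : ℂ) + (p.2 : ℂ) * Complex.I).im = p.2 := by simp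
      simp only [hV, hre, him, hA, hB]
      ring
    simp_rw [hsplit]
    rw [integral_add hAi (hBi.const_mul _), integral_const_mul, integral_prod_symm _ hAi,
      integral_prod _ hBi]
    have h1 : ∀ b : ℝ, ∫ a, A (a, b) ∂(symmUniform c) = 0 := fun b =>
      integral_density_mul_bump_eq_zero hc0 k (γ := fun r => (r : ℂ) + (b : ℂ) * Complex.I)
        (fun r => by
          have h := ((hasDerivAt_id r).ofReal_comp).add_const ((b : ℂ) * Complex.I)
          simpa using h) y κ
    have h2 : ∀ a : ℝ, ∫ b, B (a, b) ∂(symmUniform c) = 0 := fun a =>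
      integral_density_mul_bump_eq_zero hc0 k (γ := fun r => (a : ℂ) + (r : ℂ) * Complex.I)
        (fun r => by
          simpa using (((hasDerivAt_id r).ofReal_comp).mul_const Complex.I).const_add (a : ℂ)) y κ
    simp [h1, h2]
  have key := le_condMMSE hXL h₀ snr hVc.measurable hVL hpost
  have hre : ∀ p : ℝ × ℝ, ((p.1 : ℂ) + (p.2 : ℂ) * Complex.I).re = p.1 := fun p => by simp
  have him : ∀ p : ℝ × ℝ, ((p.1 : ℂ) + (p.2 : ℂ) * Complex.I).im = p.2 := fun p => by simp
  have hA : ∫ xn, starRingEnd ℂ (V xn) * (h₀ * xn.1) ∂(qamLaw.prod stdComplexGaussian)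
      = -(h₀ * ((2 * (2 * k / (2 * k + 1)) : ℝ) : ℂ)) := by
    have hi : Integrable (fun xn : ℂ × ℂ => starRingEnd ℂ (V xn) * (h₀ * xn.1))
        (qamLaw.prod stdComplexGaussian) := MemLp.integrable_mul hVL.star (memLp_fst_prod hXL h₀)
    rw [integral_prod _ hi]
    have hin : ∀ x : ℂ, ∫ n, starRingEnd ℂ (V (x, n)) * (h₀ * x) ∂stdComplexGaussian
        = h₀ * ((w' x.re : ℂ) - Complex.I * (w' x.im : ℂ)) * x := by
      intro x
      have hlin : ∀ (a b : ℝ) (d : ℂ), Integrable (fun n : ℂ => ((a + b * (2 * (d * n).re) : ℝ) : ℂ))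
        stdComplexGaussian := fun a b d =>
        ((integrable_const _).add (((integrable_re_mul d).const_mul 2).const_mul b)).ofReal
      have hval : ∀ (a b : ℝ) (d : ℂ), ∫ n : ℂ, ((a + b * (2 * (d * n).re) : ℝ) : ℂ)
          ∂stdComplexGaussian = a := by
        intro a b d
        rw [integral_complex_ofReal, integral_add (integrable_const _)
          (((integrable_re_mul d).const_mul 2).const_mul b), integral_const_mul,
          integral_const_mul, integral_re_mul]
        simp
      simp only [hV, map_add, map_mul, Complex.conj_ofReal, Complex.conj_I]
      rw [integral_mul_const, integral_add (by simpa only [map_mul] using hlin _ _ _)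
        ((by simpa only [map_mul, Complex.conj_I] using hlin _ _ _ : Integrable _ _).const_mul _),
        integral_const_mul]
      have e1 := hval (w' x.re) (w x.re) (starRingEnd ℂ (κ * 1))
      have e2 := hval (w' x.im) (w x.im) (starRingEnd ℂ (κ * Complex.I))
      simp only [map_mul, Complex.conj_I] at e1 e2
      rw [e1, e2]
      ring
    simp_rw [hin]
    rw [integral_qamLaw]
    simp only [hre, him]
    have hexp : ∀ p : ℝ × ℝ, h₀ * ((w' p.1 : ℂ) - Complex.I * (w' p.2 : ℂ))
        * ((p.1 : ℂ) + (p.2 : ℂ) * Complex.I)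
        = h₀ * (((p.1 * w' p.1) * 1 + 1 * (p.2 * w' p.2) : ℝ) : ℂ)
          + h₀ * Complex.I * ((w' p.1 * p.2 - p.1 * w' p.2 : ℝ) : ℂ) := by
      intro p
      push_cast
      linear_combination (-(h₀ * w' p.2 * p.2)) * Complex.I_sq
    simp_rw [hexp]
    have hcw' : Continuous w' := continuous_bumpDeriv _ _
    have i1 : Integrable (fun p : ℝ × ℝ => (p.1 * w' p.1) * 1) ((symmUniform c).prod (symmUniform c)) :=
      integrable_symmUniform_prod hc0 (by fun_prop)
    have i2 : Integrable (fun p : ℝ × ℝ => 1 * (p.2 * w' p.2)) ((symmUniform c).prod (symmUniform c)) :=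
      integrable_symmUniform_prod hc0 (by fun_prop)
    have i3 : Integrable (fun p : ℝ × ℝ => w' p.1 * p.2) ((symmUniform c).prod (symmUniform c)) :=
      integrable_symmUniform_prod hc0 (by fun_prop)
    have i4 : Integrable (fun p : ℝ × ℝ => p.1 * w' p.2) ((symmUniform c).prod (symmUniform c)) :=
      integrable_symmUniform_prod hc0 (by fun_prop)
    rw [integral_add (integrable_symmUniform_prod hc0 (by fun_prop))
      (integrable_symmUniform_prod hc0 (by fun_prop)), integral_const_mul, integral_const_mul,
      integral_complex_ofReal, integral_complex_ofReal, integral_add i1 i2, integral_sub i3 i4,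
      integral_prod_mul (fun a => a * w' a) (fun _ => 1),
      integral_prod_mul (fun _ => 1) (fun a => a * w' a),
      integral_prod_mul w' (fun a => a), integral_prod_mul (fun a => a) w',
      integral_mul_bumpDeriv hc0 hk, integral_bumpDeriv hc0]
    simp
    ring
  have hB : ∫ xn, ‖V xn‖ ^ 2 ∂(qamLaw.prod stdComplexGaussian)
      ≤ 4 * (4 * k ^ 2 / (3 * (4 * k - 1)) + ‖κ‖ ^ 2) := by
    rw [integral_prod _ (hVL.integrable_norm_pow (by norm_num))]
    have hin : ∀ x : ℂ, ∫ n, ‖V (x, n)‖ ^ 2 ∂stdComplexGaussian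
        = (w' x.re ^ 2 + (2 * ‖κ‖ ^ 2) * w x.re ^ 2) + (w' x.im ^ 2 + (2 * ‖κ‖ ^ 2) * w x.im ^ 2) := by
      intro x
      have : ∀ n, ‖V (x, n)‖ ^ 2 = (w' x.re + (2 * w x.re) * (starRingEnd ℂ (κ * 1) * n).re) ^ 2
          + (w' x.im + (2 * w x.im) * (starRingEnd ℂ (κ * Complex.I) * n).re) ^ 2 := by
        intro n
        simp only [hV]
        generalize (starRingEnd ℂ (κ * 1) * n).re = r1
        generalize (starRingEnd ℂ (κ * Complex.I) * n).re = r2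
        rw [← Complex.normSq_eq_norm_sq, Complex.normSq_apply]
        simp only [Complex.add_re, Complex.add_im, Complex.ofReal_re, Complex.ofReal_im,
          Complex.mul_re, Complex.mul_im, Complex.I_re, Complex.I_im]
        ring
      simp_rw [this]
      rw [integral_add (integrable_affine_sq _ _ _) (integrable_affine_sq _ _ _),
        integral_affine_sq, integral_affine_sq, RCLike.norm_conj, RCLike.norm_conj, norm_mul κ,
        norm_mul κ, Complex.norm_I, norm_one]
      ring
    simp_rw [hin]
    rw [integral_qamLaw]
    simp only [hre, him]
    have hcw' : Continuous w' := continuous_bumpDeriv _ _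
    have hcw : Continuous w := continuous_bump _ _
    have hone : ∫ r, (w' r ^ 2 + (2 * ‖κ‖ ^ 2) * w r ^ 2) ∂(symmUniform c)
        ≤ 2 * (4 * k ^ 2 / (3 * (4 * k - 1)) + ‖κ‖ ^ 2) := by
      rw [integral_add (integrable_symmUniform hc0 (by fun_prop))
        ((integrable_symmUniform hc0 (by fun_prop)).const_mul _), integral_const_mul,
        integral_bumpDeriv_sq hc0 hk]
      have h3 : c ^ 2 = 3 / 2 := Real.sq_sqrt (by norm_num)
      have hk' : (1 : ℝ) ≤ k := by exact_mod_cast hk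
      have h4 : (4 * k ^ 2 / (3 / 2 * (4 * k - 1)) : ℝ) = 2 * (4 * k ^ 2 / (3 * (4 * k - 1))) := by
        have : (4 * k - 1 : ℝ) ≠ 0 := by linarith
        field_simp
      rw [h3, h4]
      have := integral_bump_sq_le hc0 k
      nlinarith [sq_nonneg ‖κ‖, mul_le_mul_of_nonneg_left this (sq_nonneg ‖κ‖)]
    have i1 : Integrable (fun p : ℝ × ℝ => w' p.1 ^ 2 + (2 * ‖κ‖ ^ 2) * w p.1 ^ 2)
      ((symmUniform c).prod (symmUniform c)) := integrable_symmUniform_prod hc0 (by fun_prop)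
    have i2 : Integrable (fun p : ℝ × ℝ => w' p.2 ^ 2 + (2 * ‖κ‖ ^ 2) * w p.2 ^ 2)
      ((symmUniform c).prod (symmUniform c)) := integrable_symmUniform_prod hc0 (by fun_prop)
    rw [integral_add i1 i2, integral_fun_fst (fun r => w' r ^ 2 + (2 * ‖κ‖ ^ 2) * w r ^ 2),
      integral_fun_snd (fun r => w' r ^ 2 + (2 * ‖κ‖ ^ 2) * w r ^ 2)]
    simp only [probReal_univ, one_smul]
    linarith
  rw [hA, norm_neg, norm_mul, mul_pow, Complex.norm_real, Real.norm_eq_abs, sq_abs, mul_pow] at key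
  have h5 := mul_le_mul_of_nonneg_right hB (condMMSE_nonneg qamLaw h₀ snr)
  rw [← hρ]
  linarith

lemma condMMSE_qamLaw_le {h₀ : ℂ} {snr : ℝ} (hh : h₀ ≠ 0) (hs : 0 < snr) :
    condMMSE qamLaw h₀ snr ≤ 1 / snr := by
  set κ : ℂ := (√snr : ℝ) * h₀ with hκ
  have hρ : ‖κ‖ ^ 2 = ‖h₀‖ ^ 2 * snr := norm_gain_sq h₀ hs.le
  have hκ0 : κ ≠ 0 := by simp [hκ, hh, Real.sqrt_ne_zero'.2 hs]
  have hXL := memLp_id_of_bounded bounded_qamLaw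
  set e : ℂ → ℂ := fun y => h₀ * (y / κ) with he
  have hec : Continuous e := by fun_prop
  have hYe : ∀ xn : ℂ × ℂ, e (channelOutput h₀ snr xn) = h₀ * xn.1 + h₀ * (κ⁻¹ * xn.2) := by
    intro xn
    simp only [he, channelOutput_eq, ← hκ]
    field_simp
  have hL : MemLp (fun xn : ℂ × ℂ => h₀ * (κ⁻¹ * xn.2)) 2 (qamLaw.prod stdComplexGaussian) :=
    (memLp_snd_prod qamLaw κ⁻¹).const_mul h₀
  have he2 : MemLp (fun xn => e (channelOutput h₀ snr xn)) 2 (qamLaw.prod stdComplexGaussian) := by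
    simp_rw [hYe]
    exact (memLp_fst_prod hXL h₀).add hL
  refine (condMMSE_le hXL h₀ snr hec.measurable he2).trans_eq ?_
  simp_rw [hYe, sub_add_cancel_left, norm_neg]
  rw [integral_prod _ (hL.integrable_norm_pow (by norm_num))]
  simp only [norm_mul h₀, mul_pow, integral_const_mul, integral_norm_sq_mul]
  rw [norm_inv, inv_pow, hρ]
  have : ‖h₀‖ ≠ 0 := norm_ne_zero_iff.2 hh
  simp
  field_simp

/-! ### Averaging over the channel gain -/

/-- The real-valued version of `fadingFun`. -/
def fadingReal (fh : ℝ → ℝ) (t : ℝ) : ℝ := √t * fh √t / 2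

lemma fadingFun_eq (fh : ℝ → ℝ) (t : ℝ) : fadingFun fh t = (fadingReal fh t : ℂ) := rfl

lemma ae_volume_ne_zero : ∀ᵐ r : ℝ, r ≠ 0 := by
  rw [ae_iff]
  simp

section Gain

variable {Ph : Measure ℂ} {fh : ℝ → ℝ}

lemma fadingReal_nonneg (hfh : IsGainDensity Ph fh) (t : ℝ) : 0 ≤ fadingReal fh t := by
  have := hfh.2.1 √t
  unfold fadingReal
  positivity

/-- A modulus is nonnegative and a law with a density has no atom at 0. The density may therefore be
restricted to the half-line, where the substitution `t = r²` is available. -/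
lemma map_norm_eq_restrict (hfh : IsGainDensity Ph fh) :
    Ph.map (fun z : ℂ => ‖z‖)
      = (volume.restrict (Set.Ioi (0 : ℝ))).withDensity (fun r => ENNReal.ofReal (fh r)) := by
  have hpos : ∀ᵐ r ∂(Ph.map (fun z : ℂ => ‖z‖)), r ∈ Set.Ioi (0 : ℝ) := by
    have h1 : ∀ᵐ r ∂(Ph.map (fun z : ℂ => ‖z‖)), 0 ≤ r := by
      rw [ae_map_iff (by fun_prop) measurableSet_Ici]
      exact ae_of_all _ fun z => norm_nonneg z
    have h2 : ∀ᵐ r ∂(Ph.map (fun z : ℂ => ‖z‖)), r ≠ 0 := by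
      rw [hfh.2.2]
      exact (withDensity_absolutelyContinuous _ _).ae_le ae_volume_ne_zero
    filter_upwards [h1, h2] with r a b using lt_of_le_of_ne a (Ne.symm b)
  rw [← Measure.restrict_eq_self_of_ae_mem hpos, hfh.2.2, restrict_withDensity measurableSet_Ioi]

lemma ae_gain_ne_zero (hfh : IsGainDensity Ph fh) : ∀ᵐ h ∂Ph, h ≠ 0 := by
  have h2 : ∀ᵐ r ∂(Ph.map (fun z : ℂ => ‖z‖)), r ≠ 0 := by
    rw [hfh.2.2]
    exact (withDensity_absolutelyContinuous _ _).ae_le ae_volume_ne_zero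
  have h3 := ae_of_ae_map (by fun_prop) h2
  filter_upwards [h3] with h hh
  exact norm_ne_zero_iff.1 hh

/-- The Jacobian of `t = r²`: under it the law `fh(r) dr` of the modulus becomes the law `f(t)/t dt`
of its square. -/
lemma half_mul_rpow_mul_eq (fh : ℝ → ℝ) (G : ℝ → ℝ) {t : ℝ} (ht : 0 < t) :
    (|(1 / 2 : ℝ)| * t ^ ((1 / 2 : ℝ) - 1)) • (fh (t ^ (1 / 2 : ℝ)) * G ((t ^ (1 / 2 : ℝ)) ^ 2))
      = G t * (fadingReal fh t / t) := by
  have h1 : t ^ (1 / 2 : ℝ) = √t := (Real.sqrt_eq_rpow t).symm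
  have h2 : √t ^ 2 = t := Real.sq_sqrt ht.le
  have h3 : t ^ ((1 / 2 : ℝ) - 1) = √t / t := by
    rw [Real.rpow_sub_one ht.ne', h1]
  rw [h1, h2, h3, fadingReal, smul_eq_mul, abs_of_pos (by norm_num)]
  ring

lemma integrable_gain_iff (hfh : IsGainDensity Ph fh) {G : ℝ → ℝ} (hG : Measurable G) :
    Integrable (fun h : ℂ => G (‖h‖ ^ 2)) Ph
      ↔ IntegrableOn (fun t => G t * (fadingReal fh t / t)) (Set.Ioi 0) := by
  have hfm := hfh.1
  have hG2 : Measurable fun r : ℝ => G (r ^ 2) := hG.comp (measurable_id.pow_const 2)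
  have h1 : Integrable (fun h : ℂ => G (‖h‖ ^ 2)) Ph
      ↔ Integrable (fun r : ℝ => G (r ^ 2)) (Ph.map (fun z : ℂ => ‖z‖)) := by
    rw [integrable_map_measure hG2.aestronglyMeasurable
      (by fun_prop)]
    rfl
  rw [h1, map_norm_eq_restrict hfh, integrable_withDensity_iff_integrable_smul' (by fun_prop)
    (ae_of_all _ fun _ => ENNReal.ofReal_lt_top)]
  have h2 : ∀ r, (ENNReal.ofReal (fh r)).toReal • G (r ^ 2) = fh r * G (r ^ 2) := by
    intro r; rw [ENNReal.toReal_ofReal (hfh.2.1 r), smul_eq_mul]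
  simp_rw [h2]
  change IntegrableOn (fun r => fh r * G (r ^ 2)) (Set.Ioi 0) ↔ _
  rw [← integrableOn_Ioi_comp_rpow_iff (fun r => fh r * G (r ^ 2)) (p := 1 / 2) (by norm_num)]
  exact integrableOn_congr_fun (fun t ht => half_mul_rpow_mul_eq fh G ht) measurableSet_Ioi

lemma integral_gain_eq (hfh : IsGainDensity Ph fh) {G : ℝ → ℝ} (hG : Measurable G) :
    ∫ h, G (‖h‖ ^ 2) ∂Ph = ∫ t in Set.Ioi 0, G t * (fadingReal fh t / t) := by
  have hfm := hfh.1
  have hG2 : Measurable fun r : ℝ => G (r ^ 2) := hG.comp (measurable_id.pow_const 2)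
  have h1 : ∫ h, G (‖h‖ ^ 2) ∂Ph = ∫ r, G (r ^ 2) ∂(Ph.map (fun z : ℂ => ‖z‖)) := by
    rw [integral_map (by fun_prop) hG2.aestronglyMeasurable]
  rw [h1, map_norm_eq_restrict hfh, integral_withDensity_eq_integral_toReal_smul (by fun_prop)
    (ae_of_all _ fun _ => ENNReal.ofReal_lt_top)]
  have h2 : ∀ r, (ENNReal.ofReal (fh r)).toReal • G (r ^ 2) = fh r * G (r ^ 2) := by
    intro r; rw [ENNReal.toReal_ofReal (hfh.2.1 r), smul_eq_mul]
  simp_rw [h2]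
  rw [← integral_comp_rpow_Ioi (fun r => fh r * G (r ^ 2)) (p := 1 / 2) (by norm_num)]
  exact setIntegral_congr_fun measurableSet_Ioi (fun t ht => half_mul_rpow_mul_eq fh G ht)

lemma integrableOn_fadingReal (hfh : IsGainDensity Ph fh)
    (hPh : Integrable (fun z : ℂ => ‖z‖ ^ 2) Ph) :
    IntegrableOn (fadingReal fh) (Set.Ioi 0) := by
  have h := (integrable_gain_iff hfh (G := fun t => t) measurable_id).1 hPh
  refine h.congr_fun (fun t ht => ?_) measurableSet_Ioi
  have : t ≠ 0 := (Set.mem_Ioi.1 ht).ne'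
  field_simp

/-- This is `M[f; 0]`, the total mass of the law of `|h|²`, which is why the leading term for
bounded inputs is `ζ/snr`. -/
lemma integral_fadingReal_div [IsProbabilityMeasure Ph] (hfh : IsGainDensity Ph fh) :
    ∫ t in Set.Ioi 0, fadingReal fh t / t = 1 := by
  have h := integral_gain_eq hfh (G := fun _ => 1) measurable_const
  simpa using h.symm

lemma avgMMSE_stdComplexGaussian (hfh : IsGainDensity Ph fh) {snr : ℝ} (hs : 0 ≤ snr) :
    avgMMSE stdComplexGaussian Ph snr = ∫ t in Set.Ioi 0, fadingReal fh t / (1 + snr * t) := by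
  unfold avgMMSE
  simp_rw [condMMSE_stdComplexGaussian _ hs]
  rw [integral_gain_eq hfh (G := fun t => t / (1 + t * snr)) (by fun_prop)]
  refine setIntegral_congr_fun measurableSet_Ioi (fun t ht => ?_)
  have : t ≠ 0 := (Set.mem_Ioi.1 ht).ne'
  field_simp

/-- A uniform bound on the conditional error gives the one-term expansion of the average. -/
lemma abs_avgMMSE_sub_le [IsProbabilityMeasure Ph] (hfh : IsGainDensity Ph fh) (hPh : Integrable (fun z : ℂ => ‖z‖ ^ 2) Ph)
    {PX : Measure ℂ} [IsProbabilityMeasure PX] (hb : ∀ᵐ x ∂PX, ‖x‖ ≤ 2) {ζ K R : ℝ} {snr : ℝ}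
    (hs : 0 < snr)
    (hK : ∀ h₀ : ℂ, h₀ ≠ 0 →
      |condMMSE PX h₀ snr - ζ / snr| ≤ K * (‖h₀‖ ^ 2 * (‖h₀‖ ^ 2 * snr) ^ (-R)))
    (hint : IntegrableOn (fun t => t ^ (-R) * fadingReal fh t) (Set.Ioi 0)) :
    |avgMMSE PX Ph snr - ζ / snr|
      ≤ (K * ∫ t in Set.Ioi 0, t ^ (-R) * fadingReal fh t) * snr ^ (-R) := by
  have hi1 : Integrable (fun h₀ => condMMSE PX h₀ snr) Ph := by
    refine (hPh.const_mul 4).mono' (measurable_condMMSE hb snr).aestronglyMeasurable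
      (ae_of_all _ fun h₀ => ?_)
    rw [Real.norm_of_nonneg (condMMSE_nonneg _ _ _)]
    exact condMMSE_le_four_mul hb h₀ snr
  have heq : ∀ t ∈ Set.Ioi (0 : ℝ), (t * t ^ (-R)) * (fadingReal fh t / t)
      = t ^ (-R) * fadingReal fh t := by
    intro t ht
    have : t ≠ 0 := (Set.mem_Ioi.1 ht).ne'
    field_simp
  have hGm : Measurable fun t : ℝ => t * t ^ (-R) := by fun_prop
  have hG : Integrable (fun h : ℂ => ‖h‖ ^ 2 * (‖h‖ ^ 2) ^ (-R)) Ph :=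
    (integrable_gain_iff hfh hGm).2
      (hint.congr_fun (fun t ht => (heq t ht).symm) measurableSet_Ioi)
  have hGv : ∫ h : ℂ, ‖h‖ ^ 2 * (‖h‖ ^ 2) ^ (-R) ∂Ph
      = ∫ t in Set.Ioi 0, t ^ (-R) * fadingReal fh t := by
    rw [integral_gain_eq hfh hGm]
    exact setIntegral_congr_fun measurableSet_Ioi heq
  have hsub : avgMMSE PX Ph snr - ζ / snr = ∫ h₀, (condMMSE PX h₀ snr - ζ / snr) ∂Ph := by
    rw [integral_sub hi1 (integrable_const _)]
    simp [avgMMSE]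
  rw [hsub, ← Real.norm_eq_abs]
  calc _ ≤ ∫ h₀ : ℂ, (K * snr ^ (-R)) * (‖h₀‖ ^ 2 * (‖h₀‖ ^ 2) ^ (-R)) ∂Ph := by
        refine norm_integral_le_of_norm_le (hG.const_mul _) ?_
        filter_upwards [ae_gain_ne_zero hfh] with h₀ hh
        refine (hK h₀ hh).trans_eq ?_
        rw [Real.mul_rpow (by positivity) hs.le]
        ring
    _ = _ := by rw [integral_const_mul, hGv]; ring

end Gain

/-! ### Uniform error bounds for the bounded inputs -/

/-- Only `ρ < 1` needs an argument beyond lowering the exponent. There `ρ^(-R)` exceeds both 1 and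
`ρ⁻¹`, because `R ≥ 1`, and so dominates the trivial bound `4|h₀|²` as well as `ζ/snr = ζ|h₀|² ρ⁻¹`.
The freedom to lower `R` matters later, since only moments allowed by `f` near 0 can be averaged. -/
lemma abs_condMMSE_sub_le_of_large {PX : Measure ℂ} [IsProbabilityMeasure PX]
    (hb : ∀ᵐ x ∂PX, ‖x‖ ≤ 2) {ζ K R₀ : ℝ} (hζ : 0 ≤ ζ) (hK0 : 0 ≤ K)
    (hK : ∀ (h₀ : ℂ) (snr : ℝ), h₀ ≠ 0 → 0 < snr → 1 ≤ ‖h₀‖ ^ 2 * snr →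
      |condMMSE PX h₀ snr - ζ / snr| ≤ K * (‖h₀‖ ^ 2 * (‖h₀‖ ^ 2 * snr) ^ (-R₀)))
    {R : ℝ} (hR1 : 1 ≤ R) (hR : R ≤ R₀) (h₀ : ℂ) (snr : ℝ) (hh : h₀ ≠ 0) (hs : 0 < snr) :
    |condMMSE PX h₀ snr - ζ / snr| ≤ (K + 4 + ζ) * (‖h₀‖ ^ 2 * (‖h₀‖ ^ 2 * snr) ^ (-R)) := by
  have hn : 0 < ‖h₀‖ := norm_pos_iff.2 hh
  set ρ := ‖h₀‖ ^ 2 * snr with hρ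
  have hρ0 : 0 < ρ := by positivity
  have hpos : 0 ≤ ‖h₀‖ ^ 2 * ρ ^ (-R) := by positivity
  by_cases h1 : 1 ≤ ρ
  · refine (hK h₀ snr hh hs h1).trans ?_
    calc K * (‖h₀‖ ^ 2 * ρ ^ (-R₀)) ≤ K * (‖h₀‖ ^ 2 * ρ ^ (-R)) := by
          gcongr
      _ ≤ _ := by
          refine mul_le_mul_of_nonneg_right ?_ hpos
          linarith
  · push Not at h1
    have e1 : 1 ≤ ρ ^ (-R) := Real.one_le_rpow_of_pos_of_le_one_of_nonpos hρ0 h1.le (by linarith)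
    have e2 : ρ⁻¹ ≤ ρ ^ (-R) := by
      rw [← Real.rpow_neg_one]
      exact Real.rpow_le_rpow_of_exponent_ge hρ0 h1.le (by linarith)
    have e3 : ζ / snr = ζ * (‖h₀‖ ^ 2 * ρ⁻¹) := by
      rw [hρ]; field_simp
    have e4 := condMMSE_le_four_mul hb h₀ snr
    have e5 := condMMSE_nonneg PX h₀ snr
    have e6 : 4 * ‖h₀‖ ^ 2 ≤ 4 * (‖h₀‖ ^ 2 * ρ ^ (-R)) := by
      nlinarith [sq_nonneg ‖h₀‖]
    have e7 : ζ / snr ≤ ζ * (‖h₀‖ ^ 2 * ρ ^ (-R)) := by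
      rw [e3]; gcongr
    have e8 : 0 ≤ ζ / snr := by positivity
    have e9 : 0 ≤ ζ * (‖h₀‖ ^ 2 * ρ ^ (-R)) := by positivity
    have e10 : 0 ≤ K * (‖h₀‖ ^ 2 * ρ ^ (-R)) := by positivity
    rw [abs_le]
    constructor <;> nlinarith

lemma rpow_neg_three_half {x : ℝ} (hx : 0 ≤ x) : x ^ (-(3 / 2) : ℝ) = (x * √x)⁻¹ := by
  rw [Real.rpow_neg hx, show (3 / 2 : ℝ) = 1 + 1 / 2 by norm_num,
    Real.rpow_add_of_nonneg hx (by norm_num) (by norm_num), Real.rpow_one, Real.sqrt_eq_rpow]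

lemma pskLaw_error_bound : ∃ K : ℝ, ∀ R : ℝ, 1 ≤ R → R ≤ 2 → ∀ (h₀ : ℂ) (snr : ℝ), h₀ ≠ 0 → 0 < snr →
    |condMMSE pskLaw h₀ snr - (1 / 2) / snr| ≤ K * (‖h₀‖ ^ 2 * (‖h₀‖ ^ 2 * snr) ^ (-R)) := by
  obtain ⟨K, hK0, hK⟩ := condMMSE_pskLaw_le
  refine ⟨(K + 1) + 4 + 1 / 2, fun R hR1 hR => abs_condMMSE_sub_le_of_large (R₀ := 2) (K := K + 1) bounded_pskLaw
    (by norm_num) (by positivity) ?_ hR1 hR⟩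
  intro h₀ snr hh hs h1
  have hn : 0 < ‖h₀‖ := norm_pos_iff.2 hh
  have hup := hK h₀ snr hh hs h1
  have hlow := le_condMMSE_pskLaw h₀ hs.le
  have e3 : (1 / 2) / snr = ‖h₀‖ ^ 2 * (1 / (2 * (‖h₀‖ ^ 2 * snr))) := by field_simp
  have e2 : (‖h₀‖ ^ 2 * snr) ^ (-2 : ℝ) = ((‖h₀‖ ^ 2 * snr) ^ 2)⁻¹ := by
    rw [Real.rpow_neg (by positivity)]; norm_cast
  rw [e2, e3]
  generalize ‖h₀‖ ^ 2 * snr = ρ at *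
  have hρ0 : 0 < ρ := by linarith
  have e4 : ‖h₀‖ ^ 2 / (1 + 2 * ρ) ≥ ‖h₀‖ ^ 2 * (1 / (2 * ρ) - (ρ ^ 2)⁻¹) := by
    rw [ge_iff_le, div_eq_mul_inv (‖h₀‖ ^ 2)]
    gcongr
    rw [← sub_nonneg]
    have : (1 + 2 * ρ)⁻¹ - (1 / (2 * ρ) - (ρ ^ 2)⁻¹) = (3 * ρ + 2) / (2 * ρ ^ 2 * (1 + 2 * ρ)) := by
      field_simp
      ring
    rw [this]
    positivity
  have e5 : 0 ≤ ‖h₀‖ ^ 2 * (ρ ^ 2)⁻¹ := by positivity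
  have e6 : 0 ≤ K * (‖h₀‖ ^ 2 * (ρ ^ 2)⁻¹) := by positivity
  rw [abs_le]
  constructor <;> nlinarith

/-- Arithmetic of the van Trees bound for the polynomial test functions. -/
lemma exists_test_degree {ρ : ℝ} (hρ : 1 ≤ ρ) : ∃ k : ℕ, 1 ≤ k ∧
    1 - 1 / √ρ ≤ (2 * k / (2 * k + 1) : ℝ) ^ 2 ∧ (4 * k ^ 2 / (3 * (4 * k - 1)) : ℝ) ≤ √ρ := by
  have hsq : 1 ≤ √ρ := Real.one_le_sqrt.2 hρ
  -- The relative loss is about `1/k` from the correlation and `k/ρ` from `∫ w'²`. The choice `k ≈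
  -- √ρ` balances them at `ρ^(-1/2)`, which is the origin of the exponent `3/2`.
  refine ⟨⌈√ρ⌉₊, Nat.one_le_ceil_iff.2 (by linarith), ?_, ?_⟩
  · have h1 : √ρ ≤ ⌈√ρ⌉₊ := Nat.le_ceil _
    set k : ℝ := (⌈√ρ⌉₊ : ℝ)
    have hk : 1 ≤ k := hsq.trans h1
    have h2 : 1 / k ≤ 1 / √ρ := by gcongr
    have h3 : 1 - 1 / k ≤ (2 * k / (2 * k + 1)) ^ 2 := by
      rw [← sub_nonneg]
      have : (2 * k / (2 * k + 1)) ^ 2 - (1 - 1 / k) = (3 * k + 1) / (k * (2 * k + 1) ^ 2) := by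
        field_simp
        ring
      rw [this]
      positivity
    linarith
  · have h1 : (⌈√ρ⌉₊ : ℝ) < √ρ + 1 := Nat.ceil_lt_add_one (by positivity)
    have h0 : √ρ ≤ ⌈√ρ⌉₊ := Nat.le_ceil _
    set k : ℝ := (⌈√ρ⌉₊ : ℝ)
    rw [div_le_iff₀ (by nlinarith)]
    nlinarith

lemma pamLaw_error_bound : ∃ K : ℝ, ∀ R : ℝ, 1 ≤ R → R ≤ 3 / 2 → ∀ (h₀ : ℂ) (snr : ℝ), h₀ ≠ 0 →
    0 < snr →
    |condMMSE pamLaw h₀ snr - (1 / 2) / snr| ≤ K * (‖h₀‖ ^ 2 * (‖h₀‖ ^ 2 * snr) ^ (-R)) := by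
  refine ⟨1 + 4 + 1 / 2, fun R hR1 hR => abs_condMMSE_sub_le_of_large (K := 1) (R₀ := 3 / 2) bounded_pamLaw
    (by norm_num) (by positivity) ?_ hR1 hR⟩
  intro h₀ snr hh hs h1
  have hn : 0 < ‖h₀‖ := norm_pos_iff.2 hh
  have hup := condMMSE_pamLaw_le hh hs
  obtain ⟨k, hk, hk1, hk2⟩ := exists_test_degree h1
  have hlow := le_condMMSE_pamLaw h₀ hs.le hk
  have h0 := condMMSE_nonneg pamLaw h₀ snr
  have e3 : (1 / 2) / snr = ‖h₀‖ ^ 2 * (1 / (2 * (‖h₀‖ ^ 2 * snr))) := by field_simp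
  have e3' : 1 / (2 * snr) = ‖h₀‖ ^ 2 * (1 / (2 * (‖h₀‖ ^ 2 * snr))) := by field_simp
  rw [e3'] at hup
  rw [e3, rpow_neg_three_half (by positivity)]
  generalize condMMSE pamLaw h₀ snr = c at *
  generalize ‖h₀‖ ^ 2 * snr = ρ at *
  have hρ0 : 0 < ρ := by linarith
  have hr : 0 < √ρ := Real.sqrt_pos.2 hρ0
  have hlow2 : ‖h₀‖ ^ 2 * (1 - 1 / √ρ) ≤ (√ρ + 2 * ρ) * c := by
    calc _ ≤ ‖h₀‖ ^ 2 * (2 * k / (2 * k + 1) : ℝ) ^ 2 := by gcongr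
      _ ≤ _ := hlow
      _ ≤ _ := by gcongr
  have hlow3 : ‖h₀‖ ^ 2 * (1 / (2 * ρ) - (ρ * √ρ)⁻¹) ≤ c := by
    rw [← div_le_iff₀' (by positivity)] at hlow2
    refine le_trans ?_ hlow2
    rw [mul_div_assoc]
    gcongr
    rw [← sub_nonneg]
    have hsq : ρ = √ρ ^ 2 := (Real.sq_sqrt hρ0.le).symm
    -- In terms of `√ρ` the difference is an explicit positive rational function, so the van Trees
    -- bound loses at most `(ρ√ρ)⁻¹`.
    have : (1 - 1 / √ρ) / (√ρ + 2 * ρ) - (1 / (2 * ρ) - (ρ * √ρ)⁻¹)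
        = (√ρ + 2) / (2 * √ρ ^ 3 * (1 + 2 * √ρ)) := by
      generalize √ρ = r at *
      subst hsq
      field_simp
      ring
    rw [this]
    positivity
  have e5 : 0 ≤ ‖h₀‖ ^ 2 * (ρ * √ρ)⁻¹ := by positivity
  rw [abs_le]
  constructor <;> nlinarith

lemma qamLaw_error_bound : ∃ K : ℝ, ∀ R : ℝ, 1 ≤ R → R ≤ 3 / 2 → ∀ (h₀ : ℂ) (snr : ℝ), h₀ ≠ 0 →
    0 < snr →
    |condMMSE qamLaw h₀ snr - 1 / snr| ≤ K * (‖h₀‖ ^ 2 * (‖h₀‖ ^ 2 * snr) ^ (-R)) := by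
  refine ⟨2 + 4 + 1, fun R hR1 hR => abs_condMMSE_sub_le_of_large (K := 2) (R₀ := 3 / 2) bounded_qamLaw
    (by norm_num) (by positivity) ?_ hR1 hR⟩
  intro h₀ snr hh hs h1
  have hn : 0 < ‖h₀‖ := norm_pos_iff.2 hh
  have hup := condMMSE_qamLaw_le hh hs
  obtain ⟨k, hk, hk1, hk2⟩ := exists_test_degree h1
  have hlow := le_condMMSE_qamLaw h₀ hs.le hk
  have h0 := condMMSE_nonneg qamLaw h₀ snr
  have e3 : 1 / snr = ‖h₀‖ ^ 2 * (1 / (‖h₀‖ ^ 2 * snr)) := by field_simp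
  rw [e3] at hup ⊢
  rw [rpow_neg_three_half (by positivity)]
  generalize condMMSE qamLaw h₀ snr = c at *
  generalize ‖h₀‖ ^ 2 * snr = ρ at *
  have hρ0 : 0 < ρ := by linarith
  have hr : 0 < √ρ := Real.sqrt_pos.2 hρ0
  have hlow2 : ‖h₀‖ ^ 2 * (1 - 1 / √ρ) ≤ (√ρ + ρ) * c := by
    calc _ ≤ ‖h₀‖ ^ 2 * (2 * k / (2 * k + 1) : ℝ) ^ 2 := by gcongr
      _ ≤ _ := hlow
      _ ≤ _ := by gcongr
  have hlow3 : ‖h₀‖ ^ 2 * (1 / ρ - 2 * (ρ * √ρ)⁻¹) ≤ c := by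
    rw [← div_le_iff₀' (by positivity)] at hlow2
    refine le_trans ?_ hlow2
    rw [mul_div_assoc]
    gcongr
    rw [← sub_nonneg]
    have hsq : ρ = √ρ ^ 2 := (Real.sq_sqrt hρ0.le).symm
    have : (1 - 1 / √ρ) / (√ρ + ρ) - (1 / ρ - 2 * (ρ * √ρ)⁻¹)
        = 2 / (√ρ ^ 3 * (1 + √ρ)) := by
      generalize √ρ = r at *
      subst hsq
      field_simp
      ring
    rw [this]
    positivity
  have e5 : 0 ≤ ‖h₀‖ ^ 2 * (ρ * √ρ)⁻¹ := by positivity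
  rw [abs_le]
  constructor <;> nlinarith

/-! ### Powers times logarithms -/

lemma norm_cpow_mul_log_pow (b : ℂ) (n : ℕ) {u : ℝ} (hu : 0 < u) :
    ‖(u : ℂ) ^ b * ((Real.log u : ℝ) : ℂ) ^ n‖ = u ^ b.re * |Real.log u| ^ n := by
  rw [norm_mul, norm_pow, Complex.norm_cpow_eq_rpow_re_of_pos hu, Complex.norm_real,
    Real.norm_eq_abs]

lemma isLittleO_cpow_mul_log_pow_atTop {b : ℂ} {D : ℝ} (h : b.re < D) (n : ℕ) :
    (fun u : ℝ => (u : ℂ) ^ b * ((Real.log u : ℝ) : ℂ) ^ n) =o[atTop] fun u : ℝ => u ^ D := by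
  have h1 := isLittleO_log_rpow_rpow_atTop (n : ℝ) (sub_pos.2 h)
  have h2 := (isBigO_refl (fun u : ℝ => u ^ b.re) atTop).mul_isLittleO h1.norm_left
  refine IsLittleO.of_norm_left ?_
  refine h2.congr' ?_ ?_
  · filter_upwards [eventually_gt_atTop 0] with u hu
    rw [norm_cpow_mul_log_pow b n hu, Real.rpow_natCast, norm_pow, Real.norm_eq_abs]
  · filter_upwards [eventually_gt_atTop 0] with u hu
    rw [← Real.rpow_add hu]; ring_nf

lemma isLittleO_cpow_mul_log_pow_zero {b : ℂ} {D : ℝ} (h : D < b.re) (n : ℕ) :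
    (fun u : ℝ => (u : ℂ) ^ b * ((Real.log u : ℝ) : ℂ) ^ n) =o[𝓝[>] 0] fun u : ℝ => u ^ D := by
  have h1 := isLittleO_abs_log_rpow_rpow_nhdsGT_zero (n : ℝ) (sub_neg.2 h)
  have h2 := (isBigO_refl (fun u : ℝ => u ^ b.re) (𝓝[>] 0)).mul_isLittleO h1
  refine IsLittleO.of_norm_left ?_
  refine h2.congr' ?_ ?_
  · filter_upwards [self_mem_nhdsWithin] with u hu
    rw [norm_cpow_mul_log_pow b n hu, Real.rpow_natCast]
  · filter_upwards [self_mem_nhdsWithin] with u hu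
    rw [← Real.rpow_add hu]; ring_nf

lemma isBigO_rpow_zero_of_le {a b : ℝ} (h : a ≤ b) :
    (fun t : ℝ => t ^ b) =O[𝓝[>] 0] fun t : ℝ => t ^ a := by
  refine IsBigO.of_bound 1 ?_
  filter_upwards [Ioo_mem_nhdsGT (show (0 : ℝ) < 1 by norm_num)] with t ht
  rw [Real.norm_of_nonneg (Real.rpow_nonneg ht.1.le _),
    Real.norm_of_nonneg (Real.rpow_nonneg ht.1.le _), one_mul]
  exact Real.rpow_le_rpow_of_exponent_ge ht.1 ht.2.le h

lemma isBigO_rpow_top_of_le {a b : ℝ} (h : a ≤ b) :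
    (fun t : ℝ => t ^ a) =O[atTop] fun t : ℝ => t ^ b := by
  refine IsBigO.of_bound 1 ?_
  filter_upwards [eventually_ge_atTop 1] with t ht
  have h0 : 0 ≤ t := by linarith
  rw [Real.norm_of_nonneg (Real.rpow_nonneg h0 _),
    Real.norm_of_nonneg (Real.rpow_nonneg h0 _), one_mul]
  exact Real.rpow_le_rpow_of_exponent_le ht h

/-- The finite sums of a fading expansion. -/
def fadingSum (N : ℕ → ℕ) (p : ℕ → ℕ → ℂ) (a : ℕ → ℂ) (k : ℕ) (t : ℝ) : ℂ :=
  ∑ m ∈ Finset.range (k + 1), ∑ n ∈ Finset.range (N m + 1),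
    p m n * (t : ℂ) ^ a m * ((Real.log t : ℝ) : ℂ) ^ n

lemma isBigO_fadingSum {N : ℕ → ℕ} {p : ℕ → ℕ → ℂ} {a : ℕ → ℂ} {D : ℝ}
    (hD : ∀ m, D < (a m).re) (k : ℕ) :
    fadingSum N p a k =O[𝓝[>] 0] fun t : ℝ => t ^ D := by
  refine IsBigO.fun_sum (A := fun m (t : ℝ) => ∑ n ∈ Finset.range (N m + 1),
    p m n * (t : ℂ) ^ a m * ((Real.log t : ℝ) : ℂ) ^ n) fun m _ => ?_
  refine IsBigO.fun_sum (A := fun n (t : ℝ) =>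
    p m n * (t : ℂ) ^ a m * ((Real.log t : ℝ) : ℂ) ^ n) fun n _ => ?_
  simp_rw [mul_assoc]
  exact (isLittleO_cpow_mul_log_pow_zero (hD m) n).isBigO.const_mul_left _

/-! ### Symbols and finite differences -/

/-- `T` and its first `j` derivatives have the growth of `u ^ B` and its derivatives. -/
def IsSymbol : ℕ → ℝ → (ℝ → ℂ) → Prop
  | 0, B, T => T =O[atTop] fun u : ℝ => u ^ B
  | j + 1, B, T => T =O[atTop] (fun u : ℝ => u ^ B) ∧
      ∃ T' : ℝ → ℂ, (∀ᶠ u in atTop, HasDerivAt T (T' u) u) ∧ IsSymbol j (B - 1) T'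

lemma IsSymbol.isBigO {j : ℕ} {B : ℝ} {T : ℝ → ℂ} (h : IsSymbol j B T) :
    T =O[atTop] fun u : ℝ => u ^ B := by
  cases j with
  | zero => exact h
  | succ j => exact h.1

lemma isSymbol_zero (j : ℕ) (B : ℝ) : IsSymbol j B (fun _ => 0) := by
  induction j generalizing B with
  | zero => exact isBigO_zero _ _
  | succ j ih => exact ⟨isBigO_zero _ _, fun _ => 0, Eventually.of_forall fun u => hasDerivAt_const u 0,
      ih _⟩

lemma IsSymbol.add {j : ℕ} {B : ℝ} {S T : ℝ → ℂ} (hS : IsSymbol j B S) (hT : IsSymbol j B T) :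
    IsSymbol j B (fun u => S u + T u) := by
  induction j generalizing B S T with
  | zero => exact IsBigO.add hS hT
  | succ j ih =>
    obtain ⟨h1, S', hS1, hS2⟩ := hS
    obtain ⟨h2, T', hT1, hT2⟩ := hT
    exact ⟨h1.add h2, fun u => S' u + T' u, by
      filter_upwards [hS1, hT1] with u a b using a.add b, ih hS2 hT2⟩

lemma IsSymbol.const_mul {j : ℕ} {B : ℝ} {T : ℝ → ℂ} (hT : IsSymbol j B T) (c : ℂ) :
    IsSymbol j B (fun u => c * T u) := by
  induction j generalizing B T with
  | zero => exact IsBigO.const_mul_left hT c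
  | succ j ih =>
    obtain ⟨h2, T', hT1, hT2⟩ := hT
    exact ⟨h2.const_mul_left c, fun u => c * T' u, by
      filter_upwards [hT1] with u a using a.const_mul c, ih hT2⟩

lemma IsSymbol.sum {ι : Type*} {s : Finset ι} {j : ℕ} {B : ℝ} {T : ι → ℝ → ℂ}
    (h : ∀ i ∈ s, IsSymbol j B (T i)) : IsSymbol j B (fun u => ∑ i ∈ s, T i u) := by
  classical
  induction s using Finset.induction_on with
  | empty => simpa using isSymbol_zero j B
  | insert i s hi ih =>
    simp_rw [Finset.sum_insert hi]
    exact (h i (Finset.mem_insert_self _ _)).add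
      (ih fun i' hi' => h i' (Finset.mem_insert_of_mem hi'))

lemma IsSymbol.conj {j : ℕ} {B : ℝ} {T : ℝ → ℂ} (hT : IsSymbol j B T) :
    IsSymbol j B (fun u => starRingEnd ℂ (T u)) := by
  induction j generalizing B T with
  | zero => exact IsBigO.of_norm_left (by simpa using IsBigO.norm_left hT)
  | succ j ih =>
    obtain ⟨h2, T', hT1, hT2⟩ := hT
    refine ⟨IsBigO.of_norm_left (by simpa using h2.norm_left), fun u => starRingEnd ℂ (T' u), ?_,
      ih hT2⟩
    filter_upwards [hT1] with u a using a.star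

/-- The strict inequality leaves room for the logarithms. Differentiation lowers the exponent to `b
- 1` and yields the log powers `n` and `n - 1`, so the induction runs over all `b`, `B`, `n`. For `n
= 0` the truncated `n - 1` carries coefficient 0. -/
lemma isSymbol_cpow_mul_log_pow (j : ℕ) {b : ℂ} {B : ℝ} (h : b.re < B) (n : ℕ) :
    IsSymbol j B (fun u : ℝ => (u : ℂ) ^ b * ((Real.log u : ℝ) : ℂ) ^ n) := by
  induction j generalizing b B n with
  | zero => exact (isLittleO_cpow_mul_log_pow_atTop h n).isBigO
  | succ j ih =>
    have hb : (b - 1).re < B - 1 := by simpa using h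
    refine ⟨(isLittleO_cpow_mul_log_pow_atTop h n).isBigO, fun u =>
      b * ((u : ℂ) ^ (b - 1) * ((Real.log u : ℝ) : ℂ) ^ n)
        + n * ((u : ℂ) ^ (b - 1) * ((Real.log u : ℝ) : ℂ) ^ (n - 1)), ?_,
      ((ih hb n).const_mul b).add ((ih hb (n - 1)).const_mul n)⟩
    filter_upwards [eventually_gt_atTop 0] with u hu
    have hu0 : (u : ℂ) ≠ 0 := Complex.ofReal_ne_zero.2 hu.ne'
    have h1 : HasDerivAt (fun u : ℝ => (u : ℂ) ^ b) (b * (u : ℂ) ^ (b - 1)) u := by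
      have := (hasDerivAt_id (u : ℂ)).cpow_const (c := b) (Or.inl (by simpa using hu))
      simpa using this.comp_ofReal
    have h2 : HasDerivAt (fun u : ℝ => ((Real.log u : ℝ) : ℂ) ^ n)
        (n * ((Real.log u : ℝ) : ℂ) ^ (n - 1) * ((u⁻¹ : ℝ) : ℂ)) u :=
      (Real.hasDerivAt_log hu.ne').ofReal_comp.fun_pow n
    refine (h1.mul h2).congr_deriv ?_
    have h3 : (u : ℂ) ^ b = (u : ℂ) ^ (b - 1) * u := by
      rw [Complex.cpow_sub _ _ hu0, Complex.cpow_one]; field_simp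
    rw [h3]
    push_cast
    field_simp

lemma rpow_le_of_mem_Icc {h u s : ℝ} (hu : 1 ≤ u) (hh : 0 ≤ h) (hs : s ∈ Set.Icc u (u + h))
    (b : ℝ) : s ^ b ≤ (1 + h) ^ |b| * u ^ b := by
  have hu0 : 0 < u := by linarith
  have hs0 : 0 < s := by linarith [hs.1]
  have h1 : 1 ≤ s / u := (one_le_div hu0).2 hs.1
  have h2 : s / u ≤ 1 + h := by rw [div_le_iff₀ hu0]; nlinarith [hs.2]
  have h3 : s ^ b = (s / u) ^ b * u ^ b := by
    rw [Real.div_rpow hs0.le hu0.le]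
    have := (Real.rpow_pos_of_pos hu0 b).ne'
    field_simp
  rw [h3]
  refine mul_le_mul_of_nonneg_right ?_ (Real.rpow_nonneg hu0.le _)
  calc (s / u) ^ b ≤ (s / u) ^ |b| := Real.rpow_le_rpow_of_exponent_le h1 (le_abs_self b)
    _ ≤ (1 + h) ^ |b| := Real.rpow_le_rpow (by positivity) h2 (abs_nonneg b)

lemma isBigO_shift {T : ℝ → ℂ} {B h : ℝ} (hh : 0 ≤ h) (hT : T =O[atTop] fun u : ℝ => u ^ B) :
    (fun u => T (u + h)) =O[atTop] fun u : ℝ => u ^ B := by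
  have h1 : (fun u => T (u + h)) =O[atTop] fun u : ℝ => (u + h) ^ B :=
    hT.comp_tendsto (tendsto_atTop_add_const_right _ _ tendsto_id)
  refine h1.trans (IsBigO.of_bound ((1 + h) ^ |B|) ?_)
  filter_upwards [eventually_ge_atTop 1] with u hu
  rw [Real.norm_of_nonneg (by positivity), Real.norm_of_nonneg (by positivity)]
  exact rpow_le_of_mem_Icc hu hh ⟨by linarith, le_rfl⟩ B

lemma isBigO_sub_shift {T T' : ℝ → ℂ} {B h : ℝ} (hh : 0 ≤ h)
    (hd : ∀ᶠ u in atTop, HasDerivAt T (T' u) u) (hT' : T' =O[atTop] fun u : ℝ => u ^ B) :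
    (fun u => T u - T (u + h)) =O[atTop] fun u : ℝ => u ^ B := by
  obtain ⟨C, hC⟩ := hT'.bound
  obtain ⟨U, hU⟩ := eventually_atTop.1 (hd.and (hC.and (eventually_ge_atTop 1)))
  refine IsBigO.of_bound (|C| * (1 + h) ^ |B| * h) ?_
  filter_upwards [eventually_ge_atTop U] with u hu
  have hu1 : 1 ≤ u := (hU u hu).2.2
  have hbound : ∀ s ∈ Set.Icc u (u + h), ‖T' s‖ ≤ |C| * (1 + h) ^ |B| * u ^ B := by
    intro s hs
    have h1 := (hU s (hu.trans hs.1)).2.1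
    have hs0 : 0 ≤ s := by linarith [hs.1]
    rw [Real.norm_of_nonneg (Real.rpow_nonneg hs0 _)] at h1
    calc ‖T' s‖ ≤ C * s ^ B := h1
      _ ≤ |C| * s ^ B := by gcongr; exact le_abs_self C
      _ ≤ |C| * ((1 + h) ^ |B| * u ^ B) := by
          gcongr; exact rpow_le_of_mem_Icc hu1 hh hs B
      _ = _ := by ring
  have := (convex_Icc u (u + h)).norm_image_sub_le_of_norm_hasDerivWithin_le
    (f := T) (f' := T') (fun s hs => (hU s (hu.trans hs.1)).1.hasDerivWithinAt) hbound
    (x := u + h) (y := u) ⟨by linarith, le_rfl⟩ ⟨le_rfl, by linarith⟩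
  refine this.trans_eq ?_
  rw [Real.norm_of_nonneg (Real.rpow_nonneg (by linarith) _), sub_add_cancel_left, norm_neg,
    Real.norm_of_nonneg hh]
  ring

/-- By the mean value inequality a difference over a fixed step is as small as the derivative, so
each difference gains one order. -/
lemma IsSymbol.sub_shift {j : ℕ} {B h : ℝ} (hh : 0 ≤ h) {T : ℝ → ℂ} (hT : IsSymbol (j + 1) B T) :
    IsSymbol j (B - 1) (fun u => T u - T (u + h)) := by
  induction j generalizing B T with
  | zero =>
    obtain ⟨-, T', hd, hT'⟩ := hT
    exact isBigO_sub_shift hh hd hT'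
  | succ j ih =>
    obtain ⟨-, T', hd, hT'⟩ := hT
    refine ⟨isBigO_sub_shift hh hd hT'.isBigO, fun u => T' u - T' (u + h), ?_, ih hT'⟩
    have hd' := (tendsto_atTop_add_const_right atTop h tendsto_id).eventually hd
    filter_upwards [hd, hd'] with u h1 h2
    exact h1.sub (h2.comp_add_const u h)

/-- Translation by `h` as a linear operator. -/
def translation (h : ℝ) : Module.End ℂ (ℝ → ℂ) := LinearMap.funLeft ℂ ℂ (fun u => u + h)

lemma translation_apply (h : ℝ) (T : ℝ → ℂ) (u : ℝ) : translation h T u = T (u + h) := rfl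

/-- Functions bounded by `u ^ D` at infinity. -/
def growthSubmodule (D : ℝ) : Submodule ℂ (ℝ → ℂ) where
  carrier := {T | T =O[atTop] fun u : ℝ => u ^ D}
  add_mem' h1 h2 := IsBigO.add h1 h2
  zero_mem' := isBigO_zero _ _
  smul_mem' c _ h := IsBigO.const_smul_left h c

lemma translation_mem {D h : ℝ} (hh : 0 ≤ h) {T : ℝ → ℂ} (hT : T ∈ growthSubmodule D) :
    translation h T ∈ growthSubmodule D := isBigO_shift hh hT

lemma IsSymbol.pow_sub_translation {j : ℕ} {B h : ℝ} (hh : 0 ≤ h) {T : ℝ → ℂ}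
    (hT : IsSymbol j B T) : ((1 - translation h) ^ j) T ∈ growthSubmodule (B - j) := by
  induction j generalizing B T with
  | zero =>
    have h := hT.isBigO
    simp only [pow_zero, Module.End.one_apply, Nat.cast_zero, sub_zero]
    exact h
  | succ j ih =>
    have := ih (hT.sub_shift hh)
    rw [pow_succ, Module.End.mul_apply]
    have e : B - 1 - (j : ℝ) = B - ((j + 1 : ℕ) : ℝ) := by push_cast; ring
    rw [e] at this
    exact this

/-- The polynomials `(1 - X)^i` and `(1 + X)^j` are coprime. The double induction unwinds this from
`2x = (1 - τ)x + (1 + τ)x`. -/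
lemma mem_of_pow_sub_of_pow_add {M : Type*} [AddCommGroup M] [Module ℂ M] (V : Submodule ℂ M)
    (τ : Module.End ℂ M) (hτ : ∀ x ∈ V, τ x ∈ V) (i j : ℕ) {x : M}
    (h1 : ((1 - τ) ^ i) x ∈ V) (h2 : ((1 + τ) ^ j) x ∈ V) : x ∈ V := by
  have hcomm : Commute (1 - τ) (1 + τ) := by
    rw [commute_iff_eq]; noncomm_ring
  induction i generalizing j x with
  | zero => simpa using h1
  | succ i ihi =>
    induction j generalizing x with
    | zero => simpa using h2
    | succ j ihj =>
      have hY : (1 - τ) x ∈ V := by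
        refine ihi (j + 1) ?_ ?_
        · rwa [pow_succ, Module.End.mul_apply] at h1
        · rw [← Module.End.mul_apply, ← (hcomm.pow_right (j + 1)).eq, Module.End.mul_apply]
          simpa using V.sub_mem h2 (hτ _ h2)
      have hZ : (1 + τ) x ∈ V := by
        refine ihj ?_ ?_
        · rw [← Module.End.mul_apply, ((hcomm.pow_left (i + 1))).eq, Module.End.mul_apply]
          simpa using V.add_mem h1 (hτ _ h1)
        · rwa [pow_succ, Module.End.mul_apply] at h2
      have : x = (2 : ℂ)⁻¹ • ((1 - τ) x + (1 + τ) x) := by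
        simp only [LinearMap.sub_apply, LinearMap.add_apply, Module.End.one_apply]
        rw [sub_add_add_cancel, ← two_smul ℂ x, smul_smul]
        norm_num
      rw [this]
      exact V.smul_mem _ (V.add_mem hY hZ)

/-- Since `e` changes sign under the shift, multiplication by it exchanges `1 - τ` and `1 + τ`. -/
lemma pow_add_translation_mul {e T : ℝ → ℂ} {h : ℝ} (he : ∀ u, e (u + h) = - e u) (j : ℕ) :
    ((1 + translation h) ^ j) (e * T) = e * ((1 - translation h) ^ j) T := by
  induction j generalizing T with
  | zero => simp
  | succ j ih =>
    rw [pow_succ, Module.End.mul_apply, pow_succ, Module.End.mul_apply, ← ih]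
    congr 1
    ext u
    simp [translation_apply, he]
    ring

/-- A symbol whose rotation by a fast phase is almost its own conjugate decays rapidly. -/
lemma isBigO_of_phase_mul_sub_conj {T e : ℝ → ℂ} {h B D : ℝ} {j : ℕ} (hh : 0 ≤ h)
    (hT : IsSymbol j B T) (hen : ∀ u, ‖e u‖ = 1) (he : ∀ u, e (u + h) = - e u)
    (hW : (fun u => e u * T u - starRingEnd ℂ (T u)) =O[atTop] fun u : ℝ => u ^ D)
    (hj : B - j ≤ D) : T =O[atTop] fun u : ℝ => u ^ D := by
  set Tc : ℝ → ℂ := fun u => starRingEnd ℂ (T u) with hTc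
  have hle : growthSubmodule (B - j) ≤ growthSubmodule D := fun S hS =>
    IsBigO.trans hS (isBigO_rpow_top_of_le hj)
  have hVτ : ∀ x ∈ growthSubmodule D, translation h x ∈ growthSubmodule D :=
    fun x hx => translation_mem hh hx
  -- Modulo functions of order `u^D`, powers of `1 - τ` kill the slowly varying conjugate of `T`,
  -- and powers of `1 + τ` kill `e · T`. By assumption the two functions agree modulo that space, so
  -- the conjugate of `T` is killed by coprime operators and hence lies in the space.
  have h1 : ((1 - translation h) ^ j) Tc ∈ growthSubmodule D := hle (hT.conj.pow_sub_translation hh)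
  have h2 : ((1 + translation h) ^ j) (e * T) ∈ growthSubmodule D := by
    rw [pow_add_translation_mul he]
    have h3 := hle (hT.pow_sub_translation hh)
    have : (fun u => e u * ((1 - translation h) ^ j) T u) =O[atTop] fun u : ℝ => u ^ D := by
      refine IsBigO.of_norm_left ?_
      simp only [norm_mul, hen, one_mul]
      exact IsBigO.norm_left h3
    exact this
  have hstab : ∀ (i : ℕ) (x : ℝ → ℂ), x ∈ growthSubmodule D →
      ((1 + translation h) ^ i) x ∈ growthSubmodule D := by
    intro i
    induction i with
    | zero => intro x hx; simpa using hx
    | succ i ih =>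
      intro x hx
      rw [pow_succ, Module.End.mul_apply]
      exact ih _ ((growthSubmodule D).add_mem hx (hVτ x hx))
  have h4 : ((1 + translation h) ^ j) Tc ∈ growthSubmodule D := by
    have h5 := hstab j (e * T - Tc) hW
    have : Tc = e * T - (e * T - Tc) := by simp
    rw [this, map_sub]
    exact (growthSubmodule D).sub_mem h2 h5
  have h6 : Tc =O[atTop] fun u : ℝ => u ^ D :=
    mem_of_pow_sub_of_pow_add _ _ hVτ j j h1 h4
  exact IsBigO.of_norm_left (by simpa [hTc] using h6.norm_left)

/-! ### Rapid decay at the origin of expansions with an exponential factor -/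

lemma tendsto_rpow_neg_zero {μ : ℝ} (hμ : 0 < μ) :
    Tendsto (fun t : ℝ => t ^ (-μ)) (𝓝[>] 0) atTop :=
  tendsto_rpow_neg_nhdsGT_zero (by linarith)

lemma isBigO_of_hasFadingExpansion_of_re_pos {f : ℝ → ℂ} {q : ℂ} (hq : 0 < q.re) {μ : ℝ}
    (hμ : 0 < μ) {N : ℕ → ℕ} {p : ℕ → ℕ → ℂ} {a : ℕ → ℂ} (ha_mono : Monotone fun m => (a m).re)
    (hexp : HasFadingExpansion f q μ N p a) (A : ℝ) :
    f =O[𝓝[>] 0] fun t : ℝ => t ^ A := by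
  set D := (a 0).re - 1 with hD
  have hDa : ∀ m, D < (a m).re := fun m => by
    have := ha_mono (Nat.zero_le m); simp only at this; linarith
  set E : ℝ → ℂ := fun t => Complex.exp (-q * ((t ^ (-μ) : ℝ) : ℂ)) with hE
  have hEo : E =O[𝓝[>] 0] fun t : ℝ => t ^ (A - D) := by
    have h1 := (isLittleO_exp_neg_mul_rpow_atTop hq (-(A - D) / μ)).comp_tendsto
      (tendsto_rpow_neg_zero hμ)
    refine IsBigO.of_norm_left (h1.isBigO.congr' ?_ ?_)
    · filter_upwards with t
      simp [hE, Complex.norm_exp]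
    · filter_upwards [self_mem_nhdsWithin] with t ht
      rw [Function.comp_apply, ← Real.rpow_mul (Set.mem_Ioi.1 ht).le]
      congr 1
      field_simp
  have h0 := hexp 0
  have h1 : (fun t : ℝ => E t * (t : ℂ) ^ a (0 + 1) * ((Real.log t : ℝ) : ℂ) ^ N (0 + 1))
      =O[𝓝[>] 0] fun t : ℝ => t ^ (A - D) * t ^ D := by
    simp_rw [mul_assoc]
    exact hEo.mul (isLittleO_cpow_mul_log_pow_zero (hDa _) _).isBigO
  have h2 : (fun t : ℝ => E t * fadingSum N p a 0 t) =O[𝓝[>] 0] fun t : ℝ => t ^ (A - D) * t ^ D :=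
    hEo.mul (isBigO_fadingSum hDa 0)
  have h3 : f =O[𝓝[>] 0] fun t : ℝ => t ^ (A - D) * t ^ D := by
    have := (h0.trans h1).add h2
    refine this.congr_left fun t => ?_
    simp [fadingSum, hE]
  refine h3.congr' EventuallyEq.rfl ?_
  filter_upwards [self_mem_nhdsWithin] with t ht
  rw [← Real.rpow_add ht]
  ring_nf

/-- Let `E` be the unimodular phase and `S` the finite sum. As `f` is real, comparing `f ≈ E S` with
its conjugate gives `E² S - S̄ = O(t^A)`. In the variable `u = t^(-μ)`, `S` is a symbol while `E²`
changes sign after `π/(2|θ|)`, which forces `S` itself to be `O(t^A)`. -/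
lemma isBigO_of_hasFadingExpansion_of_imaginary {f : ℝ → ℂ} (hf : ∀ t, starRingEnd ℂ (f t) = f t)
    {θ : ℝ} (hθ : θ ≠ 0) {μ : ℝ} (hμ : 0 < μ) {N : ℕ → ℕ} {p : ℕ → ℕ → ℂ} {a : ℕ → ℂ}
    (ha_mono : Monotone fun m => (a m).re)
    (ha_tendsto : Tendsto (fun m => (a m).re) atTop atTop)
    (hexp : HasFadingExpansion f (θ * Complex.I) μ N p a) (A : ℝ) :
    f =O[𝓝[>] 0] fun t : ℝ => t ^ A := by
  obtain ⟨k, hk⟩ := ((tendsto_add_atTop_iff_nat 1).2 ha_tendsto).eventually_gt_atTop A |>.exists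
  set E : ℝ → ℂ := fun u => Complex.exp (-(θ * Complex.I) * (u : ℂ)) with hE
  have hEn : ∀ u, ‖E u‖ = 1 := by
    intro u
    rw [hE, Complex.norm_exp]
    simp
  have hEc : ∀ u, starRingEnd ℂ (E u) * E u = 1 := by
    intro u
    rw [mul_comm, Complex.mul_conj, Complex.normSq_eq_norm_sq, hEn]; simp
  -- The finite sum in the variable `u = t^(-μ)`, where `t^a = u^(-a/μ)` and `log t = -μ⁻¹ log u`.
  set T : ℝ → ℂ := fun u => ∑ m ∈ Finset.range (k + 1), ∑ n ∈ Finset.range (N m + 1),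
    (p m n * (-(μ : ℂ)⁻¹) ^ n) * ((u : ℂ) ^ (-a m / μ) * ((Real.log u : ℝ) : ℂ) ^ n) with hT
  have hμ0 : (μ : ℂ) ≠ 0 := Complex.ofReal_ne_zero.2 hμ.ne'
  have hST : ∀ t : ℝ, 0 < t → fadingSum N p a k t = T (t ^ (-μ)) := by
    intro t ht
    simp only [fadingSum, hT]
    refine Finset.sum_congr rfl fun m _ => Finset.sum_congr rfl fun n _ => ?_
    have h1 : ((t ^ (-μ) : ℝ) : ℂ) ^ (-a m / μ) = (t : ℂ) ^ a m := by
      rw [Complex.ofReal_cpow ht.le, ← Complex.cpow_mul]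
      · congr 1
        push_cast
        field_simp
      all_goals
        rw [← Complex.ofReal_log ht.le, ← Complex.ofReal_mul, Complex.ofReal_im]
        linarith [Real.pi_pos]
    have h2 : ((Real.log (t ^ (-μ)) : ℝ) : ℂ) = -(μ : ℂ) * (Real.log t : ℝ) := by
      rw [Real.log_rpow ht]; push_cast; ring
    rw [h1, h2, mul_pow]
    have h3 : (-(μ : ℂ)⁻¹) ^ n * (-(μ : ℂ)) ^ n = 1 := by
      rw [← mul_pow]
      field_simp
      simp
    linear_combination (-(p m n * (t : ℂ) ^ a m * ((Real.log t : ℝ) : ℂ) ^ n)) * h3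
  set B := -(a 0).re / μ + 1 with hB
  have hsym : ∀ j, IsSymbol j B T := by
    intro j
    refine IsSymbol.sum fun m _ => IsSymbol.sum fun n _ => ?_
    refine (isSymbol_cpow_mul_log_pow j ?_ n).const_mul _
    have h1 : (-a m / (μ : ℂ)).re = -(a m).re / μ := by
      rw [Complex.div_ofReal_re, Complex.neg_re]
    have h2 : (a 0).re ≤ (a m).re := ha_mono (Nat.zero_le m)
    rw [h1, hB]
    have : -(a m).re / μ ≤ -(a 0).re / μ := by gcongr
    linarith
  have herr : (fun t : ℝ => f t - E (t ^ (-μ)) * fadingSum N p a k t) =O[𝓝[>] 0]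
      fun t : ℝ => t ^ A := by
    refine (hexp k).trans ?_
    refine IsBigO.of_norm_left ?_
    have := (isLittleO_cpow_mul_log_pow_zero hk (N (k + 1))).isBigO.norm_left
    refine this.congr_left fun t => ?_
    rw [mul_assoc, norm_mul (Complex.exp _)]
    have := hEn (t ^ (-μ))
    simp only [hE] at this
    rw [this, one_mul]
  have herrc : (fun t : ℝ => f t - starRingEnd ℂ (E (t ^ (-μ))) *
      starRingEnd ℂ (fadingSum N p a k t)) =O[𝓝[>] 0] fun t : ℝ => t ^ A := by
    refine IsBigO.of_norm_left (herr.norm_left.congr_left fun t => ?_)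
    rw [← RCLike.norm_conj (f t - _), map_sub, hf, map_mul]
  have hdiff : (fun t : ℝ => E (t ^ (-μ)) ^ 2 * fadingSum N p a k t
      - starRingEnd ℂ (fadingSum N p a k t)) =O[𝓝[>] 0] fun t : ℝ => t ^ A := by
    refine IsBigO.of_norm_left ((herrc.sub herr).norm_left.congr_left fun t => ?_)
    rw [← one_mul ‖_ - _‖, ← hEn (t ^ (-μ)), ← norm_mul]
    congr 1
    linear_combination (-(starRingEnd ℂ (fadingSum N p a k t))) * hEc (t ^ (-μ))
  have hinv : Tendsto (fun u : ℝ => u ^ (-(1 / μ))) atTop (𝓝[>] 0) := by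
    rw [tendsto_nhdsWithin_iff]
    refine ⟨tendsto_rpow_neg_atTop (by positivity), ?_⟩
    filter_upwards [eventually_gt_atTop 0] with u hu
    exact Real.rpow_pos_of_pos hu _
  have hW : (fun u => E u ^ 2 * T u - starRingEnd ℂ (T u)) =O[atTop]
      fun u : ℝ => u ^ (-A / μ) := by
    refine (hdiff.comp_tendsto hinv).congr' ?_ ?_
    · filter_upwards [eventually_gt_atTop 0] with u hu
      have h1 : (u ^ (-(1 / μ))) ^ (-μ) = u := by
        rw [← Real.rpow_mul hu.le]
        have : -(1 / μ) * -μ = 1 := by field_simp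
        rw [this, Real.rpow_one]
      simp only [Function.comp_apply]
      rw [hST _ (Real.rpow_pos_of_pos hu _), h1]
    · filter_upwards [eventually_gt_atTop 0] with u hu
      rw [Function.comp_apply, ← Real.rpow_mul hu.le]
      congr 1
      field_simp
  -- Enough differences to bring the order from `B` down to the target `-A/μ`.
  obtain ⟨j, hj⟩ := exists_nat_ge (B - (-A / μ))
  have hper : ∀ u, E (u + Real.pi / (2 * |θ|)) ^ 2 = - E u ^ 2 := by
    intro u
    have hθa : |θ| ≠ 0 := abs_ne_zero.2 hθ
    simp only [hE, ← Complex.exp_nat_mul]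
    rcases lt_or_gt_of_ne hθ with h | h
    · rw [abs_of_neg h]
      have : ((2 : ℕ) : ℂ) * (-(θ * Complex.I) * ((u + Real.pi / (2 * -θ) : ℝ) : ℂ))
          = ((2 : ℕ) : ℂ) * (-(θ * Complex.I) * (u : ℂ)) + Real.pi * Complex.I := by
        have hθC : (θ : ℂ) ≠ 0 := Complex.ofReal_ne_zero.2 hθ
        push_cast
        field_simp
        ring
      rw [this, Complex.exp_add, Complex.exp_pi_mul_I]; ring
    · rw [abs_of_pos h]
      have : ((2 : ℕ) : ℂ) * (-(θ * Complex.I) * (u : ℂ))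
          = ((2 : ℕ) : ℂ) * (-(θ * Complex.I) * ((u + Real.pi / (2 * θ) : ℝ) : ℂ))
            + Real.pi * Complex.I := by
        have hθC : (θ : ℂ) ≠ 0 := Complex.ofReal_ne_zero.2 hθ
        push_cast
        field_simp
        ring
      rw [this, Complex.exp_add, Complex.exp_pi_mul_I]; ring
  have hTO : T =O[atTop] fun u : ℝ => u ^ (-A / μ) :=
    isBigO_of_phase_mul_sub_conj (e := fun u => E u ^ 2) (h := Real.pi / (2 * |θ|))
      (by positivity) (hsym j) (fun u => by rw [norm_pow, hEn, one_pow]) hper hW (by linarith)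
  have hS : fadingSum N p a k =O[𝓝[>] 0] fun t : ℝ => t ^ A := by
    refine (hTO.comp_tendsto (tendsto_rpow_neg_zero hμ)).congr' ?_ ?_
    · filter_upwards [self_mem_nhdsWithin] with t ht
      exact (hST t ht).symm
    · filter_upwards [self_mem_nhdsWithin] with t ht
      rw [Function.comp_apply, ← Real.rpow_mul (Set.mem_Ioi.1 ht).le]
      congr 1
      field_simp
  have hES : (fun t : ℝ => E (t ^ (-μ)) * fadingSum N p a k t) =O[𝓝[>] 0] fun t : ℝ => t ^ A := by
    refine IsBigO.of_norm_left (hS.norm_left.congr_left fun t => ?_)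
    rw [norm_mul, hEn, one_mul]
  refine (herr.add hES).congr_left fun t => ?_
  simp

lemma isBigO_of_hasFadingExpansion {f : ℝ → ℂ} (hf : ∀ t, starRingEnd ℂ (f t) = f t)
    {q : ℂ} (hq : 0 ≤ q.re) (hq0 : q ≠ 0) {μ : ℝ} (hμ : 0 < μ) {N : ℕ → ℕ} {p : ℕ → ℕ → ℂ}
    {a : ℕ → ℂ} (ha_mono : Monotone fun m => (a m).re)
    (ha_tendsto : Tendsto (fun m => (a m).re) atTop atTop)
    (hexp : HasFadingExpansion f q μ N p a) (A : ℝ) :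
    f =O[𝓝[>] 0] fun t : ℝ => t ^ A := by
  rcases hq.lt_or_eq with h | h
  · exact isBigO_of_hasFadingExpansion_of_re_pos h hμ ha_mono hexp A
  · have hqi : q = (q.im : ℂ) * Complex.I := by
      apply Complex.ext <;> simp [← h]
    rw [hqi] at hexp
    refine isBigO_of_hasFadingExpansion_of_imaginary hf (fun h0 => hq0 ?_) hμ ha_mono ha_tendsto
      hexp A
    rw [hqi, h0]; simp

/-! ### Growth exponents -/

lemma isBigO_of_growthZero_lt {f : ℝ → ℂ} {g : ℝ} (h : growthZero f < g) :
    f =O[𝓝[>] 0] fun t : ℝ => t ^ (-g) := by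
  obtain ⟨e, ⟨g', rfl, hg'⟩, he⟩ := sInf_lt_iff.1 h
  exact hg'.trans (isBigO_rpow_zero_of_le (neg_le_neg (EReal.coe_lt_coe_iff.1 he).le))

lemma isBigO_of_lt_decayInfty {f : ℝ → ℂ} {d : ℝ} (h : (d : EReal) < decayInfty f) :
    f =O[atTop] fun t : ℝ => t ^ (-d) := by
  obtain ⟨e, ⟨d', rfl, hd'⟩, he⟩ := lt_sSup_iff.1 h
  exact hd'.trans (isBigO_rpow_top_of_le (neg_le_neg (EReal.coe_lt_coe_iff.1 he).le))

lemma growthZero_le_of_isBigO {f : ℝ → ℂ} {A : ℝ} (h : f =O[𝓝[>] 0] fun t : ℝ => t ^ A) :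
    growthZero f ≤ ((-A : ℝ) : EReal) :=
  sInf_le ⟨-A, rfl, by simpa using h⟩

/-! ### Mellin transforms of functions cut off at `1` -/

lemma MeasureTheory.LocallyIntegrableOn.indicator_Ioi {f : ℝ → ℂ}
    (hf : LocallyIntegrableOn f (Set.Ioi 0)) {s : Set ℝ} (hs : MeasurableSet s) :
    LocallyIntegrableOn (s.indicator f) (Set.Ioi 0) := by
  rw [locallyIntegrableOn_iff isOpen_Ioi.isLocallyClosed] at hf ⊢
  exact fun k hk hc => (hf k hk hc).indicator hs

/-- The cut at 1 separates the two ends. The tail is analytic on all of `Re w < δ`, so every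
singularity of the continuation comes from `(0, 1]`. -/
lemma mellinConvergent_indicator_Ioi {f : ℝ → ℂ} (hfi : LocallyIntegrableOn f (Set.Ioi 0)) {w : ℂ}
    (hw : (w.re : EReal) < decayInfty f) :
    MellinConvergent ((Set.Ioi 1).indicator f) w ∧
      DifferentiableAt ℂ (mellin ((Set.Ioi 1).indicator f)) w := by
  obtain ⟨d, h1, h2⟩ := EReal.lt_iff_exists_real_btwn.1 hw
  have htop : (Set.Ioi 1).indicator f =O[atTop] fun t : ℝ => t ^ (-d) := by
    refine (isBigO_of_lt_decayInfty h2).congr' ?_ EventuallyEq.rfl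
    filter_upwards [eventually_gt_atTop 1] with t ht
    rw [Set.indicator_of_mem (Set.mem_Ioi.2 ht)]
  have hbot : (Set.Ioi 1).indicator f =O[𝓝[>] 0] fun t : ℝ => t ^ (-(w.re - 1)) := by
    refine (isBigO_zero (E' := ℂ) _ _).congr' ?_ EventuallyEq.rfl
    filter_upwards [Ioo_mem_nhdsGT (show (0 : ℝ) < 1 by norm_num)] with t ht
    rw [Set.indicator_of_notMem (by simpa using ht.2.le)]
  have hi := hfi.indicator_Ioi (measurableSet_Ioi (a := (1 : ℝ)))
  exact ⟨mellinConvergent_of_isBigO_rpow hi htop (EReal.coe_lt_coe_iff.1 h1) hbot (by linarith),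
    mellin_differentiableAt_of_isBigO_rpow hi htop (EReal.coe_lt_coe_iff.1 h1) hbot (by linarith)⟩

lemma isBigO_indicator_Ioc_atTop (f : ℝ → ℂ) (D : ℝ) :
    (Set.Ioc 0 1).indicator f =O[atTop] fun t : ℝ => t ^ D := by
  refine (isBigO_zero (E' := ℂ) _ _).congr' ?_ EventuallyEq.rfl
  filter_upwards [eventually_gt_atTop 1] with t ht
  rw [Set.indicator_of_notMem (by simp [ht])]

lemma indicator_Ioc_eventuallyEq (f : ℝ → ℂ) : (Set.Ioc 0 1).indicator f =ᶠ[𝓝[>] 0] f := by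
  filter_upwards [Ioo_mem_nhdsGT (show (0 : ℝ) < 1 by norm_num)] with t ht
  exact Set.indicator_of_mem (show t ∈ Set.Ioc 0 1 from ⟨ht.1, ht.2.le⟩) f

lemma mellinConvergent_indicator_Ioc {f : ℝ → ℂ} (hfi : LocallyIntegrableOn f (Set.Ioi 0)) {w : ℂ}
    {D : ℝ} (hf : f =O[𝓝[>] 0] fun t : ℝ => t ^ D) (hw : -D < w.re) :
    MellinConvergent ((Set.Ioc 0 1).indicator f) w ∧
      DifferentiableAt ℂ (mellin ((Set.Ioc 0 1).indicator f)) w := by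
  have hi := hfi.indicator_Ioi (measurableSet_Ioc (a := (0 : ℝ)) (b := 1))
  have hbot : (Set.Ioc 0 1).indicator f =O[𝓝[>] 0] fun t : ℝ => t ^ (-(-D)) := by
    rw [neg_neg]
    exact hf.congr' (indicator_Ioc_eventuallyEq f).symm EventuallyEq.rfl
  have htop := isBigO_indicator_Ioc_atTop f (-(w.re + 1))
  exact ⟨mellinConvergent_of_isBigO_rpow hi htop (by linarith) hbot hw,
    mellin_differentiableAt_of_isBigO_rpow hi htop (by linarith) hbot hw⟩

lemma locallyIntegrableOn_cpow_mul_log_pow (b : ℂ) (n : ℕ) :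
    LocallyIntegrableOn (fun t : ℝ => (t : ℂ) ^ b * ((Real.log t : ℝ) : ℂ) ^ n) (Set.Ioi 0) := by
  refine ContinuousOn.locallyIntegrableOn (fun t ht => ContinuousAt.continuousWithinAt ?_)
    measurableSet_Ioi
  have h0 : t ≠ 0 := (Set.mem_Ioi.1 ht).ne'
  refine (Complex.continuousAt_ofReal_cpow_const _ _ (Or.inr h0)).mul ?_
  exact (Complex.continuous_ofReal.continuousAt.comp (Real.continuousAt_log h0)).pow n

/-- The meromorphic function `∫_0^1 t ^ (u - 1) (log t) ^ n dt = (-1) ^ n n! / u ^ (n + 1)`. -/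
def logPole (n : ℕ) (u : ℂ) : ℂ := (-1) ^ n * n.factorial / u ^ (n + 1)

lemma hasDerivAt_logPole (n : ℕ) {u : ℂ} (hu : u ≠ 0) :
    HasDerivAt (logPole n) (logPole (n + 1) u) u := by
  have h := ((hasDerivAt_id u).fun_pow (n + 1)).fun_inv (pow_ne_zero _ hu)
  have h2 := h.const_mul ((-1) ^ n * (n.factorial : ℂ))
  refine h2.congr_deriv ?_
  simp only [logPole, id, Nat.factorial_succ]
  push_cast
  field_simp
  ring

/-- Each factor `log t` is one differentiation of the Mellin transform in `w`, and `logPole` is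
closed under differentiation. -/
lemma hasMellin_cpow_mul_log_pow (a : ℂ) (n : ℕ) {w : ℂ} (hw : 0 < (w + a).re) :
    HasMellin ((Set.Ioc 0 1).indicator fun t : ℝ => (t : ℂ) ^ a * ((Real.log t : ℝ) : ℂ) ^ n) w
      (logPole n (w + a)) := by
  induction n generalizing w with
  | zero =>
    have := hasMellin_cpow_Ioc a (s := w) (by simpa using hw)
    simpa [logPole] using this
  | succ n ih =>
    set F := (Set.Ioc (0 : ℝ) 1).indicator fun t : ℝ => (t : ℂ) ^ a * ((Real.log t : ℝ) : ℂ) ^ n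
      with hF
    obtain ⟨D, hD1, hD2⟩ := exists_between (show -w.re < a.re by rw [Complex.add_re] at hw; linarith)
    have hl := locallyIntegrableOn_cpow_mul_log_pow a n
    have hO := (isLittleO_cpow_mul_log_pow_zero hD2 n).isBigO
    have hbot : F =O[𝓝[>] 0] fun t : ℝ => t ^ (-(-D)) := by
      rw [neg_neg]
      exact hO.congr' (indicator_Ioc_eventuallyEq _).symm EventuallyEq.rfl
    have hm := mellin_hasDerivAt_of_isBigO_rpow (s := w)
      (hl.indicator_Ioi (measurableSet_Ioc (a := (0 : ℝ)) (b := 1)))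
      (isBigO_indicator_Ioc_atTop _ (-(w.re + 1))) (by linarith) hbot (by linarith)
    have e : (fun t => Real.log t • F t) = (Set.Ioc (0 : ℝ) 1).indicator
        fun t : ℝ => (t : ℂ) ^ a * ((Real.log t : ℝ) : ℂ) ^ (n + 1) := by
      ext t
      simp only [hF, Set.indicator_apply]
      split_ifs
      · rw [Complex.real_smul]; ring
      · simp
    rw [e] at hm
    refine ⟨hm.1, hm.2.unique ?_⟩
    have hne : w + a ≠ 0 := fun h => by rw [h] at hw; simp at hw
    have h1 : HasDerivAt (fun z => logPole n (z + a)) (logPole (n + 1) (w + a)) w :=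
      (hasDerivAt_logPole n hne).comp_add_const w a
    refine h1.congr_of_eventuallyEq ?_
    have hopen : IsOpen {z : ℂ | 0 < (z + a).re} :=
      isOpen_lt continuous_const (by fun_prop)
    filter_upwards [hopen.mem_nhds hw] with z hz using (ih hz).2

/-! ### Uniqueness of the continuation -/

lemma isOpen_setOf_re_lt (δ : EReal) : IsOpen {w : ℂ | (w.re : EReal) < δ} :=
  isOpen_lt (continuous_coe_real_ereal.comp Complex.continuous_re) continuous_const

lemma isPreconnected_setOf_re_lt (δ : EReal) : IsPreconnected {w : ℂ | (w.re : EReal) < δ} := by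
  refine Convex.isPreconnected ?_
  have h : Convex ℝ {x : ℝ | (x : EReal) < δ} := by
    refine Set.OrdConnected.convex ⟨fun x _ y hy z hz => ?_⟩
    exact (EReal.coe_le_coe_iff.2 hz.2).trans_lt hy
  exact h.linear_preimage Complex.reLm

/-- The identity theorem on the connected half-plane, starting from the strip where both agree with
the integral. Normal form then removes the puncture. This allows any convenient continuation to
stand for the chosen `mellinCont`. -/
lemma IsMellinContinuation.eqOn {f : ℝ → ℂ} {F G : ℂ → ℂ} (hγδ : growthZero f < decayInfty f)
    (hF : IsMellinContinuation f F) (hG : IsMellinContinuation f G) {w : ℂ}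
    (hw : (w.re : EReal) < decayInfty f) : F =ᶠ[𝓝 w] G := by
  set U := {w : ℂ | (w.re : EReal) < decayInfty f} with hU
  obtain ⟨x, hx1, hx2⟩ := EReal.lt_iff_exists_real_btwn.1 hγδ
  have hmer : MeromorphicOn (F - G) U := fun z hz => ((hF.1 hz).meromorphicAt).sub (hG.1 hz).meromorphicAt
  have hxU : (x : ℂ) ∈ U := by simpa [hU] using hx2
  have hx : meromorphicOrderAt (F - G) x = ⊤ := by
    rw [meromorphicOrderAt_eq_top_iff]
    refine Eventually.filter_mono nhdsWithin_le_nhds ?_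
    have ho : IsOpen {w : ℂ | growthZero f < (w.re : EReal)} :=
      isOpen_lt continuous_const (continuous_coe_real_ereal.comp Complex.continuous_re)
    filter_upwards [(isOpen_setOf_re_lt (decayInfty f)).mem_nhds hxU,
      ho.mem_nhds (show growthZero f < (((x : ℂ).re : ℝ) : EReal) by simpa using hx1)] with z h1 h2
    rw [Pi.sub_apply, hF.2 z h2 h1, hG.2 z h2 h1, sub_self]
  have htop : meromorphicOrderAt (F - G) w = ⊤ := by
    by_contra h
    exact hmer.meromorphicOrderAt_ne_top_of_isPreconnected (isPreconnected_setOf_re_lt _)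
      (show w ∈ U from hw) hxU h hx
  rw [meromorphicOrderAt_eq_top_iff] at htop
  rw [← (hF.1 hw).eventuallyEq_nhdsNE_iff_eventuallyEq_nhds (hG.1 hw)]
  filter_upwards [htop] with z hz
  exact sub_eq_zero.1 hz

lemma IsMellinContinuation.mellinCont {f : ℝ → ℂ} {F : ℂ → ℂ} (hF : IsMellinContinuation f F) :
    IsMellinContinuation f (mellinCont f) :=
  Classical.epsilon_spec (p := IsMellinContinuation f) ⟨F, hF⟩

/-- If `f` decays rapidly at the origin, its Mellin transform is its own continuation. -/
lemma isMellinContinuation_mellin {f : ℝ → ℂ} (hfi : LocallyIntegrableOn f (Set.Ioi 0))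
    (hf : ∀ A : ℝ, f =O[𝓝[>] 0] fun t : ℝ => t ^ A) : IsMellinContinuation f (mellin f) := by
  refine ⟨AnalyticOnNhd.meromorphicNFOn ?_, fun _ _ _ => rfl⟩
  refine DifferentiableOn.analyticOnNhd (fun w hw => DifferentiableAt.differentiableWithinAt ?_)
    (isOpen_setOf_re_lt _)
  obtain ⟨d, h1, h2⟩ := EReal.lt_iff_exists_real_btwn.1 (show (w.re : EReal) < decayInfty f from hw)
  exact mellin_differentiableAt_of_isBigO_rpow hfi (isBigO_of_lt_decayInfty h2)
    (EReal.coe_lt_coe_iff.1 h1) (hf (-(w.re - 1))) (by linarith)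

lemma growthZero_eq_bot {f : ℝ → ℂ} (hf : ∀ A : ℝ, f =O[𝓝[>] 0] fun t : ℝ => t ^ A) :
    growthZero f = ⊥ := by
  refine EReal.eq_bot_iff_forall_lt _ |>.2 fun y => ?_
  refine (growthZero_le_of_isBigO (hf (-y + 1))).trans_lt ?_
  exact EReal.coe_lt_coe_iff.2 (by linarith)

/-! ### Abscissae -/

/-- Read off from `1 - δ < c < 1` and `0 < c < 1 - γ`. The first consequence places the points `w =
-m` in the half-plane of continuation. The second removes the exponents with real part at most `-1`.
-/
lemma abscissae_nonempty_iff {f : ℝ → ℂ} (hC : (abscissae f).Nonempty) :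
    0 < decayInfty f ∧ growthZero f < 1 := by
  obtain ⟨c, h0, h1, h2, h3⟩ := hC
  constructor
  · by_contra h
    push Not at h
    have h4 : (1 : EReal) ≤ 1 - decayInfty f := by
      calc (1 : EReal) = 1 - 0 := by simp
        _ ≤ _ := EReal.sub_le_sub le_rfl h
    have := (h4.trans_lt h2)
    have h5 : ((1 : ℝ) : EReal) < c := by simpa using this
    linarith [EReal.coe_lt_coe_iff.1 h5]
  · by_contra h
    push Not at h
    have h4 : (1 : EReal) - growthZero f ≤ 0 := by
      calc (1 : EReal) - growthZero f ≤ 1 - 1 := EReal.sub_le_sub le_rfl h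
        _ = 0 := by rw [← EReal.coe_one, ← EReal.coe_sub, sub_self, EReal.coe_zero]
    have h5 : (c : EReal) < ((0 : ℝ) : EReal) := by simpa using h3.trans_le h4
    linarith [EReal.coe_lt_coe_iff.1 h5]

/-! ### The Mellin transform of a function with a logarithmic expansion at the origin -/

lemma HasMellin.sum {ι : Type*} {s : Finset ι} {F : ι → ℝ → ℂ} {w : ℂ} {c : ι → ℂ}
    (h : ∀ i ∈ s, HasMellin (F i) w (c i)) :
    HasMellin (fun t => ∑ i ∈ s, F i t) w (∑ i ∈ s, c i) := by
  classical
  induction s using Finset.induction_on with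
  | empty => simp [HasMellin, MellinConvergent, mellin]
  | insert i s hi ih =>
    have h1 := h i (Finset.mem_insert_self _ _)
    have h2 := ih fun j hj => h j (Finset.mem_insert_of_mem hj)
    simp_rw [Finset.sum_insert hi]
    rw [← h1.2, ← h2.2]
    exact hasMellin_add h1.1 h2.1

/-- The alternative `c = 0` covers formal terms whose integral would diverge but whose coefficient
the growth of `f` forces to vanish. -/
lemma hasMellin_term {b c : ℂ} {n : ℕ} {w : ℂ} (h : c = 0 ∨ 0 < (w + b).re) :
    HasMellin ((Set.Ioc 0 1).indicator
      fun t : ℝ => c * (t : ℂ) ^ b * ((Real.log t : ℝ) : ℂ) ^ n) w (c * logPole n (w + b)) := by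
  rcases h with rfl | h
  · simp [HasMellin, MellinConvergent, mellin]
  · have h1 := hasMellin_cpow_mul_log_pow b n h
    have h2 := hasMellin_const_smul h1.1 c
    rw [h1.2] at h2
    rw [smul_eq_mul] at h2
    convert h2 using 1
    ext t
    simp only [Set.indicator_apply, smul_eq_mul]
    split_ifs <;> ring

/-- `f(t) ∼ ∑ p m n t^{a m} (log t)^n` as `t → 0⁺`. -/
def HasLogExpansion (f : ℝ → ℂ) (N : ℕ → ℕ) (p : ℕ → ℕ → ℂ) (a : ℕ → ℂ) : Prop :=
  ∀ k : ℕ, (fun t : ℝ => f t - fadingSum N p a k t) =O[𝓝[>] (0 : ℝ)]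
    fun t : ℝ => (t : ℂ) ^ a (k + 1) * ((Real.log t : ℝ) : ℂ) ^ N (k + 1)

lemma HasFadingExpansion.hasLogExpansion {f : ℝ → ℂ} {μ : ℝ} {N : ℕ → ℕ} {p : ℕ → ℕ → ℂ}
    {a : ℕ → ℂ} (h : HasFadingExpansion f 0 μ N p a) : HasLogExpansion f N p a := by
  intro k
  simpa [fadingSum] using h k

lemma HasLogExpansion.isBigO {f : ℝ → ℂ} {N : ℕ → ℕ} {p : ℕ → ℕ → ℂ} {a : ℕ → ℂ}
    (h : HasLogExpansion f N p a) {k : ℕ} {D : ℝ} (hD : D < (a (k + 1)).re) :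
    (fun t : ℝ => f t - fadingSum N p a k t) =O[𝓝[>] (0 : ℝ)] fun t : ℝ => t ^ D :=
  (h k).trans (isLittleO_cpow_mul_log_pow_zero hD _).isBigO

/-- One exponent of a fading expansion. -/
def fadingBlock (N : ℕ → ℕ) (p : ℕ → ℕ → ℂ) (a : ℕ → ℂ) (m : ℕ) (t : ℝ) : ℂ :=
  ∑ n ∈ Finset.range (N m + 1), p m n * (t : ℂ) ^ a m * ((Real.log t : ℝ) : ℂ) ^ n

lemma fadingSum_eq_sum (N : ℕ → ℕ) (p : ℕ → ℕ → ℂ) (a : ℕ → ℂ) (k : ℕ) (t : ℝ) :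
    fadingSum N p a k t = ∑ m ∈ Finset.range (k + 1), fadingBlock N p a m t := rfl

lemma locallyIntegrableOn_fadingSum (N : ℕ → ℕ) (p : ℕ → ℕ → ℂ) (a : ℕ → ℂ) (k : ℕ) :
    LocallyIntegrableOn (fadingSum N p a k) (Set.Ioi 0) := by
  refine ContinuousOn.locallyIntegrableOn ?_ measurableSet_Ioi
  unfold fadingSum
  refine continuousOn_finsetSum _ fun m _ => continuousOn_finsetSum _ fun n _ => ?_
  intro t ht
  have h0 : t ≠ 0 := (Set.mem_Ioi.1 ht).ne'
  refine ContinuousAt.continuousWithinAt ?_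
  refine (continuousAt_const.mul (Complex.continuousAt_ofReal_cpow_const _ _ (Or.inr h0))).mul ?_
  exact (Complex.continuous_ofReal.continuousAt.comp (Real.continuousAt_log h0)).pow n

/-- The singular part that one exponent contributes to the Mellin transform. -/
def poleBlock (N : ℕ → ℕ) (p : ℕ → ℕ → ℂ) (a : ℕ → ℂ) (m : ℕ) (w : ℂ) : ℂ :=
  ∑ n ∈ Finset.range (N m + 1), p m n * logPole n (w + a m)

lemma hasMellin_fadingBlock {N : ℕ → ℕ} {p : ℕ → ℕ → ℂ} {a : ℕ → ℂ} {m : ℕ} {w : ℂ}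
    (h : (∀ n ≤ N m, p m n = 0) ∨ 0 < (w + a m).re) :
    HasMellin ((Set.Ioc 0 1).indicator (fadingBlock N p a m)) w (poleBlock N p a m w) := by
  have : (Set.Ioc 0 1).indicator (fadingBlock N p a m) = fun t => ∑ n ∈ Finset.range (N m + 1),
      (Set.Ioc (0 : ℝ) 1).indicator
        (fun t : ℝ => p m n * (t : ℂ) ^ a m * ((Real.log t : ℝ) : ℂ) ^ n) t := by
    ext t
    simp only [fadingBlock, Set.indicator_apply]
    split_ifs <;> simp
  rw [this]
  refine HasMellin.sum fun n hn => hasMellin_term ?_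
  exact h.imp_left fun h => h n (Nat.lt_succ_iff.1 (Finset.mem_range.1 hn))

lemma hasMellin_fadingSum {N : ℕ → ℕ} {p : ℕ → ℕ → ℂ} {a : ℕ → ℂ} {k : ℕ} {w : ℂ}
    (h : ∀ m ≤ k, (∀ n ≤ N m, p m n = 0) ∨ 0 < (w + a m).re) :
    HasMellin ((Set.Ioc 0 1).indicator (fadingSum N p a k)) w
      (∑ m ∈ Finset.range (k + 1), poleBlock N p a m w) := by
  have : (Set.Ioc 0 1).indicator (fadingSum N p a k) = fun t => ∑ m ∈ Finset.range (k + 1),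
      (Set.Ioc (0 : ℝ) 1).indicator (fadingBlock N p a m) t := by
    ext t
    simp only [fadingSum_eq_sum, Set.indicator_apply]
    split_ifs <;> simp
  rw [this]
  exact HasMellin.sum fun m hm =>
    hasMellin_fadingBlock (h m (Nat.lt_succ_iff.1 (Finset.mem_range.1 hm)))

/-- The remainder of a fading expansion, cut off at `1`. -/
def cutRemainder (f : ℝ → ℂ) (N : ℕ → ℕ) (p : ℕ → ℕ → ℂ) (a : ℕ → ℂ) (k : ℕ) : ℝ → ℂ :=
  (Set.Ioc 0 1).indicator fun t => f t - fadingSum N p a k t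

/-- The continuation of the Mellin transform obtained by removing `k + 1` exponents. -/
def mellinPiece (f : ℝ → ℂ) (N : ℕ → ℕ) (p : ℕ → ℕ → ℂ) (a : ℕ → ℂ) (k : ℕ) (w : ℂ) : ℂ :=
  mellin ((Set.Ioi 1).indicator f) w + mellin (cutRemainder f N p a k) w
    + ∑ m ∈ Finset.range (k + 1), poleBlock N p a m w

section

variable {f : ℝ → ℂ} {N : ℕ → ℕ} {p : ℕ → ℕ → ℂ} {a : ℕ → ℂ}

lemma HasLogExpansion.mellin_cutRemainder (h : HasLogExpansion f N p a)
    (hfi : LocallyIntegrableOn f (Set.Ioi 0)) {k : ℕ} {w : ℂ} (hw : -(a (k + 1)).re < w.re) :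
    MellinConvergent (cutRemainder f N p a k) w ∧
      DifferentiableAt ℂ (mellin (cutRemainder f N p a k)) w := by
  obtain ⟨D, hD1, hD2⟩ := exists_between (show -w.re < (a (k + 1)).re by linarith)
  exact mellinConvergent_indicator_Ioc (hfi.sub (locallyIntegrableOn_fadingSum N p a k))
    (h.isBigO hD2) (by linarith)

/-- Where the extra term is integrable, moving it from the remainder to the explicit poles changes
nothing. Consequently the pieces glue to one function. -/
lemma HasLogExpansion.mellinPiece_succ (h : HasLogExpansion f N p a)
    (hfi : LocallyIntegrableOn f (Set.Ioi 0)) (ha_mono : Monotone fun m => (a m).re)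
    {k : ℕ} {w : ℂ} (hw : -(a (k + 1)).re < w.re) :
    mellinPiece f N p a (k + 1) w = mellinPiece f N p a k w := by
  have h1 := (h.mellin_cutRemainder hfi (k := k + 1) (w := w) (by
    have := ha_mono (Nat.le_succ (k + 1)); simp only at this; linarith)).1
  have h2 : HasMellin _ w (poleBlock N p a (k + 1) w) := hasMellin_fadingBlock (Or.inr (by
    rw [Complex.add_re]; linarith))
  have h3 : mellin (cutRemainder f N p a k) w
      = mellin (cutRemainder f N p a (k + 1)) w + poleBlock N p a (k + 1) w := by
    rw [← h2.2, ← (hasMellin_add h1 h2.1).2]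
    congr 1
    ext t
    simp only [cutRemainder, Set.indicator_apply]
    split_ifs
    · rw [fadingSum_eq_sum _ _ _ (k + 1), Finset.sum_range_succ, ← fadingSum_eq_sum]; ring
    · simp
  rw [mellinPiece, mellinPiece, h3, Finset.sum_range_succ _ (k + 1)]
  ring

lemma HasLogExpansion.mellinPiece_eq_of_le (h : HasLogExpansion f N p a)
    (hfi : LocallyIntegrableOn f (Set.Ioi 0)) (ha_mono : Monotone fun m => (a m).re)
    {j k : ℕ} (hjk : j ≤ k) {w : ℂ} (hw : -(a (j + 1)).re < w.re) :
    mellinPiece f N p a k w = mellinPiece f N p a j w := by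
  induction k, hjk using Nat.le_induction with
  | base => rfl
  | succ k hk ih =>
    rw [h.mellinPiece_succ hfi ha_mono, ih]
    have := ha_mono (Nat.succ_le_succ hk)
    simp only [Nat.succ_eq_add_one] at this
    linarith

lemma HasLogExpansion.mellinPiece_eq (h : HasLogExpansion f N p a)
    (hfi : LocallyIntegrableOn f (Set.Ioi 0)) (ha_mono : Monotone fun m => (a m).re)
    {j k : ℕ} {w : ℂ} (hj : -(a (j + 1)).re < w.re) (hk : -(a (k + 1)).re < w.re) :
    mellinPiece f N p a k w = mellinPiece f N p a j w := by
  rcases le_total j k with hjk | hjk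
  · exact h.mellinPiece_eq_of_le hfi ha_mono hjk hj
  · exact (h.mellinPiece_eq_of_le hfi ha_mono hjk hk).symm

/-- Multiplying by the highest power of `ε` and letting `ε → 0` isolates the top coefficient, which
is therefore zero. Induction removes the others. -/
lemma eq_zero_of_isBigO_sum_inv_pow {M : ℕ} {c : ℕ → ℂ}
    (h : (fun ε : ℝ => ∑ n ∈ Finset.range (M + 1), c n / (ε : ℂ) ^ (n + 1)) =O[𝓝[>] 0]
      fun _ => (1 : ℂ)) : ∀ n ≤ M, c n = 0 := by
  induction M with
  | zero =>
    intro n hn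
    obtain rfl : n = 0 := by omega
    have h1 : Tendsto (fun ε : ℝ => (ε : ℂ)) (𝓝[>] 0) (𝓝 0) :=
      (Complex.continuous_ofReal.tendsto' 0 0 (by simp)).mono_left nhdsWithin_le_nhds
    have h2 := ((isBigO_refl (fun ε : ℝ => (ε : ℂ)) (𝓝[>] 0)).mul h).trans_tendsto
      (by simpa using h1)
    refine tendsto_nhds_unique (f := fun _ : ℝ => c 0) (l := 𝓝[>] 0) tendsto_const_nhds
      (h2.congr' ?_)
    filter_upwards [self_mem_nhdsWithin] with ε hε
    have : (ε : ℂ) ≠ 0 := Complex.ofReal_ne_zero.2 (Set.mem_Ioi.1 hε).ne'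
    simp
    field_simp
  | succ M ih =>
    have hc : c (M + 1) = 0 := by
      have h1 : Tendsto (fun ε : ℝ => (ε : ℂ) ^ (M + 2)) (𝓝[>] 0) (𝓝 0) := by
        have : Continuous fun ε : ℝ => (ε : ℂ) ^ (M + 2) := by fun_prop
        exact (this.tendsto' 0 0 (by simp)).mono_left nhdsWithin_le_nhds
      have h2 := ((isBigO_refl (fun ε : ℝ => (ε : ℂ) ^ (M + 2)) (𝓝[>] 0)).mul h).trans_tendsto
        (by simpa using h1)
      have h3 : Tendsto (fun ε : ℝ => ∑ n ∈ Finset.range (M + 2), c n * (ε : ℂ) ^ (M + 1 - n))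
          (𝓝[>] 0) (𝓝 (c (M + 1))) := by
        have : Continuous fun ε : ℝ => ∑ n ∈ Finset.range (M + 2), c n * (ε : ℂ) ^ (M + 1 - n) := by
          fun_prop
        refine (this.tendsto' 0 _ ?_).mono_left nhdsWithin_le_nhds
        rw [Finset.sum_range_succ, Finset.sum_eq_zero]
        · simp
        · intro n hn
          have : M + 1 - n ≠ 0 := by have := Finset.mem_range.1 hn; omega
          simp [this]
      refine tendsto_nhds_unique h3 (h2.congr' ?_)
      filter_upwards [self_mem_nhdsWithin] with ε hε
      have h0 : (ε : ℂ) ≠ 0 := Complex.ofReal_ne_zero.2 (Set.mem_Ioi.1 hε).ne'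
      rw [Finset.mul_sum]
      refine Finset.sum_congr rfl fun n hn => ?_
      have e : M + 2 = (M + 1 - n) + (n + 1) := by have := Finset.mem_range.1 hn; omega
      rw [e, pow_add]
      field_simp
    intro n hn
    rcases hn.lt_or_eq with h1 | rfl
    · refine ih ?_ n (by omega)
      simpa [Finset.sum_range_succ _ (M + 1), hc] using h
    · exact hc

lemma exists_re_lt (ha_tendsto : Tendsto (fun m => (a m).re) atTop atTop) (x : ℝ) (k₀ : ℕ) :
    ∃ k, k₀ ≤ k ∧ x < (a (k + 1)).re := by
  obtain ⟨k, h1, h2⟩ := (((tendsto_add_atTop_iff_nat 1).2 ha_tendsto).eventually_gt_atTop x).and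
    (eventually_ge_atTop k₀) |>.exists
  exact ⟨k, h2, h1⟩

/-- Under the assumption `f` is smaller near 0 than `t^(a m)`, so the transform of `f` cut to `(0,
1]` is analytic at `-a m`. The expansion gives it the principal part with coefficients `p m n`
there, and boundedness kills them. The point is approached from the right, where all terms of real
part at least `Re (a m)` have convergent transforms. Earlier terms vanish by strong induction. -/
lemma HasLogExpansion.coeff_eq_zero (h : HasLogExpansion f N p a)
    (hfi : LocallyIntegrableOn f (Set.Ioi 0)) (ha_inj : Function.Injective a)
    (ha_mono : Monotone fun m => (a m).re)
    (ha_tendsto : Tendsto (fun m => (a m).re) atTop atTop) {m : ℕ}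
    (hm : growthZero f < ((-(a m).re : ℝ) : EReal)) : ∀ n ≤ N m, p m n = 0 := by
  induction m using Nat.strong_induction_on with
  | _ m ih =>
  obtain ⟨K, hmK, hK⟩ := exists_re_lt ha_tendsto (a m).re m
  obtain ⟨g, hg1, hg2⟩ := EReal.lt_iff_exists_real_btwn.1 hm
  have hg2' : g < -(a m).re := EReal.coe_lt_coe_iff.1 hg2
  have hf := isBigO_of_growthZero_lt hg1
  have hd1 := (mellinConvergent_indicator_Ioc hfi hf (w := -a m) (by simpa using hg2')).2
  have hd2 := (h.mellin_cutRemainder hfi (k := K) (w := -a m) (by simpa using hK)).2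
  have hcont : ContinuousAt (fun w => mellin ((Set.Ioc 0 1).indicator f) w
      - mellin (cutRemainder f N p a K) w
      - ∑ m' ∈ (Finset.range (K + 1)).erase m, poleBlock N p a m' w) (-a m) := by
    refine (hd1.continuousAt.sub hd2.continuousAt).sub ?_
    refine tendsto_finsetSum _ fun m' hm' => tendsto_finsetSum _ fun n _ => ?_
    have hne : -a m + a m' ≠ 0 := by
      intro h0
      refine (Finset.mem_erase.1 hm').1 (ha_inj ?_)
      linear_combination h0
    exact ((hasDerivAt_logPole n hne).comp_add_const _ _).continuousAt.const_mul _
  have hlim : Tendsto (fun ε : ℝ => -a m + (ε : ℂ)) (𝓝[>] 0) (𝓝 (-a m)) := by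
    have : Continuous fun ε : ℝ => -a m + (ε : ℂ) := by fun_prop
    exact (this.tendsto' 0 _ (by simp)).mono_left nhdsWithin_le_nhds
  have hO := (hcont.tendsto.comp hlim).isBigO_one ℂ
  have hO2 : (fun ε : ℝ => ∑ n ∈ Finset.range (N m + 1),
      (p m n * ((-1) ^ n * n.factorial)) / (ε : ℂ) ^ (n + 1)) =O[𝓝[>] 0] fun _ => (1 : ℂ) := by
    refine hO.congr' ?_ EventuallyEq.rfl
    filter_upwards [self_mem_nhdsWithin] with ε hε
    have hε : 0 < ε := hε
    set w : ℂ := -a m + (ε : ℂ) with hw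
    have hwre : w.re = -(a m).re + ε := by simp [hw]
    have h1 : HasMellin _ w _ := hasMellin_fadingSum (N := N) (p := p) (a := a) (k := K) (w := w)
      fun m' _ => by
        rcases lt_or_ge m' m with hlt | hge
        · left
          refine ih m' hlt (hm.trans_le (EReal.coe_le_coe_iff.2 (neg_le_neg ?_)))
          exact ha_mono hlt.le
        · right
          have := ha_mono hge
          simp only at this
          rw [Complex.add_re, hwre]
          linarith
    have h2 := (h.mellin_cutRemainder hfi (k := K) (w := w) (by rw [hwre]; linarith)).1
    have h3 : mellin ((Set.Ioc 0 1).indicator f) w = mellin (cutRemainder f N p a K) w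
        + ∑ m' ∈ Finset.range (K + 1), poleBlock N p a m' w := by
      rw [← h1.2, ← (hasMellin_add h2 h1.1).2]
      congr 1
      ext t
      simp only [cutRemainder, Set.indicator_apply]
      split_ifs <;> ring
    have h4 := Finset.add_sum_erase (Finset.range (K + 1)) (fun m' => poleBlock N p a m' w)
      (Finset.mem_range.2 (Nat.lt_succ_of_le hmK))
    simp only [Function.comp_apply]
    rw [← hw, h3, ← h4, add_sub_cancel_left, add_sub_cancel_right, poleBlock]
    refine Finset.sum_congr rfl fun n _ => ?_
    rw [logPole, hw]
    ring_nf
  intro n hn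
  have := eq_zero_of_isBigO_sum_inv_pow hO2 n hn
  have hfac : ((-1) ^ n * n.factorial : ℂ) ≠ 0 :=
    mul_ne_zero (pow_ne_zero _ (by norm_num)) (Nat.cast_ne_zero.2 n.factorial_ne_zero)
  exact (mul_eq_zero.1 this).resolve_right hfac

/-- Each exponent either has zero coefficients by `coeff_eq_zero`, or satisfies `-Re (a m) ≤ γ < Re
w`, and then its cut-off transform converges. -/
lemma HasLogExpansion.mellin_eq_mellinPiece (h : HasLogExpansion f N p a)
    (hfi : LocallyIntegrableOn f (Set.Ioi 0)) (ha_inj : Function.Injective a)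
    (ha_mono : Monotone fun m => (a m).re)
    (ha_tendsto : Tendsto (fun m => (a m).re) atTop atTop) (k : ℕ) {w : ℂ}
    (hw1 : growthZero f < (w.re : EReal)) (hw2 : (w.re : EReal) < decayInfty f) :
    mellin f w = mellinPiece f N p a k w := by
  obtain ⟨g, hg1, hg2⟩ := EReal.lt_iff_exists_real_btwn.1 hw1
  have h1 := (mellinConvergent_indicator_Ioi hfi hw2).1
  have h2 := (mellinConvergent_indicator_Ioc hfi (isBigO_of_growthZero_lt hg1) (w := w)
    (by simpa using hg2)).1
  have h3 : HasMellin _ w _ := hasMellin_fadingSum (N := N) (p := p) (a := a) (k := k) (w := w)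
    fun m' _ => by
      by_cases hm' : growthZero f < ((-(a m').re : ℝ) : EReal)
      · exact Or.inl (h.coeff_eq_zero hfi ha_inj ha_mono ha_tendsto hm')
      · right
        have := EReal.coe_lt_coe_iff.1 ((not_lt.1 hm').trans_lt hw1)
        rw [Complex.add_re]
        linarith
  have h4 : cutRemainder f N p a k = fun t => (Set.Ioc (0 : ℝ) 1).indicator f t
      - (Set.Ioc (0 : ℝ) 1).indicator (fadingSum N p a k) t := by
    ext t
    simp only [cutRemainder, Set.indicator_apply]
    split_ifs <;> ring
  rw [mellinPiece, h4, (hasMellin_sub h2 h3.1).2, h3.2, add_assoc, sub_add_cancel,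
    ← (hasMellin_add h1 h2).2]
  refine setIntegral_congr_fun measurableSet_Ioi fun t ht => ?_
  rcases le_or_gt t 1 with h5 | h5
  · simp [h5, not_lt.2 h5, Set.mem_Ioi.1 ht]
  · simp [h5, not_le.2 h5]

lemma HasLogExpansion.analyticAt_regular (h : HasLogExpansion f N p a)
    (hfi : LocallyIntegrableOn f (Set.Ioi 0)) {k : ℕ} {w : ℂ}
    (hw1 : -(a (k + 1)).re < w.re) (hw2 : (w.re : EReal) < decayInfty f) :
    AnalyticAt ℂ (fun w => mellin ((Set.Ioi 1).indicator f) w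
      + mellin (cutRemainder f N p a k) w) w := by
  have ho : IsOpen {w : ℂ | -(a (k + 1)).re < w.re} :=
    isOpen_lt continuous_const Complex.continuous_re
  refine DifferentiableOn.analyticAt (s := {w : ℂ | -(a (k + 1)).re < w.re} ∩
    {w : ℂ | (w.re : EReal) < decayInfty f}) (fun z hz => ?_)
    ((ho.inter (isOpen_setOf_re_lt _)).mem_nhds ⟨hw1, hw2⟩)
  exact ((mellinConvergent_indicator_Ioi hfi hz.2).2.add
    (h.mellin_cutRemainder hfi hz.1).2).differentiableWithinAt

lemma meromorphicAt_poleBlock (N : ℕ → ℕ) (p : ℕ → ℕ → ℂ) (a : ℕ → ℂ) (m : ℕ) (w : ℂ) :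
    MeromorphicAt (poleBlock N p a m) w := by
  unfold poleBlock logPole
  fun_prop

lemma analyticAt_poleBlock (N : ℕ → ℕ) (p : ℕ → ℕ → ℂ) {a : ℕ → ℂ} {m : ℕ} {w : ℂ}
    (hw : w + a m ≠ 0) : AnalyticAt ℂ (poleBlock N p a m) w := by
  unfold poleBlock logPole
  refine Finset.analyticAt_fun_sum _ fun n _ => ?_
  refine analyticAt_const.mul (analyticAt_const.div (by fun_prop) (pow_ne_zero _ hw))

lemma HasLogExpansion.meromorphicAt_mellinPiece (h : HasLogExpansion f N p a)
    (hfi : LocallyIntegrableOn f (Set.Ioi 0)) {k : ℕ} {w : ℂ}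
    (hw1 : -(a (k + 1)).re < w.re) (hw2 : (w.re : EReal) < decayInfty f) :
    MeromorphicAt (mellinPiece f N p a k) w :=
  (h.analyticAt_regular hfi hw1 hw2).meromorphicAt.fun_add
    (MeromorphicAt.fun_sum fun m _ => meromorphicAt_poleBlock N p a m w)

lemma HasLogExpansion.analyticAt_mellinPiece (h : HasLogExpansion f N p a)
    (hfi : LocallyIntegrableOn f (Set.Ioi 0)) {k : ℕ} {w : ℂ}
    (hw1 : -(a (k + 1)).re < w.re) (hw2 : (w.re : EReal) < decayInfty f)
    (hne : ∀ m ≤ k, w + a m ≠ 0) :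
    AnalyticAt ℂ (mellinPiece f N p a k) w :=
  (h.analyticAt_regular hfi hw1 hw2).add
    (Finset.analyticAt_fun_sum _ fun m hm => analyticAt_poleBlock N p
      (hne m (Nat.lt_succ_iff.1 (Finset.mem_range.1 hm))))

/-- A logarithmic expansion at the origin continues the Mellin transform meromorphically. -/
theorem HasLogExpansion.exists_isMellinContinuation (h : HasLogExpansion f N p a)
    (hfi : LocallyIntegrableOn f (Set.Ioi 0)) (ha_inj : Function.Injective a)
    (ha_mono : Monotone fun m => (a m).re)
    (ha_tendsto : Tendsto (fun m => (a m).re) atTop atTop) :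
    ∃ F, IsMellinContinuation f F ∧ ∀ (k : ℕ) (w : ℂ), -(a (k + 1)).re < w.re →
      (w.re : EReal) < decayInfty f → F =ᶠ[𝓝[≠] w] mellinPiece f N p a k := by
  -- `κ w` is a number of exponents sufficient at `w`. Although it jumps with `w`, the pieces agree
  -- on overlaps, so near each point `F₀` coincides with a single meromorphic piece.
  choose κ _ hκ using fun w : ℂ => exists_re_lt ha_tendsto (-w.re) 0
  set F₀ : ℂ → ℂ := fun w => mellinPiece f N p a (κ w) w with hF₀
  set U := {w : ℂ | (w.re : EReal) < decayInfty f} with hU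
  have heq : ∀ (k : ℕ) (w : ℂ), -(a (k + 1)).re < w.re → F₀ =ᶠ[𝓝 w] mellinPiece f N p a k := by
    intro k w hw
    have ho : IsOpen {w : ℂ | -(a (k + 1)).re < w.re} :=
      isOpen_lt continuous_const Complex.continuous_re
    filter_upwards [ho.mem_nhds hw] with z hz
    exact h.mellinPiece_eq hfi ha_mono hz (by linarith [hκ z])
  have hmer : MeromorphicOn F₀ U := fun w hw => by
    have h1 : -(a (κ w + 1)).re < w.re := by linarith [hκ w]
    exact (h.meromorphicAt_mellinPiece hfi h1 hw).congr
      ((heq _ w h1).symm.filter_mono nhdsWithin_le_nhds)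
  refine ⟨toMeromorphicNFOn F₀ U, ⟨meromorphicNFOn_toMeromorphicNFOn _ _, fun w hw1 hw2 => ?_⟩,
    fun k w hw1 hw2 => ?_⟩
  · have hstrip : mellin f =ᶠ[𝓝 w] F₀ := by
      have ho : IsOpen {w : ℂ | growthZero f < (w.re : EReal)} :=
        isOpen_lt continuous_const (continuous_coe_real_ereal.comp Complex.continuous_re)
      filter_upwards [ho.mem_nhds hw1, (isOpen_setOf_re_lt _).mem_nhds hw2] with z h1 h2
      exact h.mellin_eq_mellinPiece hfi ha_inj ha_mono ha_tendsto _ h1 h2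
    obtain ⟨g, hg1, hg2⟩ := EReal.lt_iff_exists_real_btwn.1 hw1
    obtain ⟨d, hd1, hd2⟩ := EReal.lt_iff_exists_real_btwn.1 hw2
    have han : AnalyticAt ℂ (mellin f) w := by
      rw [Complex.analyticAt_iff_eventually_differentiableAt]
      have ho : IsOpen {w : ℂ | g < w.re ∧ w.re < d} :=
        (isOpen_lt continuous_const Complex.continuous_re).inter
          (isOpen_lt Complex.continuous_re continuous_const)
      filter_upwards [ho.mem_nhds ⟨EReal.coe_lt_coe_iff.1 hg2, EReal.coe_lt_coe_iff.1 hd1⟩]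
        with z hz
      exact mellin_differentiableAt_of_isBigO_rpow hfi (isBigO_of_lt_decayInfty hd2) hz.2
        (isBigO_of_growthZero_lt hg1) hz.1
    rw [toMeromorphicNFOn_eq_toMeromorphicNFAt hmer hw2,
      toMeromorphicNFAt_eq_self.2 (han.congr hstrip).meromorphicNFAt]
    exact hstrip.eq_of_nhds.symm
  · exact (hmer.toMeromorphicNFOn_eq_self_on_nhdsNE hw2).trans
      ((heq k w hw1).filter_mono nhdsWithin_le_nhds)

lemma HasLogExpansion.isMellinContinuation (h : HasLogExpansion f N p a)
    (hfi : LocallyIntegrableOn f (Set.Ioi 0)) (ha_inj : Function.Injective a)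
    (ha_mono : Monotone fun m => (a m).re)
    (ha_tendsto : Tendsto (fun m => (a m).re) atTop atTop) :
    IsMellinContinuation f (mellinCont f) := by
  obtain ⟨F, hF, -⟩ := h.exists_isMellinContinuation hfi ha_inj ha_mono ha_tendsto
  exact hF.mellinCont

lemma HasLogExpansion.mellinCont_eventuallyEq (h : HasLogExpansion f N p a)
    (hfi : LocallyIntegrableOn f (Set.Ioi 0)) (ha_inj : Function.Injective a)
    (ha_mono : Monotone fun m => (a m).re)
    (ha_tendsto : Tendsto (fun m => (a m).re) atTop atTop) (hγδ : growthZero f < decayInfty f)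
    {k : ℕ} {w : ℂ} (hw1 : -(a (k + 1)).re < w.re) (hw2 : (w.re : EReal) < decayInfty f) :
    mellinCont f =ᶠ[𝓝[≠] w] mellinPiece f N p a k := by
  obtain ⟨F, hF, hF2⟩ := h.exists_isMellinContinuation hfi ha_inj ha_mono ha_tendsto
  exact ((hF.mellinCont.eqOn hγδ hF hw2).filter_mono nhdsWithin_le_nhds).trans (hF2 k w hw1 hw2)

lemma HasLogExpansion.mellinCont_eq (h : HasLogExpansion f N p a)
    (hfi : LocallyIntegrableOn f (Set.Ioi 0)) (ha_inj : Function.Injective a)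
    (ha_mono : Monotone fun m => (a m).re)
    (ha_tendsto : Tendsto (fun m => (a m).re) atTop atTop) (hγδ : growthZero f < decayInfty f)
    {k : ℕ} {w : ℂ} (hw1 : -(a (k + 1)).re < w.re) (hw2 : (w.re : EReal) < decayInfty f)
    (hne : ∀ m ≤ k, w + a m ≠ 0) :
    mellinCont f w = mellinPiece f N p a k w := by
  have h1 := h.mellinCont_eventuallyEq hfi ha_inj ha_mono ha_tendsto hγδ hw1 hw2
  rw [((h.isMellinContinuation hfi ha_inj ha_mono ha_tendsto).1
    hw2).eventuallyEq_nhdsNE_iff_eventuallyEq_nhds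
    (h.analyticAt_mellinPiece hfi hw1 hw2 hne).meromorphicNFAt] at h1
  exact h1.eq_of_nhds

end

/-! ### Moments of the fading density and the expansions they give -/

section

variable {Ph : Measure ℂ} {fh : ℝ → ℝ}

lemma locallyIntegrableOn_fadingFun (hfh : IsGainDensity Ph fh)
    (hPh : Integrable (fun z : ℂ => ‖z‖ ^ 2) Ph) :
    LocallyIntegrableOn (fadingFun fh) (Set.Ioi 0) :=
  IntegrableOn.locallyIntegrableOn (Integrable.ofReal (integrableOn_fadingReal hfh hPh))

/-- Near 0 the integrand is `O(t^(b - R))` with `b - R > -1`. Away from 0 the power is bounded, and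
`f` is integrable because its integral is the second moment of the gain. -/
lemma integrableOn_rpow_neg_mul_fadingReal (hfh : IsGainDensity Ph fh)
    (hPh : Integrable (fun z : ℂ => ‖z‖ ^ 2) Ph) {R b : ℝ} (hR : 0 ≤ R)
    (hO : fadingFun fh =O[𝓝[>] 0] fun t : ℝ => t ^ b) (hb : R - 1 < b) :
    IntegrableOn (fun t => t ^ (-R) * fadingReal fh t) (Set.Ioi 0) := by
  have hi := integrableOn_fadingReal hfh hPh
  have hO2 : fadingReal fh =O[𝓝[>] 0] fun t : ℝ => t ^ (-(-b)) := by
    rw [neg_neg]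
    refine IsBigO.of_norm_left (hO.norm_left.congr_left fun t => ?_)
    rw [fadingFun_eq, Complex.norm_real]
  obtain ⟨c, hc, h1⟩ := mellin_convergent_zero_of_isBigO hi.aestronglyMeasurable hO2
    (s := 1 - R) (by linarith)
  rw [← Set.Ioc_union_Ioi_eq_Ioi hc.le, integrableOn_union]
  refine ⟨by simpa using h1, ?_⟩
  have h2 : IntegrableOn (fadingReal fh) (Set.Ioi c) := hi.mono_set (Set.Ioi_subset_Ioi hc.le)
  refine h2.bdd_mul (c := c ^ (-R)) ?_ ?_
  · exact (measurable_id.pow_const _).aestronglyMeasurable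
  · refine (ae_restrict_iff' measurableSet_Ioi).2 (Eventually.of_forall fun t ht => ?_)
    have ht : c < t := ht
    rw [Real.norm_of_nonneg (Real.rpow_nonneg (hc.trans ht).le _)]
    exact Real.rpow_le_rpow_of_nonpos hc ht.le (by linarith)

lemma mellin_fadingFun_ofReal (x : ℝ) :
    mellin (fadingFun fh) x = ((∫ t in Set.Ioi 0, t ^ (x - 1) * fadingReal fh t : ℝ) : ℂ) := by
  rw [mellin, ← integral_complex_ofReal]
  refine setIntegral_congr_fun measurableSet_Ioi fun t ht => ?_
  simp only [fadingFun_eq, smul_eq_mul]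
  rw [Complex.ofReal_mul, Complex.ofReal_cpow (Set.mem_Ioi.1 ht).le]
  push_cast
  rfl

lemma mellin_fadingFun_zero [IsProbabilityMeasure Ph] (hfh : IsGainDensity Ph fh) : mellin (fadingFun fh) 0 = 1 := by
  have h := mellin_fadingFun_ofReal (fh := fh) 0
  rw [Complex.ofReal_zero] at h
  rw [h, ← Complex.ofReal_one, Complex.ofReal_inj]
  refine Eq.trans ?_ (integral_fadingReal_div hfh)
  refine setIntegral_congr_fun measurableSet_Ioi fun t ht => ?_
  simp only [zero_sub, Real.rpow_neg_one]
  rw [div_eq_inv_mul]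

/-- A uniform bound on the conditional MMSE gives the one-term expansion of the average MMSE. -/
lemma oneTermExpansion_of_bound [IsProbabilityMeasure Ph] {PX : Measure ℂ} [IsProbabilityMeasure PX] {ζ K R : ℝ}
    (hfh : IsGainDensity Ph fh)
    (hPh : Integrable (fun z : ℂ => ‖z‖ ^ 2) Ph) (hb : ∀ᵐ x ∂PX, ‖x‖ ≤ 2)
    (hK : ∀ h₀ snr, h₀ ≠ 0 → 0 < snr →
      |condMMSE PX h₀ snr - ζ / snr| ≤ K * (‖h₀‖ ^ 2 * (‖h₀‖ ^ 2 * snr) ^ (-R)))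
    (hint : IntegrableOn (fun t => t ^ (-R) * fadingReal fh t) (Set.Ioi 0))
    (h0 : mellinCont (fadingFun fh) 0 = 1) :
    OneTermExpansion PX Ph (fadingFun fh) ζ R := by
  refine IsBigO.of_bound (K * ∫ t in Set.Ioi 0, t ^ (-R) * fadingReal fh t) ?_
  filter_upwards [eventually_gt_atTop 0] with snr hs
  have h := abs_avgMMSE_sub_le hfh hPh hb hs (fun h₀ h => hK h₀ snr h hs) hint
  rw [h0, mul_one, ← Complex.ofReal_div, ← Complex.ofReal_sub, Complex.norm_real, Real.norm_eq_abs,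
    Real.norm_of_nonneg (Real.rpow_nonneg hs.le _)]
  exact h

lemma oneTermExpansion_of_isBigO [IsProbabilityMeasure Ph] (hfh : IsGainDensity Ph fh)
    (hPh : Integrable (fun z : ℂ => ‖z‖ ^ 2) Ph) {R b : ℝ} (hR : 1 < R) (hRb : R - 1 < b)
    (hO : fadingFun fh =O[𝓝[>] 0] fun t : ℝ => t ^ b)
    (hδ : 0 < decayInfty (fadingFun fh))
    (hcont : IsMellinContinuation (fadingFun fh) (mellinCont (fadingFun fh))) :
    (R ≤ 2 → OneTermExpansion pskLaw Ph (fadingFun fh) (1 / 2) R) ∧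
    (R ≤ 3 / 2 → OneTermExpansion pamLaw Ph (fadingFun fh) (1 / 2) R) ∧
    (R ≤ 3 / 2 → OneTermExpansion qamLaw Ph (fadingFun fh) 1 R) := by
  have hint := integrableOn_rpow_neg_mul_fadingReal hfh hPh (by linarith) hO hRb
  have hγ : growthZero (fadingFun fh) < ((0 : ℝ) : EReal) :=
    (growthZero_le_of_isBigO hO).trans_lt (EReal.coe_lt_coe_iff.2 (by linarith))
  have h0 : mellinCont (fadingFun fh) 0 = 1 := by
    rw [hcont.2 0 (by simpa using hγ) (by simpa using hδ), mellin_fadingFun_zero hfh]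
  have e : (1 / 2 : ℂ) = ((1 / 2 : ℝ) : ℂ) := by push_cast; rfl
  refine ⟨fun h => ?_, fun h => ?_, fun h => ?_⟩
  · obtain ⟨K, hK⟩ := pskLaw_error_bound
    rw [e]
    exact oneTermExpansion_of_bound hfh hPh bounded_pskLaw (hK R hR.le h) hint h0
  · obtain ⟨K, hK⟩ := pamLaw_error_bound
    rw [e]
    exact oneTermExpansion_of_bound hfh hPh bounded_pamLaw (hK R hR.le h) hint h0
  · obtain ⟨K, hK⟩ := qamLaw_error_bound
    have := oneTermExpansion_of_bound (ζ := 1) hfh hPh bounded_qamLaw (hK R hR.le h) hint h0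
    simpa using this

/-! ### Gaussian inputs and rapidly decaying densities -/

lemma one_div_one_add_eq {x : ℝ} (hx : 0 < x) (k : ℕ) :
    1 / (1 + x) = ∑ m ∈ Finset.range (k + 1), (-1) ^ m * (x ^ (m + 1))⁻¹
      + (-1) ^ (k + 1) * (x ^ (k + 1) * (1 + x))⁻¹ := by
  induction k with
  | zero => simp; field_simp; ring
  | succ k ih =>
    rw [ih, Finset.sum_range_succ _ (k + 1)]
    field_simp
    ring

/-- All negative moments of `f` exist, so the finite geometric expansion of `1/(1 + st)` can be
integrated term by term. Its remainder is at most `(st)^(-(k+2))`. -/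
lemma avgMMSE_stdComplexGaussian_sub_isBigO (hfh : IsGainDensity Ph fh)
    (hPh : Integrable (fun z : ℂ => ‖z‖ ^ 2) Ph)
    (hO : ∀ A : ℝ, fadingFun fh =O[𝓝[>] 0] fun t : ℝ => t ^ A)
    (hδ : 0 < decayInfty (fadingFun fh))
    (hcont : IsMellinContinuation (fadingFun fh) (mellinCont (fadingFun fh))) (k : ℕ) :
    (fun snr : ℝ => ((avgMMSE stdComplexGaussian Ph snr : ℝ) : ℂ) -
        ∑ m ∈ Finset.range (k + 1), regularTerm (fadingFun fh) m snr)
      =O[atTop] fun snr : ℝ => (snr ^ (k + 2))⁻¹ := by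
  have hint : ∀ m : ℕ, IntegrableOn (fun t => t ^ (-(m + 1 : ℝ)) * fadingReal fh t) (Set.Ioi 0) :=
    fun m => integrableOn_rpow_neg_mul_fadingReal hfh hPh (by positivity) (hO (m + 1)) (by linarith)
  have hM : ∀ m : ℕ, mellinCont (fadingFun fh) (-(m : ℂ))
      = ((∫ t in Set.Ioi 0, t ^ (-(m + 1 : ℝ)) * fadingReal fh t : ℝ) : ℂ) := by
    intro m
    have h1 : (-(m : ℂ)) = ((-(m : ℝ) : ℝ) : ℂ) := by push_cast; rfl
    rw [h1, hcont.2, mellin_fadingFun_ofReal]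
    · congr 2; ext t; ring_nf
    · rw [growthZero_eq_bot hO]; exact EReal.bot_lt_coe _
    · rw [Complex.ofReal_re]
      exact lt_of_le_of_lt (EReal.coe_le_coe_iff.2 (by simp : -(m : ℝ) ≤ 0)) (by simpa using hδ)
  set I := ∫ t in Set.Ioi 0, t ^ (-((k + 1 : ℕ) + 1 : ℝ)) * fadingReal fh t with hI
  refine IsBigO.of_bound I ?_
  filter_upwards [eventually_gt_atTop 0] with s hs
  have hsum : ∑ m ∈ Finset.range (k + 1), regularTerm (fadingFun fh) m s
      = ((∫ t in Set.Ioi 0, ∑ m ∈ Finset.range (k + 1),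
        ((-1) ^ m * (s ^ (m + 1))⁻¹) * (t ^ (-(m + 1 : ℝ)) * fadingReal fh t) : ℝ) : ℂ) := by
    rw [integral_finsetSum _ fun m _ => (hint m).const_mul _]
    push_cast
    refine Finset.sum_congr rfl fun m _ => ?_
    rw [integral_const_mul, regularTerm, hM]
    push_cast
    ring
  rw [hsum, avgMMSE_stdComplexGaussian hfh hs.le, ← Complex.ofReal_sub, Complex.norm_real]
  have hg : IntegrableOn (fun t => fadingReal fh t / (1 + s * t)) (Set.Ioi 0) := by
    simp_rw [div_eq_mul_inv]
    refine Integrable.mul_bdd (c := 1) (integrableOn_fadingReal hfh hPh) (by fun_prop) ?_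
    · refine (ae_restrict_iff' measurableSet_Ioi).2 (Eventually.of_forall fun t ht => ?_)
      have ht : 0 < t := ht
      rw [Real.norm_of_nonneg (by positivity)]
      exact inv_le_one_of_one_le₀ (by nlinarith [mul_pos hs ht])
  rw [← integral_sub hg (integrable_finsetSum _ fun m _ => (hint m).const_mul _)]
  rw [Real.norm_of_nonneg (show 0 ≤ (s ^ (k + 2))⁻¹ by positivity), mul_comm, hI,
    ← integral_const_mul]
  refine norm_integral_le_of_norm_le ((hint (k + 1)).const_mul _) ?_
  refine (ae_restrict_iff' measurableSet_Ioi).2 (Eventually.of_forall fun t ht => ?_)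
  have ht : 0 < t := ht
  have hpow : ∀ m : ℕ, t ^ (-(m + 1 : ℝ)) = (t ^ (m + 1))⁻¹ := fun m => by
    rw [Real.rpow_neg ht.le, ← Real.rpow_natCast]; push_cast; rfl
  have hx : 0 < s * t := mul_pos hs ht
  have h1 : fadingReal fh t / (1 + s * t) - ∑ m ∈ Finset.range (k + 1),
      ((-1) ^ m * (s ^ (m + 1))⁻¹) * (t ^ (-(m + 1 : ℝ)) * fadingReal fh t)
      = fadingReal fh t * ((-1) ^ (k + 1) * ((s * t) ^ (k + 1) * (1 + s * t))⁻¹) := by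
    have h2 : ∑ m ∈ Finset.range (k + 1),
        ((-1) ^ m * (s ^ (m + 1))⁻¹) * (t ^ (-(m + 1 : ℝ)) * fadingReal fh t)
        = fadingReal fh t * ∑ m ∈ Finset.range (k + 1), (-1) ^ m * ((s * t) ^ (m + 1))⁻¹ := by
      rw [Finset.mul_sum]
      refine Finset.sum_congr rfl fun m _ => ?_
      rw [hpow, mul_pow, mul_inv]
      ring
    rw [h2, div_eq_mul_one_div, one_div_one_add_eq hx k]
    ring
  rw [h1, norm_mul, norm_mul, norm_pow, norm_neg, norm_one, one_pow, one_mul,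
    Real.norm_of_nonneg (fadingReal_nonneg hfh t), Real.norm_of_nonneg (by positivity), hpow,
    mul_comm _ (fadingReal fh t), mul_left_comm]
  refine mul_le_mul_of_nonneg_left ?_ (fadingReal_nonneg hfh t)
  rw [← mul_inv, ← mul_pow]
  refine inv_anti₀ (by positivity) ?_
  rw [pow_succ (s * t) (k + 1)]
  gcongr
  linarith

end

/-! ### The Mellin transform of `1 / (1 + s t)` -/

lemma image_div_one_add : (fun t : ℝ => t / (1 + t)) '' Set.Ioi 0 = Set.Ioo 0 1 := by
  ext x
  constructor
  · rintro ⟨t, ht, rfl⟩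
    have ht : 0 < t := ht
    exact ⟨by positivity, by rw [div_lt_one (by positivity)]; linarith⟩
  · rintro ⟨h0, h1⟩
    have : (0 : ℝ) < 1 - x := by linarith
    exact ⟨x / (1 - x), Set.mem_Ioi.2 (by positivity), by field_simp; ring⟩

/-- The substitution `x = t/(1 + t)` turns the integral into the beta integral `B(z, 1 - z) = Γ(z)
Γ(1 - z)`, to which the reflection formula applies. -/
lemma mellin_inv_one_add {z : ℂ} (h0 : 0 < z.re) (h1 : z.re < 1) :
    mellin (fun t : ℝ => (((1 + t)⁻¹ : ℝ) : ℂ)) z = Real.pi / Complex.sin (Real.pi * z) := by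
  have hb : Complex.betaIntegral z (1 - z) = Real.pi / Complex.sin (Real.pi * z) := by
    rw [← Complex.Gamma_mul_Gamma_one_sub,
      Complex.Gamma_mul_Gamma_eq_betaIntegral h0 (by simpa using h1)]
    simp
  rw [← hb, Complex.betaIntegral, intervalIntegral.integral_of_le zero_le_one,
    integral_Ioc_eq_integral_Ioo, ← image_div_one_add,
    integral_image_eq_integral_abs_deriv_smul (f' := fun t => ((1 + t) ^ 2)⁻¹) measurableSet_Ioi]
  · refine setIntegral_congr_fun measurableSet_Ioi fun t ht => ?_
    have ht : 0 < t := ht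
    have ht1 : 0 < 1 + t := by linarith
    have e1 : (1 : ℂ) - ((t / (1 + t) : ℝ) : ℂ) = (((1 + t)⁻¹ : ℝ) : ℂ) := by
      rw [← Complex.ofReal_one, ← Complex.ofReal_sub]
      congr 1
      field_simp
      ring
    have hne : ((1 + t : ℝ) : ℂ) ≠ 0 := Complex.ofReal_ne_zero.2 ht1.ne'
    have e2 : ((t / (1 + t) : ℝ) : ℂ) ^ (z - 1) = (t : ℂ) ^ (z - 1) * ((1 + t : ℝ) : ℂ) ^ (1 - z) := by
      rw [div_eq_mul_inv, Complex.ofReal_mul, Complex.mul_cpow_ofReal_nonneg ht.le (by positivity),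
        Complex.ofReal_inv, Complex.inv_cpow, ← Complex.cpow_neg, neg_sub]
      rw [Complex.arg_ofReal_of_nonneg ht1.le]
      exact Real.pi_pos.ne
    have e3 : (((1 + t)⁻¹ : ℝ) : ℂ) ^ (1 - z - 1) = ((1 + t : ℝ) : ℂ) ^ z := by
      rw [Complex.ofReal_inv, Complex.inv_cpow, ← Complex.cpow_neg]
      · ring_nf
      · rw [Complex.arg_ofReal_of_nonneg ht1.le]
        exact Real.pi_pos.ne
    have e4 : ((1 + t : ℝ) : ℂ) ^ (1 - z) * ((1 + t : ℝ) : ℂ) ^ z = ((1 + t : ℝ) : ℂ) := by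
      rw [← Complex.cpow_add _ _ hne, sub_add_cancel, Complex.cpow_one]
    simp only [smul_eq_mul]
    rw [e1, e2, e3, abs_of_pos (by positivity), Complex.real_smul, mul_assoc ((t : ℂ) ^ _), e4]
    push_cast
    have hne' : (1 : ℂ) + t ≠ 0 := by simpa using hne
    field_simp
  · intro t ht
    have ht : 0 < t := ht
    have ht1 : 1 + t ≠ 0 := by linarith
    refine HasDerivAt.hasDerivWithinAt ?_
    have := (hasDerivAt_id t).div ((hasDerivAt_id t).const_add 1) ht1
    refine this.congr_deriv ?_
    simp
  · intro x hx y hy h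
    have hx : 0 < x := hx
    have hy : 0 < y := hy
    have h : x / (1 + x) = y / (1 + y) := h
    rw [div_eq_div_iff (by positivity) (by positivity)] at h
    linarith

/-- The kernel `1 / (1 + s t)`. -/
def stieltjesKernel (s t : ℝ) : ℂ := (((1 + s * t)⁻¹ : ℝ) : ℂ)

lemma mellin_stieltjesKernel {s : ℝ} (hs : 0 < s) {z : ℂ} (h0 : 0 < z.re) (h1 : z.re < 1) :
    mellin (stieltjesKernel s) z
      = (s : ℂ) ^ (-z) * (Real.pi / Complex.sin (Real.pi * z)) := by
  have := mellin_comp_mul_left (fun t : ℝ => (((1 + t)⁻¹ : ℝ) : ℂ)) z hs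
  rw [mellin_inv_one_add h0 h1, smul_eq_mul] at this
  exact this

lemma locallyIntegrableOn_stieltjesKernel {s : ℝ} (hs : 0 < s) :
    LocallyIntegrableOn (stieltjesKernel s) (Set.Ioi 0) := by
  refine ContinuousOn.locallyIntegrableOn ?_ measurableSet_Ioi
  refine Complex.continuous_ofReal.comp_continuousOn (ContinuousOn.inv₀ (by fun_prop) ?_)
  intro t ht
  have : 0 < s * t := mul_pos hs ht
  linarith

lemma norm_stieltjesKernel_le {s t : ℝ} (hs : 0 < s) (ht : 0 < t) :
    ‖stieltjesKernel s t‖ ≤ s⁻¹ * t⁻¹ := by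
  have : 0 < s * t := mul_pos hs ht
  rw [stieltjesKernel, Complex.norm_real, Real.norm_of_nonneg (by positivity), ← mul_inv]
  exact inv_anti₀ this (by linarith)

lemma norm_stieltjesKernel_le_one {s t : ℝ} (hs : 0 < s) (ht : 0 < t) :
    ‖stieltjesKernel s t‖ ≤ 1 := by
  have : 0 < s * t := mul_pos hs ht
  rw [stieltjesKernel, Complex.norm_real, Real.norm_of_nonneg (by positivity)]
  exact inv_le_one_of_one_le₀ (by linarith)

lemma isBigO_stieltjesKernel_zero {s : ℝ} (hs : 0 < s) :
    stieltjesKernel s =O[𝓝[>] 0] fun t : ℝ => t ^ (0 : ℝ) := by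
  refine IsBigO.of_bound 1 ?_
  filter_upwards [self_mem_nhdsWithin] with t ht
  simpa using norm_stieltjesKernel_le_one hs ht

lemma isBigO_stieltjesKernel_atTop {s : ℝ} (hs : 0 < s) :
    stieltjesKernel s =O[atTop] fun t : ℝ => t ^ (-1 : ℝ) := by
  refine IsBigO.of_bound s⁻¹ ?_
  filter_upwards [eventually_gt_atTop 0] with t ht
  rw [Real.norm_of_nonneg (Real.rpow_nonneg ht.le _), Real.rpow_neg_one]
  exact norm_stieltjesKernel_le hs ht

lemma lt_decayInfty_of_isBigO {g : ℝ → ℂ} {d x : ℝ} (h : g =O[atTop] fun t : ℝ => t ^ (-d))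
    (hx : x < d) : (x : EReal) < decayInfty g :=
  (EReal.coe_lt_coe_iff.2 hx).trans_le (le_sSup ⟨d, rfl, h⟩)

/-- All derivatives of a Mellin transform. -/
lemma iteratedDeriv_mellin {n : ℕ} {g : ℝ → ℂ} {a b : ℝ} {z : ℂ}
    (hg : LocallyIntegrableOn g (Set.Ioi 0)) (htop : g =O[atTop] fun t : ℝ => t ^ (-a))
    (hza : z.re < a) (hbot : g =O[𝓝[>] 0] fun t : ℝ => t ^ (-b)) (hzb : b < z.re) :
    iteratedDeriv n (mellin g) z
      = mellin (fun t => ((Real.log t : ℝ) : ℂ) ^ n * g t) z := by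
  induction n generalizing g a b with
  | zero => simp
  | succ n ih =>
    rw [iteratedDeriv_succ']
    obtain ⟨a', h1, h2⟩ := exists_between hza
    obtain ⟨b', h3, h4⟩ := exists_between hzb
    have hev : deriv (mellin g) =ᶠ[𝓝 z] mellin (fun t => Real.log t • g t) := by
      have ho : IsOpen {w : ℂ | b < w.re ∧ w.re < a} :=
        (isOpen_lt continuous_const Complex.continuous_re).inter
          (isOpen_lt Complex.continuous_re continuous_const)
      filter_upwards [ho.mem_nhds ⟨hzb, hza⟩] with w hw
      exact (mellin_hasDerivAt_of_isBigO_rpow hg htop hw.2 hbot hw.1).2.deriv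
    have hl : LocallyIntegrableOn (fun t => Real.log t • g t) (Set.Ioi 0) :=
      hg.continuousOn_smul isOpen_Ioi.isLocallyClosed
        (Real.continuousOn_log.mono (fun t ht => (Set.mem_Ioi.1 ht).ne'))
    rw [hev.iteratedDeriv_eq, ih hl (isBigO_rpow_top_log_smul h2 htop) h1
      (isBigO_rpow_zero_log_smul h3 hbot) h4]
    congr 1
    ext t
    rw [Complex.real_smul]
    ring

lemma mellin_indicator_stieltjesKernel_add {s : ℝ} (hs : 0 < s) {z : ℂ} (h0 : 0 < z.re)
    (h1 : z.re < 1) :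
    mellin ((Set.Ioc 0 1).indicator (stieltjesKernel s)) z
      + mellin ((Set.Ioi 1).indicator (stieltjesKernel s)) z
      = (s : ℂ) ^ (-z) * (Real.pi / Complex.sin (Real.pi * z)) := by
  have hl := locallyIntegrableOn_stieltjesKernel hs
  have hc1 := (mellinConvergent_indicator_Ioc hl (isBigO_stieltjesKernel_zero hs) (w := z)
    (by simpa using h0)).1
  have hc2 := (mellinConvergent_indicator_Ioi hl (w := z)
    (lt_decayInfty_of_isBigO (isBigO_stieltjesKernel_atTop hs) h1)).1
  rw [← (hasMellin_add hc1 hc2).2, ← mellin_stieltjesKernel hs h0 h1]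
  refine setIntegral_congr_fun measurableSet_Ioi fun t ht => ?_
  rcases le_or_gt t 1 with h5 | h5
  · simp [h5, not_lt.2 h5, Set.mem_Ioi.1 ht]
  · simp [h5, not_le.2 h5]

/-- Integrates `1/(1 + st) = 1/(st) - (1/(st)) · 1/(1 + st)` over `t > 1`. Each iteration widens the
domain of analyticity of the last term by one unit and exposes the pole at the next positive
integer. -/
lemma mellin_indicator_Ioi_stieltjesKernel_step {s : ℝ} (hs : 0 < s) {w : ℂ} (hw : w.re < 1) :
    mellin ((Set.Ioi 1).indicator (stieltjesKernel s)) w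
      = -(s : ℂ)⁻¹ * logPole 0 (w - 1)
        - (s : ℂ)⁻¹ * mellin ((Set.Ioi 1).indicator (stieltjesKernel s)) (w - 1) := by
  have hl := locallyIntegrableOn_stieltjesKernel hs
  have hc : MellinConvergent ((Set.Ioi 1).indicator (stieltjesKernel s)) (w - 1) :=
    (mellinConvergent_indicator_Ioi hl (lt_decayInfty_of_isBigO (isBigO_stieltjesKernel_atTop hs)
      (by simp; linarith))).1
  have hre : (w - 2).re < -1 := by simp; linarith
  have hI : logPole 0 (w - 1) = -∫ t : ℝ in Set.Ioi 1, (t : ℂ) ^ (w - 2) := by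
    rw [integral_Ioi_cpow_of_lt hre zero_lt_one]
    simp only [logPole, Complex.ofReal_one, Complex.one_cpow, Nat.factorial]
    rw [show w - 2 + 1 = w - 1 by ring]
    simp [neg_div]
  have hI2 : ∫ t : ℝ in Set.Ioi 1, (t : ℂ) ^ (w - 2)
      = ∫ t : ℝ in Set.Ioi 0, (Set.Ioi (1 : ℝ)).indicator (fun t : ℝ => (t : ℂ) ^ (w - 2)) t := by
    rw [setIntegral_indicator measurableSet_Ioi, Set.inter_eq_right.2
      (Set.Ioi_subset_Ioi zero_le_one)]
  have hi : IntegrableOn ((Set.Ioi (1 : ℝ)).indicator (fun t : ℝ => (t : ℂ) ^ (w - 2)))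
      (Set.Ioi 0) := by
    have h : IntegrableOn (fun t : ℝ => (t : ℂ) ^ (w - 2)) (Set.Ioi (1 : ℝ)) :=
      integrableOn_Ioi_cpow_of_lt hre zero_lt_one
    exact (h.integrable_indicator measurableSet_Ioi).integrableOn
  have hsC : (s : ℂ) ≠ 0 := Complex.ofReal_ne_zero.2 hs.ne'
  rw [hI, hI2, neg_mul_neg, mellin, mellin, ← integral_const_mul, ← integral_const_mul,
    ← integral_sub (hi.const_mul _) (Integrable.const_mul hc _)]
  refine setIntegral_congr_fun measurableSet_Ioi fun t ht => ?_
  have ht0 : (t : ℂ) ≠ 0 := Complex.ofReal_ne_zero.2 (Set.mem_Ioi.1 ht).ne'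
  by_cases h : t ∈ Set.Ioi (1 : ℝ)
  · simp only [Set.indicator_of_mem h, smul_eq_mul]
    have h1 : ((1 + s * t : ℝ) : ℂ) ≠ 0 :=
      Complex.ofReal_ne_zero.2 (by have := mul_pos hs (Set.mem_Ioi.1 ht); linarith)
    have e1 : (t : ℂ) ^ (w - 1) = (t : ℂ) ^ (w - 2) * t := by
      rw [show w - 1 = (w - 2) + 1 by ring, Complex.cpow_add _ _ ht0, Complex.cpow_one]
    rw [e1, show w - 1 - 1 = w - 2 by ring, stieltjesKernel, Complex.ofReal_inv]
    field_simp
    push_cast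
    ring
  · simp [Set.indicator_of_notMem h]

lemma mellin_indicator_Ioi_stieltjesKernel {s : ℝ} (hs : 0 < s) {z : ℂ} (hz : z.re < 1) (M : ℕ) :
    mellin ((Set.Ioi 1).indicator (stieltjesKernel s)) z
      = -∑ m ∈ Finset.range M, (-1) ^ m * ((s : ℂ) ^ (m + 1))⁻¹ * logPole 0 (z - 1 - m)
        + (-1) ^ M * ((s : ℂ) ^ M)⁻¹
          * mellin ((Set.Ioi 1).indicator (stieltjesKernel s)) (z - M) := by
  induction M with
  | zero => simp
  | succ M ih =>
    rw [ih, mellin_indicator_Ioi_stieltjesKernel_step hs (w := z - M)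
      (by simp; have : (0 : ℝ) ≤ M := M.cast_nonneg; linarith), Finset.sum_range_succ]
    rw [show z - M - 1 = z - 1 - M by ring, show z - ((M + 1 : ℕ) : ℂ) = z - 1 - M by push_cast; ring,
      pow_succ (s : ℂ) M, pow_succ (-1 : ℂ) M, mul_inv]
    ring

lemma analyticAt_mellin_Ioc_stieltjesKernel {s : ℝ} (hs : 0 < s) {z : ℂ} (hz : 0 < z.re) :
    AnalyticAt ℂ (mellin ((Set.Ioc 0 1).indicator (stieltjesKernel s))) z := by
  rw [Complex.analyticAt_iff_eventually_differentiableAt]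
  filter_upwards [(isOpen_lt continuous_const Complex.continuous_re).mem_nhds hz] with w hw
  exact (mellinConvergent_indicator_Ioc (locallyIntegrableOn_stieltjesKernel hs)
    (isBigO_stieltjesKernel_zero hs) (by simpa using hw)).2

lemma analyticAt_mellin_Ioi_stieltjesKernel {s : ℝ} (hs : 0 < s) {z : ℂ} (hz : z.re < 1) :
    AnalyticAt ℂ (mellin ((Set.Ioi 1).indicator (stieltjesKernel s))) z := by
  rw [Complex.analyticAt_iff_eventually_differentiableAt]
  filter_upwards [(isOpen_lt Complex.continuous_re continuous_const).mem_nhds hz] with w hw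
  exact (mellinConvergent_indicator_Ioi (locallyIntegrableOn_stieltjesKernel hs)
    (lt_decayInfty_of_isBigO (isBigO_stieltjesKernel_atTop hs) hw)).2

lemma differentiable_sin_pi_mul : Differentiable ℂ fun z : ℂ => Complex.sin (Real.pi * z) := by
  fun_prop

lemma differentiable_ofReal_cpow_neg {s : ℝ} (hs : 0 < s) :
    Differentiable ℂ fun z : ℂ => (s : ℂ) ^ (-z) := by
  have : (s : ℂ) ≠ 0 := Complex.ofReal_ne_zero.2 hs.ne'
  intro z
  exact DifferentiableAt.const_cpow (by fun_prop) (Or.inl this)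

/-- The truncated Mellin transform of the kernel, up to an error that is analytic in a wide strip. -/
lemma mellin_Ioc_stieltjesKernel_eventuallyEq {s : ℝ} (hs : 0 < s) (M : ℕ) {z₀ : ℂ}
    (h0 : 0 < z₀.re) (h1 : z₀.re < M + 1) :
    (fun z => mellin ((Set.Ioc 0 1).indicator (stieltjesKernel s)) z
      + (-1) ^ M * ((s : ℂ) ^ M)⁻¹
          * mellin ((Set.Ioi 1).indicator (stieltjesKernel s)) (z - M)) =ᶠ[𝓝[≠] z₀]
    fun z => (s : ℂ) ^ (-z) * (Real.pi / Complex.sin (Real.pi * z))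
      + ∑ m ∈ Finset.range M, (-1) ^ m * ((s : ℂ) ^ (m + 1))⁻¹ * logPole 0 (z - 1 - m) := by
  set A : ℂ → ℂ := fun z => mellin ((Set.Ioc 0 1).indicator (stieltjesKernel s)) z
      + (-1) ^ M * ((s : ℂ) ^ M)⁻¹
          * mellin ((Set.Ioi 1).indicator (stieltjesKernel s)) (z - M) with hA
  set B : ℂ → ℂ := fun z => (s : ℂ) ^ (-z) * (Real.pi / Complex.sin (Real.pi * z))
      + ∑ m ∈ Finset.range M, (-1) ^ m * ((s : ℂ) ^ (m + 1))⁻¹ * logPole 0 (z - 1 - m) with hB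
  set U : Set ℂ := {z | 0 < z.re} ∩ {z | z.re < M + 1} with hU
  have hUpre : IsPreconnected U :=
    ((convex_halfSpace_re_gt 0).inter (convex_halfSpace_re_lt _)).isPreconnected
  have hAmer : MeromorphicOn A U := fun z hz => by
    have h2 : AnalyticAt ℂ (fun z : ℂ => mellin ((Set.Ioi 1).indicator (stieltjesKernel s)) (z - M))
        z := AnalyticAt.comp (g := mellin ((Set.Ioi 1).indicator (stieltjesKernel s)))
          (analyticAt_mellin_Ioi_stieltjesKernel hs (by
            have : z.re < M + 1 := hz.2
            simp; linarith)) (by fun_prop)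
    exact ((analyticAt_mellin_Ioc_stieltjesKernel hs hz.1).add
      (analyticAt_const.mul h2)).meromorphicAt
  have hBmer : MeromorphicOn B U := fun z _ => by
    have h1 : MeromorphicAt (fun z : ℂ => (s : ℂ) ^ (-z)) z :=
      ((differentiable_ofReal_cpow_neg hs).analyticAt z).meromorphicAt
    have h2 : MeromorphicAt (fun z : ℂ => Complex.sin (Real.pi * z)) z :=
      (differentiable_sin_pi_mul.analyticAt z).meromorphicAt
    refine (h1.fun_mul ((MeromorphicAt.const _ _).fun_div h2)).fun_add
      (MeromorphicAt.fun_sum fun m _ => ?_)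
    unfold logPole
    fun_prop
  have hxU : ((1 / 2 : ℝ) : ℂ) ∈ U :=
    ⟨by simp, by
      have : (0 : ℝ) ≤ M := M.cast_nonneg
      rw [Set.mem_ofPred_eq, Complex.ofReal_re]; linarith⟩
  -- On `0 < Re z < 1` all integrals converge and the identity is an explicit computation. From
  -- `1/2` it spreads over the connected strip `0 < Re z < M + 1`.
  have hx : meromorphicOrderAt (A - B) ((1 / 2 : ℝ) : ℂ) = ⊤ := by
    rw [meromorphicOrderAt_eq_top_iff]
    refine Eventually.filter_mono nhdsWithin_le_nhds ?_
    have ho : IsOpen {w : ℂ | 0 < w.re ∧ w.re < 1} :=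
      (isOpen_lt continuous_const Complex.continuous_re).inter
        (isOpen_lt Complex.continuous_re continuous_const)
    filter_upwards [ho.mem_nhds (show 0 < (((1 / 2 : ℝ) : ℂ)).re ∧ (((1 / 2 : ℝ) : ℂ)).re < 1 by
      rw [Complex.ofReal_re]; norm_num)] with z hz
    have e1 := mellin_indicator_stieltjesKernel_add hs hz.1 hz.2
    have e2 := mellin_indicator_Ioi_stieltjesKernel hs hz.2 M
    simp only [Pi.sub_apply, hA, hB]
    linear_combination e1 - e2
  have htop : meromorphicOrderAt (A - B) z₀ = ⊤ := by
    by_contra h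
    exact (hAmer.sub hBmer).meromorphicOrderAt_ne_top_of_isPreconnected hUpre
      (show z₀ ∈ U from ⟨h0, h1⟩) hxU h hx
  rw [meromorphicOrderAt_eq_top_iff] at htop
  filter_upwards [htop] with z hz
  exact sub_eq_zero.1 hz

/-! ### Bounds for the error -/

lemma exists_norm_mellin_Ioi_log_stieltjesKernel_le (n : ℕ) {w : ℂ} (hw : w.re < 1) :
    ∃ C : ℝ, ∀ s : ℝ, 0 < s →
      ‖mellin ((Set.Ioi 1).indicator fun t => ((Real.log t : ℝ) : ℂ) ^ n * stieltjesKernel s t) w‖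
        ≤ C * s⁻¹ := by
  set g : ℝ → ℂ := fun t => (t : ℂ) ^ (-1 : ℂ) * ((Real.log t : ℝ) : ℂ) ^ n with hg
  obtain ⟨d, h1, h2⟩ := exists_between hw
  have hO : g =O[atTop] fun t : ℝ => t ^ (-d) :=
    (isLittleO_cpow_mul_log_pow_atTop (by simpa using h2) n).isBigO
  have hc := (mellinConvergent_indicator_Ioi (locallyIntegrableOn_cpow_mul_log_pow (-1) n)
    (lt_decayInfty_of_isBigO hO h1)).1
  refine ⟨∫ t : ℝ in Set.Ioi 0, ‖(t : ℂ) ^ (w - 1) • (Set.Ioi 1).indicator g t‖, fun s hs => ?_⟩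
  rw [← integral_mul_const]
  refine norm_integral_le_of_norm_le (hc.norm.mul_const _) ?_
  refine (ae_restrict_iff' measurableSet_Ioi).2 (Eventually.of_forall fun t ht => ?_)
  have ht : 0 < t := ht
  rw [norm_smul, norm_smul, mul_assoc]
  gcongr
  by_cases h : t ∈ Set.Ioi (1 : ℝ)
  · rw [Set.indicator_of_mem h, Set.indicator_of_mem h, hg, norm_mul, norm_mul,
      Complex.cpow_neg_one, norm_inv, Complex.norm_real, Real.norm_of_nonneg ht.le]
    calc _ ≤ ‖((Real.log t : ℝ) : ℂ) ^ n‖ * (s⁻¹ * t⁻¹) := by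
          gcongr
          exact norm_stieltjesKernel_le hs ht
      _ = _ := by ring
  · simp [Set.indicator_of_notMem h]

/-! ### Higher derivatives of products -/

lemma iteratedDeriv_sub_mul {F : ℂ → ℂ} {z₀ : ℂ} (hF : AnalyticAt ℂ F z₀) (n : ℕ) :
    iteratedDeriv (n + 1) (fun z => (z - z₀) * F z) z₀ = (n + 1) * iteratedDeriv n F z₀ := by
  rw [iteratedDeriv_fun_mul (AnalyticAt.contDiffAt (by fun_prop)) hF.contDiffAt,
    Finset.sum_eq_single 1]
  · simp [iteratedDeriv_one]
  · intro i _ hi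
    rcases i with _ | _ | i
    · simp
    · exact absurd rfl hi
    · have : iteratedDeriv (i + 1 + 1) (fun z => z - z₀) z₀ = 0 := by
        rw [iteratedDeriv_succ', iteratedDeriv_succ']
        simp
      rw [this]; simp
  · intro h; simp at h

lemma iteratedDeriv_sub_pow_mul {F : ℂ → ℂ} {z₀ : ℂ} (hF : AnalyticAt ℂ F z₀) (n j : ℕ) :
    iteratedDeriv (n + j) (fun z => (z - z₀) ^ j * F z) z₀
      = ((n + j).factorial / n.factorial : ℂ) * iteratedDeriv n F z₀ := by
  have hn : (n.factorial : ℂ) ≠ 0 := Nat.cast_ne_zero.2 n.factorial_ne_zero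
  induction j with
  | zero => simp [div_self hn]
  | succ j ih =>
    have e : (fun z => (z - z₀) ^ (j + 1) * F z) = fun z => (z - z₀) * ((z - z₀) ^ j * F z) := by
      ext z; ring
    rw [e, ← add_assoc, iteratedDeriv_sub_mul (by fun_prop), ih, Nat.factorial_succ]
    push_cast
    ring

lemma AnalyticAt.dslope_same {K : ℂ → ℂ} {z₀ : ℂ} (hK : AnalyticAt ℂ K z₀) :
    AnalyticAt ℂ (dslope K z₀) z₀ := by
  obtain ⟨p, hp⟩ := hK
  exact hp.has_fpower_series_dslope_fslope.analyticAt

/-- Taking the difference quotient shifts Taylor coefficients by one place. This evaluates what is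
left of `s^(-z) π / sin(πz)` at an integer once its polar part is subtracted. -/
lemma iteratedDeriv_dslope {K : ℂ → ℂ} {z₀ : ℂ} (hK : AnalyticAt ℂ K z₀) (n : ℕ) :
    iteratedDeriv n (dslope K z₀) z₀ = iteratedDeriv (n + 1) K z₀ / (n + 1) := by
  have h1 := iteratedDeriv_sub_mul hK.dslope_same n
  have h2 : (fun z => (z - z₀) * dslope K z₀ z) = fun z => K z - K z₀ := by
    ext z
    simpa using sub_smul_dslope K z₀ z
  have h3 : iteratedDeriv (n + 1) (fun z => K z - K z₀) z₀ = iteratedDeriv (n + 1) K z₀ := by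
    rw [iteratedDeriv_succ', iteratedDeriv_succ']
    congr 1
    ext z
    simp
  have hn : (n + 1 : ℂ) ≠ 0 := Nat.cast_add_one_ne_zero n
  rw [eq_div_iff hn, mul_comm, ← h1, h2, h3]

lemma iteratedDeriv_ofReal_cpow_neg {s : ℝ} (hs : 0 < s) (j : ℕ) (z : ℂ) :
    iteratedDeriv j (fun z : ℂ => (s : ℂ) ^ (-z)) z
      = (-((Real.log s : ℝ) : ℂ)) ^ j * (s : ℂ) ^ (-z) := by
  have hsC : (s : ℂ) ≠ 0 := Complex.ofReal_ne_zero.2 hs.ne'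
  have e : (fun z : ℂ => (s : ℂ) ^ (-z)) = fun z => Complex.exp (-((Real.log s : ℝ) : ℂ) * z) := by
    ext z
    rw [Complex.cpow_def_of_ne_zero hsC, Complex.ofReal_log hs.le]
    ring_nf
  have e' := congrFun e z
  rw [e, iteratedDeriv_cexp_const_mul, e']

lemma iteratedDeriv_cpow_neg_mul {s : ℝ} (hs : 0 < s) {F : ℂ → ℂ} {z₀ : ℂ}
    (hF : AnalyticAt ℂ F z₀) (n : ℕ) :
    iteratedDeriv n (fun z => (s : ℂ) ^ (-z) * F z) z₀ = (s : ℂ) ^ (-z₀) *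
      ∑ j ∈ Finset.range (n + 1), (n.choose j : ℂ) * (-((Real.log s : ℝ) : ℂ)) ^ j *
        iteratedDeriv (n - j) F z₀ := by
  rw [iteratedDeriv_fun_mul ((differentiable_ofReal_cpow_neg hs).analyticAt z₀).contDiffAt
    hF.contDiffAt, Finset.mul_sum]
  refine Finset.sum_congr rfl fun j _ => ?_
  rw [iteratedDeriv_ofReal_cpow_neg hs]
  ring

lemma isLittleO_iteratedDeriv_cpow_neg_mul {F : ℂ → ℂ} {z₀ : ℂ} (hF : AnalyticAt ℂ F z₀) (n : ℕ)
    {X : ℝ} (hX : X < z₀.re) :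
    (fun s : ℝ => iteratedDeriv n (fun z => (s : ℂ) ^ (-z) * F z) z₀) =o[atTop]
      fun s : ℝ => s ^ (-X) := by
  have h : (fun s : ℝ => ∑ j ∈ Finset.range (n + 1),
      ((n.choose j : ℂ) * (-1) ^ j * iteratedDeriv (n - j) F z₀) *
        ((s : ℂ) ^ (-z₀) * ((Real.log s : ℝ) : ℂ) ^ j)) =o[atTop] fun s : ℝ => s ^ (-X) :=
    IsLittleO.fun_sum fun j _ =>
      (isLittleO_cpow_mul_log_pow_atTop (by simpa using hX) j).const_mul_left _
  refine h.congr' ?_ EventuallyEq.rfl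
  filter_upwards [eventually_gt_atTop 0] with s hs
  rw [iteratedDeriv_cpow_neg_mul hs hF, Finset.mul_sum]
  refine Finset.sum_congr rfl fun j _ => ?_
  rw [neg_pow ((Real.log s : ℝ) : ℂ)]
  ring

lemma iteratedDeriv_logPole_comp_sub (n : ℕ) {c z : ℂ} (h : z - c ≠ 0) :
    iteratedDeriv n (fun z => logPole 0 (z - c)) z = logPole n (z - c) := by
  have key : ∀ j : ℕ, iteratedDeriv n (fun z => logPole j (z - c)) z = logPole (n + j) (z - c) := by
    induction n with
    | zero => intro j; simp
    | succ n ih =>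
      intro j
      rw [iteratedDeriv_succ']
      have : deriv (fun z => logPole j (z - c)) =ᶠ[𝓝 z] fun z => logPole (j + 1) (z - c) := by
        have ho : IsOpen {z : ℂ | z - c ≠ 0} := isOpen_ne_fun (by fun_prop) (by fun_prop)
        filter_upwards [ho.mem_nhds h] with w hw
        exact ((hasDerivAt_logPole j hw).comp_sub_const w c).deriv
      rw [this.iteratedDeriv_eq, ih]
      congr 1
      omega
  simpa using key 0

lemma analyticAt_logPole_comp_sub (n : ℕ) {c z : ℂ} (h : z - c ≠ 0) :
    AnalyticAt ℂ (fun z => logPole n (z - c)) z := by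
  unfold logPole
  exact analyticAt_const.div (by fun_prop) (pow_ne_zero _ h)

/-! ### The residues of `π / sin (π z)` -/

/-- `(z - z₀) π / sin (π z)` with the singularity at the integer `z₀` removed. -/
def residueKernel (z₀ z : ℂ) : ℂ := Real.pi / dslope (fun z : ℂ => Complex.sin (Real.pi * z)) z₀ z

lemma sin_pi_mul_natCast_add_one (l : ℕ) : Complex.sin (Real.pi * (1 + (l : ℂ))) = 0 := by
  rw [Complex.sin_eq_zero_iff]
  exact ⟨1 + l, by push_cast; ring⟩

lemma deriv_sin_pi_mul (z : ℂ) :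
    deriv (fun z : ℂ => Complex.sin (Real.pi * z)) z = Real.pi * Complex.cos (Real.pi * z) := by
  have := (Complex.hasDerivAt_sin (Real.pi * z)).comp z ((hasDerivAt_id z).const_mul (Real.pi : ℂ))
  rw [mul_one, mul_comm] at this
  exact this.deriv

lemma cos_pi_mul_natCast_add_one (l : ℕ) :
    Complex.cos (Real.pi * (1 + (l : ℂ))) = (-1) ^ (l + 1) := by
  have h := congrArg (fun x : ℝ => (x : ℂ)) (Real.cos_nat_mul_pi (l + 1))
  push_cast at h
  rw [← h]
  ring_nf

lemma residueKernel_self (l : ℕ) : residueKernel (1 + l) (1 + l) = (-1) ^ (l + 1) := by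
  have hπ : (Real.pi : ℂ) ≠ 0 := Complex.ofReal_ne_zero.2 Real.pi_ne_zero
  rw [residueKernel, _root_.dslope_same, deriv_sin_pi_mul, cos_pi_mul_natCast_add_one]
  have h : ((-1 : ℂ) ^ (l + 1)) * (-1) ^ (l + 1) = 1 := by rw [← mul_pow]; simp
  have h0 : ((-1 : ℂ) ^ (l + 1)) ≠ 0 := pow_ne_zero _ (by norm_num)
  field_simp
  rw [pow_two, h]

lemma analyticAt_residueKernel (l : ℕ) : AnalyticAt ℂ (residueKernel (1 + l)) (1 + l) := by
  refine analyticAt_const.div (differentiable_sin_pi_mul.analyticAt _).dslope_same ?_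
  rw [_root_.dslope_same, deriv_sin_pi_mul, cos_pi_mul_natCast_add_one]
  exact mul_ne_zero (Complex.ofReal_ne_zero.2 Real.pi_ne_zero) (pow_ne_zero _ (by norm_num))

lemma residueKernel_of_ne (l : ℕ) {z : ℂ} (hz : z ≠ 1 + l) :
    residueKernel (1 + l) z = (z - (1 + l)) * (Real.pi / Complex.sin (Real.pi * z)) := by
  rw [residueKernel, dslope_of_ne _ hz, slope_def_field, sin_pi_mul_natCast_add_one, sub_zero]
  have : z - (1 + l) ≠ 0 := sub_ne_zero.2 hz
  rw [div_div_eq_mul_div]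
  ring

lemma sin_pi_mul_one_add_ne_zero {a : ℂ} (ha : -1 < a.re) (hn : ¬ ∃ l : ℕ, (l : ℂ) = a) :
    Complex.sin (Real.pi * (1 + a)) ≠ 0 := by
  intro h
  obtain ⟨k, hk⟩ := Complex.sin_eq_zero_iff.1 h
  have hπ : (Real.pi : ℂ) ≠ 0 := Complex.ofReal_ne_zero.2 Real.pi_ne_zero
  have h1 : 1 + a = k := mul_left_cancel₀ hπ (by rw [hk]; ring)
  have h2 : a = ((k - 1 : ℤ) : ℂ) := by push_cast; linear_combination h1
  have h3 : (0 : ℝ) < k := by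
    have := congrArg Complex.re h1
    simp at this
    linarith
  have h4 : 0 ≤ k - 1 := by have : (0 : ℤ) < k := by exact_mod_cast h3
                            omega
  obtain ⟨l, hl⟩ := Int.eq_ofNat_of_zero_le h4
  exact hn ⟨l, by rw [h2, hl]; simp⟩

lemma analyticAt_pi_div_sin {z : ℂ} (h : Complex.sin (Real.pi * z) ≠ 0) :
    AnalyticAt ℂ (fun z : ℂ => (Real.pi : ℂ) / Complex.sin (Real.pi * z)) z :=
  analyticAt_const.div (differentiable_sin_pi_mul.analyticAt z) h

/-! ### Truncated moments of the kernel -/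

/-- `∫_0^1 t ^ a (log t) ^ n / (1 + s t) dt`. -/
def truncatedMoment (a : ℂ) (n : ℕ) (s : ℝ) : ℂ :=
  mellin ((Set.Ioc 0 1).indicator fun t => ((Real.log t : ℝ) : ℂ) ^ n * stieltjesKernel s t) (1 + a)

open Classical in
/-- The contribution of `t ^ a (log t) ^ n` to the expansion at infinity. -/
def momentKernel (a : ℂ) (n : ℕ) (s : ℝ) : ℂ :=
  -- When `1 + a` is a pole of `π / sin(πz)`, the polar part is subtracted. What remains is the
  -- difference quotient of `s^(-z)` times `residueKernel`, and its `n`-th derivative is the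
  -- `(n+1)`-st derivative of that product divided by `n + 1`.
  if ∃ l : ℕ, (l : ℂ) = a then
    iteratedDeriv (n + 1) (fun z => (s : ℂ) ^ (-z) * residueKernel (1 + a) z) (1 + a) / (n + 1)
  else
    iteratedDeriv n (fun z => (s : ℂ) ^ (-z) * (Real.pi / Complex.sin (Real.pi * z))) (1 + a)

lemma isLittleO_momentKernel {a : ℂ} (ha : -1 < a.re) (n : ℕ) {X : ℝ} (hX : X < 1 + a.re) :
    momentKernel a n =o[atTop] fun s : ℝ => s ^ (-X) := by
  have hX' : X < (1 + a).re := by simpa using hX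
  by_cases h : ∃ l : ℕ, (l : ℂ) = a
  · have e : momentKernel a n = fun s : ℝ => ((n : ℂ) + 1)⁻¹ * iteratedDeriv (n + 1)
        (fun z => (s : ℂ) ^ (-z) * residueKernel (1 + a) z) (1 + a) := by
      ext s
      rw [momentKernel, if_pos h, div_eq_inv_mul]
    rw [e]
    obtain ⟨l, rfl⟩ := h
    exact (isLittleO_iteratedDeriv_cpow_neg_mul (analyticAt_residueKernel l) _ hX').const_mul_left _
  · have e : momentKernel a n = fun s : ℝ => iteratedDeriv n
        (fun z => (s : ℂ) ^ (-z) * (Real.pi / Complex.sin (Real.pi * z))) (1 + a) := by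
      ext s
      rw [momentKernel, if_neg h]
    rw [e]
    exact isLittleO_iteratedDeriv_cpow_neg_mul
      (analyticAt_pi_div_sin (sin_pi_mul_one_add_ne_zero ha h)) _ hX'

lemma iteratedDeriv_mellin_Ioc_stieltjesKernel {s : ℝ} (hs : 0 < s) {a : ℂ} (ha : -1 < a.re)
    (n : ℕ) : iteratedDeriv n (mellin ((Set.Ioc 0 1).indicator (stieltjesKernel s))) (1 + a)
      = truncatedMoment a n s := by
  have hl := (locallyIntegrableOn_stieltjesKernel hs).indicator_Ioi
    (measurableSet_Ioc (a := (0 : ℝ)) (b := 1))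
  have hbot : (Set.Ioc 0 1).indicator (stieltjesKernel s) =O[𝓝[>] 0] fun t : ℝ => t ^ (-(0 : ℝ)) := by
    rw [neg_zero]
    exact (isBigO_stieltjesKernel_zero hs).congr' (indicator_Ioc_eventuallyEq _).symm
      EventuallyEq.rfl
  rw [iteratedDeriv_mellin hl (isBigO_indicator_Ioc_atTop _ (-((1 + a).re + 1))) (by linarith) hbot
    (by simp; linarith), truncatedMoment]
  congr 1
  ext t
  simp only [Set.indicator_apply]
  split_ifs <;> simp

lemma iteratedDeriv_mellin_Ioi_stieltjesKernel {s : ℝ} (hs : 0 < s) {w : ℂ} (hw : w.re < 1)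
    (n : ℕ) : iteratedDeriv n (mellin ((Set.Ioi 1).indicator (stieltjesKernel s))) w
      = mellin ((Set.Ioi 1).indicator
          fun t => ((Real.log t : ℝ) : ℂ) ^ n * stieltjesKernel s t) w := by
  have hl := (locallyIntegrableOn_stieltjesKernel hs).indicator_Ioi
    (measurableSet_Ioi (a := (1 : ℝ)))
  have htop : (Set.Ioi 1).indicator (stieltjesKernel s) =O[atTop] fun t : ℝ => t ^ (-(1 : ℝ)) := by
    refine (isBigO_stieltjesKernel_atTop hs).congr' ?_ EventuallyEq.rfl
    filter_upwards [eventually_gt_atTop 1] with t ht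
    rw [Set.indicator_of_mem (Set.mem_Ioi.2 ht)]
  have hbot : (Set.Ioi 1).indicator (stieltjesKernel s) =O[𝓝[>] 0]
      fun t : ℝ => t ^ (-(w.re - 1)) := by
    refine (isBigO_zero (E' := ℂ) _ _).congr' ?_ EventuallyEq.rfl
    filter_upwards [Ioo_mem_nhdsGT (show (0 : ℝ) < 1 by norm_num)] with t ht
    rw [Set.indicator_of_notMem (by simpa using ht.2.le)]
  rw [iteratedDeriv_mellin hl htop hw hbot (by linarith)]
  congr 1
  ext t
  simp only [Set.indicator_apply]
  split_ifs <;> simp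

/-- The `n`-th derivative at `1 + a` of the continued identity for the truncated kernel. If `a` is
an integer `l`, then `l < M`, and the pole of `s^(-z) π / sin(πz)` cancels against the summand `m =
l`, leaving a difference quotient. The sum keeps its form in that case because `logPole n 0 = 0` by
division by zero. -/
lemma truncatedMoment_add {s : ℝ} (hs : 0 < s) {a : ℂ} (ha : -1 < a.re) (n : ℕ) {M : ℕ}
    (hM : a.re < M) :
    truncatedMoment a n s + (-1) ^ M * ((s : ℂ) ^ M)⁻¹ *
        mellin ((Set.Ioi 1).indicator
          fun t => ((Real.log t : ℝ) : ℂ) ^ n * stieltjesKernel s t) (1 + a - M)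
      = momentKernel a n s
        + ∑ m ∈ Finset.range M, (-1) ^ m * ((s : ℂ) ^ (m + 1))⁻¹ * logPole n (a - m) := by
  have h0 : 0 < (1 + a).re := by simp; linarith
  have h1 : (1 + a).re < M + 1 := by simp; linarith
  have h2 : (1 + a - M).re < 1 := by simp; linarith
  have hev := mellin_Ioc_stieltjesKernel_eventuallyEq hs M h0 h1
  have han1 := analyticAt_mellin_Ioc_stieltjesKernel hs h0
  have han2 : AnalyticAt ℂ
      (fun z : ℂ => mellin ((Set.Ioi 1).indicator (stieltjesKernel s)) (z - M)) (1 + a) :=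
    AnalyticAt.comp (g := mellin ((Set.Ioi 1).indicator (stieltjesKernel s)))
      (analyticAt_mellin_Ioi_stieltjesKernel hs h2) (by fun_prop)
  have han3 : AnalyticAt ℂ (fun z : ℂ => (-1) ^ M * ((s : ℂ) ^ M)⁻¹ *
      mellin ((Set.Ioi 1).indicator (stieltjesKernel s)) (z - M)) (1 + a) :=
    analyticAt_const.mul han2
  have hlhs : iteratedDeriv n (fun z => mellin ((Set.Ioc 0 1).indicator (stieltjesKernel s)) z
      + (-1) ^ M * ((s : ℂ) ^ M)⁻¹
          * mellin ((Set.Ioi 1).indicator (stieltjesKernel s)) (z - M)) (1 + a)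
      = truncatedMoment a n s + (-1) ^ M * ((s : ℂ) ^ M)⁻¹ *
        mellin ((Set.Ioi 1).indicator
          fun t => ((Real.log t : ℝ) : ℂ) ^ n * stieltjesKernel s t) (1 + a - M) := by
    rw [iteratedDeriv_fun_add han1.contDiffAt han3.contDiffAt,
      iteratedDeriv_const_mul_field, iteratedDeriv_mellin_Ioc_stieltjesKernel hs ha,
      iteratedDeriv_comp_sub_const, ← iteratedDeriv_mellin_Ioi_stieltjesKernel hs h2]
  have hD : ∀ m : ℕ, (m : ℂ) ≠ a → iteratedDeriv n (fun z => logPole 0 (z - 1 - m)) (1 + a)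
      = logPole n (a - m) ∧ AnalyticAt ℂ (fun z => logPole 0 (z - 1 - m)) (1 + a) := by
    intro m hm
    have hne : 1 + a - (1 + (m : ℂ)) ≠ 0 := fun h => hm (by linear_combination -h)
    simp_rw [sub_sub]
    exact ⟨by rw [iteratedDeriv_logPole_comp_sub n hne]; congr 1; ring,
      analyticAt_logPole_comp_sub 0 hne⟩
  have hT : ∀ S : Finset ℕ, (∀ m ∈ S, (m : ℂ) ≠ a) →
      AnalyticAt ℂ (fun z => ∑ m ∈ S, (-1) ^ m * ((s : ℂ) ^ (m + 1))⁻¹ * logPole 0 (z - 1 - m))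
        (1 + a) ∧
      iteratedDeriv n
        (fun z => ∑ m ∈ S, (-1) ^ m * ((s : ℂ) ^ (m + 1))⁻¹ * logPole 0 (z - 1 - m)) (1 + a)
        = ∑ m ∈ S, (-1) ^ m * ((s : ℂ) ^ (m + 1))⁻¹ * logPole n (a - m) := by
    intro S hS
    have han : ∀ m ∈ S, AnalyticAt ℂ
        (fun z => (-1) ^ m * ((s : ℂ) ^ (m + 1))⁻¹ * logPole 0 (z - 1 - m)) (1 + a) :=
      fun m hm => analyticAt_const.mul (hD m (hS m hm)).2
    refine ⟨Finset.analyticAt_fun_sum _ han, ?_⟩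
    rw [iteratedDeriv_fun_sum fun m hm => (han m hm).contDiffAt]
    refine Finset.sum_congr rfl fun m hm => ?_
    rw [iteratedDeriv_const_mul_field, (hD m (hS m hm)).1]
  rw [← hlhs]
  have hlhsan := han1.add han3
  by_cases hl : ∃ l : ℕ, (l : ℂ) = a
  · rw [momentKernel, if_pos hl]
    obtain ⟨l, rfl⟩ := hl
    have hlM : l < M := by simpa using hM
    set K : ℂ → ℂ := fun z => (s : ℂ) ^ (-z) * residueKernel (1 + l) z with hK
    have hKan : AnalyticAt ℂ K (1 + l) :=
      ((differentiable_ofReal_cpow_neg hs).analyticAt _).mul (analyticAt_residueKernel l)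
    obtain ⟨hS1, hS2⟩ := hT ((Finset.range M).erase l) fun m hm h =>
      (Finset.mem_erase.1 hm).1 (Nat.cast_injective h)
    have hK0 : K (1 + l) = ((s : ℂ) ^ (l + 1))⁻¹ * (-1) ^ (l + 1) := by
      simp only [hK, residueKernel_self]
      rw [Complex.cpow_neg]
      congr 2
      rw [← Complex.cpow_natCast]
      push_cast
      ring_nf
    have hev2 : (fun z => mellin ((Set.Ioc 0 1).indicator (stieltjesKernel s)) z
        + (-1) ^ M * ((s : ℂ) ^ M)⁻¹
          * mellin ((Set.Ioi 1).indicator (stieltjesKernel s)) (z - M)) =ᶠ[𝓝[≠] (1 + l : ℂ)]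
        fun z => dslope K (1 + l) z + ∑ m ∈ (Finset.range M).erase l,
          (-1) ^ m * ((s : ℂ) ^ (m + 1))⁻¹ * logPole 0 (z - 1 - m) := by
      filter_upwards [hev, self_mem_nhdsWithin] with z hz hne
      have hne : z ≠ 1 + l := hne
      have hne' : z - (1 + l) ≠ 0 := sub_ne_zero.2 hne
      rw [hz, ← Finset.add_sum_erase _ _ (Finset.mem_range.2 hlM), ← add_assoc,
        dslope_of_ne _ hne, slope_def_field, hK0]
      congr 1
      simp only [hK, residueKernel_of_ne l hne, logPole]
      rw [sub_sub z, eq_div_iff hne']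
      rw [add_mul, show ∀ x y : ℂ, x * (((-1) ^ 0 * (Nat.factorial 0 : ℂ)) / y ^ (0 + 1)) * y
        = x * (y / y) from fun x y => by simp; ring, div_self hne']
      ring
    have hev3 := (hlhsan.continuousAt.eventuallyEq_nhds_iff_eventuallyEq_nhdsNE
      (hKan.dslope_same.add hS1).continuousAt).1 hev2
    have := hev3.iteratedDeriv_eq n
    refine this.trans ?_
    simp only [Pi.add_def]
    rw [iteratedDeriv_fun_add hKan.dslope_same.contDiffAt hS1.contDiffAt, hS2,
      iteratedDeriv_dslope hKan, ← Finset.add_sum_erase _ _ (Finset.mem_range.2 hlM)]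
    simp [logPole]
  · rw [momentKernel, if_neg hl]
    have hKan : AnalyticAt ℂ
        (fun z => (s : ℂ) ^ (-z) * (Real.pi / Complex.sin (Real.pi * z))) (1 + a) :=
      ((differentiable_ofReal_cpow_neg hs).analyticAt _).mul
        (analyticAt_pi_div_sin (sin_pi_mul_one_add_ne_zero ha hl))
    obtain ⟨hS1, hS2⟩ := hT (Finset.range M) fun m _ h => hl ⟨m, h⟩
    have hev3 := (hlhsan.continuousAt.eventuallyEq_nhds_iff_eventuallyEq_nhdsNE
      (hKan.add hS1).continuousAt).1 hev
    refine (hev3.iteratedDeriv_eq n).trans ?_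
    simp only [Pi.add_def]
    rw [iteratedDeriv_fun_add hKan.contDiffAt hS1.contDiffAt, hS2]

lemma isBigO_inv_pow_of_le {i j : ℕ} (h : i ≤ j) :
    (fun s : ℝ => (s ^ j)⁻¹) =O[atTop] fun s : ℝ => (s ^ i)⁻¹ := by
  refine IsBigO.of_bound 1 ?_
  filter_upwards [eventually_ge_atTop 1] with s hs
  have h0 : 0 < s := by linarith
  rw [Real.norm_of_nonneg (by positivity), Real.norm_of_nonneg (by positivity), one_mul]
  exact inv_anti₀ (by positivity) (pow_le_pow_right₀ hs h)

lemma isBigO_const_mul_inv_pow (c : ℂ) (j : ℕ) :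
    (fun s : ℝ => ((s : ℂ) ^ j)⁻¹ * c) =O[atTop] fun s : ℝ => (s ^ j)⁻¹ := by
  refine IsBigO.of_bound ‖c‖ ?_
  filter_upwards with s
  rw [norm_mul, norm_inv, norm_pow, Complex.norm_real, norm_inv, norm_pow, mul_comm]

lemma truncatedMoment_sub_isBigO {a : ℂ} (ha : -1 < a.re) (n M : ℕ) :
    (fun s : ℝ => truncatedMoment a n s - momentKernel a n s
        - ∑ m ∈ Finset.range M, (-1) ^ m * ((s : ℂ) ^ (m + 1))⁻¹ * logPole n (a - m))
      =O[atTop] fun s : ℝ => (s ^ (M + 1))⁻¹ := by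
  obtain ⟨M', hM'⟩ := exists_nat_gt a.re
  -- The identity needs more than `Re a` polar terms. The surplus terms `M ≤ m < L` are themselves
  -- `O(s^(-(M+1)))` and go into the error.
  set L := max M M' with hL
  have hLa : a.re < L := hM'.trans_le (by exact_mod_cast le_max_right M M')
  obtain ⟨C, hC⟩ := exists_norm_mellin_Ioi_log_stieltjesKernel_le n (w := 1 + a - L)
    (by simp; linarith)
  have h1 : (fun s : ℝ => -((-1) ^ L * ((s : ℂ) ^ L)⁻¹ *
        mellin ((Set.Ioi 1).indicator
          fun t => ((Real.log t : ℝ) : ℂ) ^ n * stieltjesKernel s t) (1 + a - L)))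
      =O[atTop] fun s : ℝ => (s ^ (M + 1))⁻¹ := by
    refine IsBigO.trans ?_ (isBigO_inv_pow_of_le (show M + 1 ≤ L + 1 by omega))
    refine IsBigO.of_bound C ?_
    filter_upwards [eventually_gt_atTop 0] with s hs
    rw [norm_neg, norm_mul, norm_mul, norm_pow, norm_neg, norm_one, one_pow, one_mul, norm_inv,
      norm_pow, Complex.norm_real, norm_inv, norm_pow, pow_succ ‖s‖ L, mul_inv, Real.norm_of_nonneg hs.le]
    calc _ ≤ (s ^ L)⁻¹ * (C * s⁻¹) := by gcongr; exact hC s hs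
      _ = _ := by ring
  have h2 : (fun s : ℝ => ∑ m ∈ Finset.Ico M L,
      (-1) ^ m * ((s : ℂ) ^ (m + 1))⁻¹ * logPole n (a - m))
      =O[atTop] fun s : ℝ => (s ^ (M + 1))⁻¹ := by
    refine IsBigO.fun_sum fun m hm => ?_
    have := (isBigO_const_mul_inv_pow ((-1) ^ m * logPole n (a - m)) (m + 1)).trans
      (isBigO_inv_pow_of_le (show M + 1 ≤ m + 1 by have := (Finset.mem_Ico.1 hm).1; omega))
    refine this.congr_left fun s => by ring
  refine (h1.add h2).congr' ?_ EventuallyEq.rfl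
  filter_upwards [eventually_gt_atTop 0] with s hs
  have e := truncatedMoment_add hs ha n hLa
  rw [← Finset.sum_range_add_sum_Ico _ (le_max_left M M')] at e
  linear_combination -e

/-! ### Expansion of `∫ f(t) / (1 + s t) dt` as `s → ∞` -/

lemma measurable_stieltjesKernel (s : ℝ) : Measurable (stieltjesKernel s) := by
  unfold stieltjesKernel
  fun_prop

lemma norm_mul_stieltjesKernel_le {s t : ℝ} (hs : 0 < s) (ht : 0 < t) :
    ‖(t : ℂ) * stieltjesKernel s t‖ ≤ s⁻¹ := by
  rw [norm_mul, Complex.norm_real, Real.norm_of_nonneg ht.le]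
  calc _ ≤ t * (s⁻¹ * t⁻¹) := by gcongr; exact norm_stieltjesKernel_le hs ht
    _ = s⁻¹ := by field_simp

lemma integrableOn_mul_stieltjesKernel {s : ℝ} (hs : 0 < s) {h : ℝ → ℂ}
    (hh : IntegrableOn h (Set.Ioi 0)) :
    IntegrableOn (fun t : ℝ => h t * ((t : ℂ) * stieltjesKernel s t)) (Set.Ioi 0) := by
  refine Integrable.mul_bdd (c := s⁻¹) hh ?_ ?_
  · have := measurable_stieltjesKernel s
    exact Measurable.aestronglyMeasurable (by fun_prop)
  · exact (ae_restrict_iff' measurableSet_Ioi).2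
      (Eventually.of_forall fun t ht => norm_mul_stieltjesKernel_le hs ht)

lemma integrableOn_mul_stieltjesKernel_of_mellinConvergent {s : ℝ} (hs : 0 < s) {h : ℝ → ℂ}
    (hh : MellinConvergent h 0) :
    IntegrableOn (fun t : ℝ => h t * stieltjesKernel s t) (Set.Ioi 0) := by
  refine (integrableOn_mul_stieltjesKernel hs hh).congr_fun (fun t ht => ?_) measurableSet_Ioi
  have ht0 : (t : ℂ) ≠ 0 := Complex.ofReal_ne_zero.2 (Set.mem_Ioi.1 ht).ne'
  simp only [zero_sub, Complex.cpow_neg_one, smul_eq_mul]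
  field_simp

/-- The finite geometric series. The last factor `t · kernel` is bounded by `1/s`, so only moments
up to order `M` are needed for an error `s^(-(M+1))`. -/
lemma stieltjesKernel_eq {s t : ℝ} (hs : 0 < s) (ht : 0 < t) (M : ℕ) :
    stieltjesKernel s t = ∑ m ∈ Finset.range M, (-1) ^ m * ((s : ℂ) ^ (m + 1))⁻¹ *
        (t : ℂ) ^ (-(m : ℂ) - 1)
      + (-1) ^ M * ((s : ℂ) ^ M)⁻¹ * ((t : ℂ) ^ (-(M : ℂ) - 1) * (t * stieltjesKernel s t)) := by
  have ht0 : (t : ℂ) ≠ 0 := Complex.ofReal_ne_zero.2 ht.ne'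
  have hs0 : (s : ℂ) ≠ 0 := Complex.ofReal_ne_zero.2 hs.ne'
  have h1 : (1 + s * t : ℂ) ≠ 0 := by
    have : ((1 + s * t : ℝ) : ℂ) ≠ 0 :=
      Complex.ofReal_ne_zero.2 (by have := mul_pos hs ht; linarith)
    simpa using this
  have hpow : ∀ m : ℕ, (t : ℂ) ^ (-(m : ℂ) - 1) = ((t : ℂ) ^ (m + 1))⁻¹ := fun m => by
    rw [← Complex.cpow_natCast, ← Complex.cpow_neg]
    push_cast
    ring_nf
  simp_rw [hpow]
  have hk : stieltjesKernel s t = (1 + s * t : ℂ)⁻¹ := by simp [stieltjesKernel]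
  obtain ⟨D, hD⟩ : ∃ D : ℂ, D = 1 + s * t := ⟨_, rfl⟩
  rw [← hD] at h1 hk
  rw [hk]
  induction M with
  | zero => simp; field_simp
  | succ M ih =>
    rw [Finset.sum_range_succ]
    nth_rewrite 1 [ih]
    rw [add_assoc]
    congr 1
    field_simp
    rw [hD]
    ring

lemma integral_mul_stieltjesKernel_sub_isBigO {h : ℝ → ℂ} {M : ℕ}
    (hh : ∀ m : ℕ, m ≤ M → MellinConvergent h (-(m : ℂ))) :
    (fun s : ℝ => (∫ t in Set.Ioi 0, h t * stieltjesKernel s t)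
        - ∑ m ∈ Finset.range M, (-1) ^ m * ((s : ℂ) ^ (m + 1))⁻¹ * mellin h (-(m : ℂ)))
      =O[atTop] fun s : ℝ => (s ^ (M + 1))⁻¹ := by
  set g : ℝ → ℂ := fun t => (t : ℂ) ^ (-(M : ℂ) - 1) • h t with hg
  have hgi : IntegrableOn g (Set.Ioi 0) := hh M le_rfl
  refine IsBigO.of_bound (∫ t in Set.Ioi 0, ‖g t‖) ?_
  filter_upwards [eventually_gt_atTop 0] with s hs
  have hi := integrableOn_mul_stieltjesKernel hs hgi
  have hm : ∀ m ∈ Finset.range M, IntegrableOn (fun t : ℝ => (-1) ^ m * ((s : ℂ) ^ (m + 1))⁻¹ *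
      ((t : ℂ) ^ (-(m : ℂ) - 1) • h t)) (Set.Ioi 0) := fun m hm =>
    Integrable.const_mul (hh m (Finset.mem_range.1 hm).le) _
  have e : ∫ t in Set.Ioi 0, h t * stieltjesKernel s t
      = ∑ m ∈ Finset.range M, (-1) ^ m * ((s : ℂ) ^ (m + 1))⁻¹ * mellin h (-(m : ℂ))
        + (-1) ^ M * ((s : ℂ) ^ M)⁻¹ * ∫ t in Set.Ioi 0, g t * (t * stieltjesKernel s t) := by
    simp_rw [mellin, ← integral_const_mul]
    rw [← integral_finsetSum _ hm, ← integral_add (integrable_finsetSum _ hm) (hi.const_mul _)]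
    refine setIntegral_congr_fun measurableSet_Ioi fun t ht => ?_
    simp only [hg, smul_eq_mul]
    nth_rewrite 1 [stieltjesKernel_eq hs ht M]
    rw [mul_add, Finset.mul_sum]
    congr 1
    · exact Finset.sum_congr rfl fun m _ => by ring
    · ring
  rw [e, add_sub_cancel_left, norm_mul, norm_mul, norm_pow, norm_neg, norm_one, one_pow, one_mul,
    norm_inv, norm_pow, Complex.norm_real, norm_inv, norm_pow, pow_succ ‖s‖ M, mul_inv,
    Real.norm_of_nonneg hs.le]
  have hb : ‖∫ t in Set.Ioi 0, g t * (t * stieltjesKernel s t)‖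
      ≤ (∫ t in Set.Ioi 0, ‖g t‖) * s⁻¹ := by
    rw [← integral_mul_const]
    refine norm_integral_le_of_norm_le (hgi.norm.mul_const _) ?_
    refine (ae_restrict_iff' measurableSet_Ioi).2 (Eventually.of_forall fun t ht => ?_)
    rw [norm_mul]
    gcongr
    exact norm_mul_stieltjesKernel_le hs ht
  calc _ ≤ (s ^ M)⁻¹ * ((∫ t in Set.Ioi 0, ‖g t‖) * s⁻¹) := by gcongr
    _ = _ := by ring

lemma integrableOn_term_mul_stieltjesKernel {s : ℝ} (hs : 0 < s) {b c : ℂ} {n : ℕ}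
    (h : c = 0 ∨ -1 < b.re) :
    IntegrableOn (fun t : ℝ => (Set.Ioc (0 : ℝ) 1).indicator
      (fun t : ℝ => c * (t : ℂ) ^ b * ((Real.log t : ℝ) : ℂ) ^ n) t * stieltjesKernel s t)
      (Set.Ioi 0) ∧
    ∫ t in Set.Ioi 0, (Set.Ioc (0 : ℝ) 1).indicator
      (fun t : ℝ => c * (t : ℂ) ^ b * ((Real.log t : ℝ) : ℂ) ^ n) t * stieltjesKernel s t
      = c * truncatedMoment b n s := by
  constructor
  · have h1 := (hasMellin_term (b := b) (c := c) (n := n) (w := 1)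
      (h.imp_right fun h => by simp; linarith)).1
    refine Integrable.mul_bdd (c := 1) ?_ (measurable_stieltjesKernel s).aestronglyMeasurable ?_
    · simp only [MellinConvergent, sub_self, Complex.cpow_zero, one_smul] at h1
      exact h1
    · exact (ae_restrict_iff' measurableSet_Ioi).2
        (Eventually.of_forall fun t ht => norm_stieltjesKernel_le_one hs ht)
  · rw [truncatedMoment, mellin, ← integral_const_mul]
    refine setIntegral_congr_fun measurableSet_Ioi fun t _ => ?_
    simp only [Set.indicator_apply, smul_eq_mul, add_sub_cancel_left]
    split_ifs
    · ring
    · simp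

section

variable {f : ℝ → ℂ} {N : ℕ → ℕ} {p : ℕ → ℕ → ℂ} {a : ℕ → ℂ}

/-- Write `f = F +` the cut-off terms of the expansion. `F` has the moments needed for the geometric
series, and the cut-off terms give truncated moments of the kernel. The polar sums in `logPole n (a
i - m)` that the latter produce are exactly the pole blocks at `w = -m`, so together with the
moments of `F` they form `mellinPiece` at `-m`. -/
lemma HasLogExpansion.integral_mul_stieltjesKernel_sub_isBigO (h : HasLogExpansion f N p a)
    (hfi : LocallyIntegrableOn f (Set.Ioi 0)) (ha_inj : Function.Injective a)
    (ha_mono : Monotone fun m => (a m).re)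
    (ha_tendsto : Tendsto (fun m => (a m).re) atTop atTop)
    (hγ : growthZero f < 1) (hδ : 0 < decayInfty f) {K M : ℕ} (hK : M < (a (K + 1)).re) :
    (fun s : ℝ => (∫ t in Set.Ioi 0, f t * stieltjesKernel s t)
        - ∑ m ∈ Finset.range M, (-1) ^ m * ((s : ℂ) ^ (m + 1))⁻¹ *
          mellinPiece f N p a K (-(m : ℂ))
        - ∑ i ∈ Finset.range (K + 1), ∑ n ∈ Finset.range (N i + 1),
          p i n * momentKernel (a i) n s)
      =O[atTop] fun s : ℝ => (s ^ (M + 1))⁻¹ := by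
  have hp : ∀ i n, n ≤ N i → p i n = 0 ∨ -1 < (a i).re := by
    intro i n hn
    by_cases hi : -1 < (a i).re
    · exact Or.inr hi
    · refine Or.inl (h.coeff_eq_zero hfi ha_inj ha_mono ha_tendsto (hγ.trans_le ?_) n hn)
      rw [← EReal.coe_one]
      exact EReal.coe_le_coe_iff.2 (by linarith)
  set F : ℝ → ℂ := fun t => (Set.Ioi (1 : ℝ)).indicator f t + cutRemainder f N p a K t with hF
  have hMel : ∀ m : ℕ, m ≤ M → HasMellin F (-(m : ℂ))
      (mellin ((Set.Ioi 1).indicator f) (-(m : ℂ)) + mellin (cutRemainder f N p a K) (-(m : ℂ))) := by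
    intro m hm
    have hm' : (m : ℝ) ≤ M := by exact_mod_cast hm
    refine hasMellin_add (mellinConvergent_indicator_Ioi hfi ?_).1 (h.mellin_cutRemainder hfi ?_).1
    · refine lt_of_le_of_lt ?_ hδ
      rw [← EReal.coe_zero]
      exact EReal.coe_le_coe_iff.2 (by simp)
    · simp; linarith
  have h1 := _root_.integral_mul_stieltjesKernel_sub_isBigO fun m hm => (hMel m hm).1
  have h2 : (fun s : ℝ => ∑ i ∈ Finset.range (K + 1), ∑ n ∈ Finset.range (N i + 1), p i n *
      (truncatedMoment (a i) n s - momentKernel (a i) n s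
        - ∑ m ∈ Finset.range M, (-1) ^ m * ((s : ℂ) ^ (m + 1))⁻¹ * logPole n (a i - m)))
      =O[atTop] fun s : ℝ => (s ^ (M + 1))⁻¹ := by
    refine IsBigO.fun_sum fun i _ => IsBigO.fun_sum fun n hn => ?_
    rcases hp i n (Nat.lt_succ_iff.1 (Finset.mem_range.1 hn)) with h0 | h0
    · simp only [h0, zero_mul]
      exact isBigO_zero _ _
    · exact (truncatedMoment_sub_isBigO h0 n M).const_mul_left _
  refine (h1.add h2).congr' ?_ EventuallyEq.rfl
  filter_upwards [eventually_gt_atTop 0] with s hs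
  have hterm : ∀ i, ∀ n ∈ Finset.range (N i + 1), _ := fun i n hn =>
    integrableOn_term_mul_stieltjesKernel hs (n := n)
      (hp i n (Nat.lt_succ_iff.1 (Finset.mem_range.1 hn)))
  have hFi : IntegrableOn (fun t : ℝ => F t * stieltjesKernel s t) (Set.Ioi 0) :=
    integrableOn_mul_stieltjesKernel_of_mellinConvergent hs (by
      simpa using (hMel 0 (Nat.zero_le _)).1)
  have e1 : ∫ t in Set.Ioi 0, f t * stieltjesKernel s t
      = (∫ t in Set.Ioi 0, F t * stieltjesKernel s t) + ∑ i ∈ Finset.range (K + 1),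
        ∑ n ∈ Finset.range (N i + 1), p i n * truncatedMoment (a i) n s := by
    have e2 : ∀ i ∈ Finset.range (K + 1), ∑ n ∈ Finset.range (N i + 1),
        p i n * truncatedMoment (a i) n s = ∫ t in Set.Ioi 0, ∑ n ∈ Finset.range (N i + 1),
          (Set.Ioc (0 : ℝ) 1).indicator (fun t : ℝ => p i n * (t : ℂ) ^ a i *
            ((Real.log t : ℝ) : ℂ) ^ n) t * stieltjesKernel s t := fun i _ => by
      rw [integral_finsetSum _ fun n hn => (hterm i n hn).1]
      exact Finset.sum_congr rfl fun n hn => (hterm i n hn).2.symm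
    have hint : ∀ i ∈ Finset.range (K + 1), IntegrableOn (fun t => ∑ n ∈ Finset.range (N i + 1),
          (Set.Ioc (0 : ℝ) 1).indicator (fun t : ℝ => p i n * (t : ℂ) ^ a i *
            ((Real.log t : ℝ) : ℂ) ^ n) t * stieltjesKernel s t) (Set.Ioi 0) := fun i _ =>
      integrable_finsetSum _ fun n hn => (hterm i n hn).1
    rw [Finset.sum_congr rfl e2, ← integral_finsetSum _ hint,
      ← integral_add hFi (integrable_finsetSum _ hint)]
    refine setIntegral_congr_fun measurableSet_Ioi fun t ht => ?_
    have ht : 0 < t := ht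
    rcases le_or_gt t 1 with h5 | h5
    · have hmem : t ∈ Set.Ioc (0 : ℝ) 1 := ⟨ht, h5⟩
      have hnot : t ∉ Set.Ioi (1 : ℝ) := not_lt.2 h5
      simp only [hF, cutRemainder, Set.indicator_of_mem hmem, Set.indicator_of_notMem hnot,
        ← Finset.sum_mul, fadingSum]
      ring
    · have hmem : t ∉ Set.Ioc (0 : ℝ) 1 := fun h => not_lt.2 h.2 h5
      have hnot : t ∈ Set.Ioi (1 : ℝ) := h5
      simp [hF, cutRemainder, Set.indicator_of_notMem hmem, Set.indicator_of_mem hnot]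
  have e3 : ∑ m ∈ Finset.range M, (-1) ^ m * ((s : ℂ) ^ (m + 1))⁻¹ *
        mellinPiece f N p a K (-(m : ℂ))
      = ∑ m ∈ Finset.range M, (-1) ^ m * ((s : ℂ) ^ (m + 1))⁻¹ * mellin F (-(m : ℂ))
        + ∑ i ∈ Finset.range (K + 1), ∑ n ∈ Finset.range (N i + 1), p i n *
          ∑ m ∈ Finset.range M, (-1) ^ m * ((s : ℂ) ^ (m + 1))⁻¹ * logPole n (a i - m) := by
    have e4 : ∑ i ∈ Finset.range (K + 1), ∑ n ∈ Finset.range (N i + 1), p i n *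
          ∑ m ∈ Finset.range M, (-1) ^ m * ((s : ℂ) ^ (m + 1))⁻¹ * logPole n (a i - m)
        = ∑ m ∈ Finset.range M, (-1) ^ m * ((s : ℂ) ^ (m + 1))⁻¹ *
          ∑ i ∈ Finset.range (K + 1), poleBlock N p a i (-(m : ℂ)) := by
      simp_rw [Finset.mul_sum (Finset.range (K + 1))]
      rw [Finset.sum_comm (s := Finset.range M)]
      refine Finset.sum_congr rfl fun i _ => ?_
      simp_rw [poleBlock, Finset.mul_sum]
      rw [Finset.sum_comm]
      refine Finset.sum_congr rfl fun m _ => Finset.sum_congr rfl fun n _ => ?_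
      rw [neg_add_eq_sub]
      ring
    rw [e4, ← Finset.sum_add_distrib]
    refine Finset.sum_congr rfl fun m hm => ?_
    rw [mellinPiece, (hMel m (Finset.mem_range.1 hm).le).2]
    ring
  rw [e1, e3]
  simp only [mul_sub, Finset.sum_sub_distrib]
  ring

end

/-! ### The terms of the Gaussian expansion -/

lemma ofReal_cpow_neg_one_add_natCast (s : ℝ) (l : ℕ) :
    (s : ℂ) ^ (-(1 + (l : ℂ))) = ((s : ℂ) ^ (l + 1))⁻¹ := by
  rw [Complex.cpow_neg, ← Complex.cpow_natCast]
  push_cast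
  ring_nf

lemma fadingTerm_eq {N : ℕ → ℕ} {p : ℕ → ℕ → ℂ} {a : ℕ → ℂ} {i : ℕ} {s : ℝ} (hs : 0 < s)
    (hp : (∀ n ≤ N i, p i n = 0) ∨ -1 < (a i).re) (hi : ¬ ∃ l : ℕ, (l : ℂ) = a i) :
    fadingTerm N p a i s = ∑ n ∈ Finset.range (N i + 1), p i n * momentKernel (a i) n s := by
  rw [fadingTerm, Finset.mul_sum]
  refine Finset.sum_congr rfl fun n hn => ?_
  rcases hp with h0 | h0
  · rw [h0 n (Nat.lt_succ_iff.1 (Finset.mem_range.1 hn))]; simp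
  · rw [momentKernel, if_neg hi, iteratedDeriv_cpow_neg_mul hs
      (analyticAt_pi_div_sin (sin_pi_mul_one_add_ne_zero h0 hi))]
    ring

/-- Leibniz's rule divided by `n!`: the sums of the coincident terms are Taylor coefficients of
`s^(-z) H(z)`. -/
lemma sum_div_factorial_iteratedDeriv {s : ℝ} (hs : 0 < s) {H : ℂ → ℂ} {z₀ : ℂ}
    (hH : AnalyticAt ℂ H z₀) (n : ℕ) :
    (s : ℂ) ^ (-z₀) * ∑ j ∈ Finset.range (n + 1),
      (-((Real.log s : ℝ) : ℂ)) ^ j / ((j.factorial : ℂ) * ((n - j).factorial : ℂ)) *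
        iteratedDeriv (n - j) H z₀
      = iteratedDeriv n (fun z => (s : ℂ) ^ (-z) * H z) z₀ / n.factorial := by
  have hn : (n.factorial : ℂ) ≠ 0 := Nat.cast_ne_zero.2 n.factorial_ne_zero
  rw [iteratedDeriv_cpow_neg_mul hs hH, mul_div_assoc, Finset.sum_div]
  congr 1
  refine Finset.sum_congr rfl fun j hj => ?_
  rw [Nat.cast_choose ℂ (Nat.lt_succ_iff.1 (Finset.mem_range.1 hj))]
  field_simp

section

variable {f : ℝ → ℂ} {N : ℕ → ℕ} {p : ℕ → ℕ → ℂ} {a : ℕ → ℂ}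

/-- Division by zero gives `logPole n 0 = 0`. Hence at such a pole `mellinPiece` takes the value of
its regular part, the constant Laurent coefficient. -/
lemma poleBlock_self {k : ℕ} {l : ℕ} (hl : (l : ℂ) = a k) : poleBlock N p a k (-(l : ℂ)) = 0 := by
  refine Finset.sum_eq_zero fun n _ => ?_
  rw [hl, neg_add_cancel]
  simp [logPole]

/-- Near `z₀ = 1 + l` the continued transform is `reg(1 - z) - Σ p k n · n! (z - z₀)^(-(n+1))`, and
`π / sin(πz)` is `residueKernel/(z - z₀)`. Multiplication by `(z - z₀)^(N k + 2)` gives an analytic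
`H`, and the coincident term is minus the Taylor coefficient of order `N k + 1` of `s^(-z) H`. The
regular part contributes the integer-power term at `m = l`, since the residue there is `(-1)^(l+1)`.
The polar part contributes the moment kernels of `a k`. -/
lemma coincidentTerm_eq (h : HasLogExpansion f N p a)
    (hfi : LocallyIntegrableOn f (Set.Ioi 0)) (ha_inj : Function.Injective a)
    (ha_mono : Monotone fun m => (a m).re)
    (ha_tendsto : Tendsto (fun m => (a m).re) atTop atTop) (hγδ : growthZero f < decayInfty f)
    (hδ : 0 < decayInfty f) {k K l : ℕ} (hl : (l : ℂ) = a k) (hkK : k ≤ K)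
    (hK : (l : ℝ) < (a (K + 1)).re) {s : ℝ} (hs : 0 < s) :
    coincidentTerm f N a k s = (-1) ^ l * ((s : ℂ) ^ (l + 1))⁻¹ * mellinPiece f N p a K (-(l : ℂ))
      + ∑ n ∈ Finset.range (N k + 1), p k n * momentKernel (a k) n s := by
  have hw1 : -(a (K + 1)).re < (-(l : ℂ)).re := by simp; linarith
  have hw2 : (((-(l : ℂ)).re : ℝ) : EReal) < decayInfty f := by
    refine lt_of_le_of_lt ?_ hδ
    rw [← EReal.coe_zero]
    exact EReal.coe_le_coe_iff.2 (by simp)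
  set reg : ℂ → ℂ := fun w => (mellin ((Set.Ioi 1).indicator f) w
      + mellin (cutRemainder f N p a K) w)
      + ∑ i ∈ (Finset.range (K + 1)).erase k, poleBlock N p a i w with hreg
  have hregan : AnalyticAt ℂ reg (-(l : ℂ)) :=
    (h.analyticAt_regular hfi hw1 hw2).add (Finset.analyticAt_fun_sum _ fun i hi =>
      analyticAt_poleBlock N p fun h0 => (Finset.mem_erase.1 hi).1 (ha_inj (by
        rw [← hl]; linear_combination h0)))
  have hpiece : ∀ w, mellinPiece f N p a K w = reg w + poleBlock N p a k w := fun w => by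
    rw [mellinPiece, ← Finset.add_sum_erase _ _ (Finset.mem_range.2 (Nat.lt_succ_of_le hkK))]
    simp only [hreg]
    ring
  set z₀ : ℂ := 1 + l with hz₀
  have hg : AnalyticAt ℂ (fun z => reg (1 - z)) z₀ := by
    refine AnalyticAt.comp (g := reg) ?_ (by fun_prop)
    rw [show 1 - z₀ = -(l : ℂ) by rw [hz₀]; ring]
    exact hregan
  set H : ℂ → ℂ := fun z => residueKernel z₀ z * ((z - z₀) ^ (N k + 1) * reg (1 - z)
    - ∑ n ∈ Finset.range (N k + 1), p k n * n.factorial * (z - z₀) ^ (N k - n)) with hH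
  have hrk : AnalyticAt ℂ (residueKernel z₀) z₀ := analyticAt_residueKernel l
  have hHan : AnalyticAt ℂ H z₀ :=
    hrk.mul (AnalyticAt.sub (AnalyticAt.mul (by fun_prop) hg) (by fun_prop))
  have htend : Tendsto (fun z : ℂ => 1 - z) (𝓝[≠] z₀) (𝓝[≠] (-(l : ℂ))) := by
    rw [tendsto_nhdsWithin_iff]
    constructor
    · have : Continuous fun z : ℂ => 1 - z := by fun_prop
      exact (this.tendsto' _ _ (by rw [hz₀]; ring)).mono_left nhdsWithin_le_nhds
    · filter_upwards [self_mem_nhdsWithin] with z hz h0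
      have h0 : 1 - z = -(l : ℂ) := h0
      exact hz (by rw [Set.mem_singleton_iff, hz₀]; linear_combination -h0)
  have hTH : (fun z : ℂ => (z - z₀) ^ (N k + 2) *
      ((Real.pi : ℂ) * mellinCont f (1 - z) / Complex.sin (Real.pi * z))) =ᶠ[𝓝[≠] z₀] H := by
    filter_upwards [htend.eventually
      (h.mellinCont_eventuallyEq hfi ha_inj ha_mono ha_tendsto hγδ hw1 hw2),
      self_mem_nhdsWithin] with z hz hne
    have hne : z ≠ z₀ := hne
    have hv : z - z₀ ≠ 0 := sub_ne_zero.2 hne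
    rw [hz, hpiece]
    simp only [hH]
    have e1 : residueKernel z₀ z = (z - z₀) * (Real.pi / Complex.sin (Real.pi * z)) :=
      residueKernel_of_ne l hne
    have e2 : (z - z₀) ^ (N k + 1) * poleBlock N p a k (1 - z)
        = -∑ n ∈ Finset.range (N k + 1), p k n * n.factorial * (z - z₀) ^ (N k - n) := by
      rw [poleBlock, Finset.mul_sum, ← Finset.sum_neg_distrib]
      refine Finset.sum_congr rfl fun n hn => ?_
      have hn' : N k + 1 = (N k - n) + (n + 1) := by have := Finset.mem_range.1 hn; omega
      have e3 : 1 - z + a k = -(z - z₀) := by rw [← hl, hz₀]; ring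
      have e4 : ((-1 : ℂ) ^ n) * (-1) ^ n = 1 := by rw [← mul_pow]; simp
      rw [e3, logPole, hn', pow_add, neg_pow (z - z₀) (n + 1), pow_succ (-1 : ℂ) n]
      have e5 : ((-1 : ℂ) ^ n) ≠ 0 := pow_ne_zero _ (by norm_num)
      field_simp
    rw [e1, sub_eq_add_neg ((z - z₀) ^ (N k + 1) * reg (1 - z)), ← e2]
    ring
  have hNF : toMeromorphicNFAt (fun z : ℂ => (z - z₀) ^ (N k + 2) *
      ((Real.pi : ℂ) * mellinCont f (1 - z) / Complex.sin (Real.pi * z))) z₀ =ᶠ[𝓝 z₀] H := by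
    have h1 := toMeromorphicNFAt_eventuallyEq_nhds_congr hTH
    rwa [toMeromorphicNFAt_eq_self.2 hHan.meromorphicNFAt] at h1
  set Kf : ℂ → ℂ := fun z => (s : ℂ) ^ (-z) * residueKernel z₀ z with hKf
  have hKan : AnalyticAt ℂ Kf z₀ :=
    ((differentiable_ofReal_cpow_neg hs).analyticAt _).mul hrk
  have hKg : AnalyticAt ℂ (fun z => Kf z * reg (1 - z)) z₀ := hKan.mul hg
  have hK0 : Kf z₀ = ((s : ℂ) ^ (l + 1))⁻¹ * (-1) ^ (l + 1) := by
    simp only [hKf, hz₀, residueKernel_self, ofReal_cpow_neg_one_add_natCast]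
  have hdecomp : (fun z => (s : ℂ) ^ (-z) * H z) = fun z =>
      (z - z₀) ^ (N k + 1) * (Kf z * reg (1 - z))
      - ∑ n ∈ Finset.range (N k + 1), (p k n * n.factorial) * ((z - z₀) ^ (N k - n) * Kf z) := by
    ext z
    simp only [hH, hKf]
    rw [mul_sub, mul_sub, Finset.mul_sum, Finset.mul_sum]
    congr 1
    · ring
    · exact Finset.sum_congr rfl fun n _ => by ring
  have hfac : ((N k + 1).factorial : ℂ) ≠ 0 := Nat.cast_ne_zero.2 (Nat.factorial_ne_zero _)
  have hderiv : iteratedDeriv (N k + 1) (fun z => (s : ℂ) ^ (-z) * H z) z₀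
      = (N k + 1).factorial * (Kf z₀ * reg (-(l : ℂ)))
        - ∑ n ∈ Finset.range (N k + 1), p k n * ((N k + 1).factorial *
          (iteratedDeriv (n + 1) Kf z₀ / (n + 1))) := by
    have hA : AnalyticAt ℂ (fun z => (z - z₀) ^ (N k + 1) * (Kf z * reg (1 - z))) z₀ :=
      AnalyticAt.mul (by fun_prop) hKg
    have hB : ∀ n ∈ Finset.range (N k + 1), AnalyticAt ℂ
        (fun z => (p k n * n.factorial) * ((z - z₀) ^ (N k - n) * Kf z)) z₀ := fun n _ => by
      fun_prop
    rw [hdecomp, iteratedDeriv_fun_sub hA.contDiffAt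
      (Finset.analyticAt_fun_sum _ hB).contDiffAt,
      iteratedDeriv_fun_sum fun n hn => (hB n hn).contDiffAt]
    congr 1
    · have := iteratedDeriv_sub_pow_mul (F := fun z => Kf z * reg (1 - z)) (z₀ := z₀)
        hKg 0 (N k + 1)
      rw [zero_add] at this
      rw [this]
      simp only [Nat.factorial_zero, Nat.cast_one, div_one, iteratedDeriv_zero]
      rw [show 1 - z₀ = -(l : ℂ) by rw [hz₀]; ring]
    · refine Finset.sum_congr rfl fun n hn => ?_
      -- The factor `(z - z₀)^(N k - n)` absorbs that many derivatives, so exactly `n + 1` fall on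
      -- `Kf`, as in `momentKernel`.
      have hn' : N k + 1 = (n + 1) + (N k - n) := by have := Finset.mem_range.1 hn; omega
      have := iteratedDeriv_sub_pow_mul hKan (n + 1) (N k - n)
      rw [← hn'] at this
      rw [iteratedDeriv_const_mul_field, this, Nat.factorial_succ n]
      have h1 : (n.factorial : ℂ) ≠ 0 := Nat.cast_ne_zero.2 n.factorial_ne_zero
      have h2 : (n + 1 : ℂ) ≠ 0 := Nat.cast_add_one_ne_zero n
      push_cast
      field_simp
  have hz₀' : 1 + a k = z₀ := by rw [← hl]
  have hmk : ∀ n, momentKernel (a k) n s = iteratedDeriv (n + 1) Kf z₀ / (n + 1) := fun n => by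
    rw [momentKernel, if_pos ⟨l, hl⟩, hz₀']
  rw [coincidentTerm, hz₀']
  simp_rw [hNF.iteratedDeriv_eq, hmk]
  rw [neg_mul, sum_div_factorial_iteratedDeriv hs hHan, hderiv, hpiece, poleBlock_self hl, add_zero,
    hK0, pow_succ (-1 : ℂ) l]
  have e6 : ∑ n ∈ Finset.range (N k + 1), p k n * ((N k + 1).factorial *
          (iteratedDeriv (n + 1) Kf z₀ / (n + 1)))
      = (N k + 1).factorial * ∑ n ∈ Finset.range (N k + 1), p k n *
          (iteratedDeriv (n + 1) Kf z₀ / (n + 1)) := by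
    rw [Finset.mul_sum]
    exact Finset.sum_congr rfl fun n _ => by ring
  rw [e6]
  field_simp
  ring

lemma regularTerm_eq (h : HasLogExpansion f N p a)
    (hfi : LocallyIntegrableOn f (Set.Ioi 0)) (ha_inj : Function.Injective a)
    (ha_mono : Monotone fun m => (a m).re)
    (ha_tendsto : Tendsto (fun m => (a m).re) atTop atTop) (hγδ : growthZero f < decayInfty f)
    (hδ : 0 < decayInfty f) {m K : ℕ} (hm : ¬ ∃ n : ℕ, (m : ℂ) = a n)
    (hK : (m : ℝ) < (a (K + 1)).re) (s : ℝ) :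
    regularTerm f m s = (-1) ^ m * ((s : ℂ) ^ (m + 1))⁻¹ * mellinPiece f N p a K (-(m : ℂ)) := by
  rw [regularTerm, h.mellinCont_eq hfi ha_inj ha_mono ha_tendsto hγδ (k := K)]
  · ring
  · simp; linarith
  · refine lt_of_le_of_lt ?_ hδ
    rw [← EReal.coe_zero]
    exact EReal.coe_le_coe_iff.2 (by simp)
  · intro n _ h0
    exact hm ⟨n, by linear_combination -h0⟩

end

/-! ### The asymptotic expansion for Gaussian inputs -/

lemma isLittleO_inv_pow {X : ℝ} {j : ℕ} (h : X < j) :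
    (fun s : ℝ => (s ^ j)⁻¹) =o[atTop] fun s : ℝ => s ^ (-X) := by
  refine (isLittleO_iff_tendsto' ?_).2 ?_
  · filter_upwards [eventually_gt_atTop 0] with s hs h0
    exact absurd h0 (Real.rpow_pos_of_pos hs _).ne'
  · refine (tendsto_rpow_neg_atTop (sub_pos.2 h)).congr' ?_
    filter_upwards [eventually_gt_atTop 0] with s hs
    rw [neg_sub, Real.rpow_sub hs, Real.rpow_natCast, Real.rpow_neg hs.le]
    field_simp

section

variable {f : ℝ → ℂ} {N : ℕ → ℕ} {p : ℕ → ℕ → ℂ} {a : ℕ → ℂ}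

open Classical in
-- Each coincident index `i`, with `a i = l`, supplies both the integer term `m = l` and the moment
-- terms of `a i`. By injectivity of `a`, the map `i ↦ ⌊Re (a i)⌋₊` is a bijection from these
-- indices to the integers that occur as exponents. The three index sets thus reassemble into all
-- integers and all exponents of order at most `X`.
lemma gaussianPartialSum_eq (h : HasLogExpansion f N p a)
    (hfi : LocallyIntegrableOn f (Set.Ioi 0)) (ha_inj : Function.Injective a)
    (ha_mono : Monotone fun m => (a m).re)
    (ha_tendsto : Tendsto (fun m => (a m).re) atTop atTop) (hγδ : growthZero f < decayInfty f)
    (hδ : 0 < decayInfty f) (hp : ∀ i, (∀ n ≤ N i, p i n = 0) ∨ -1 < (a i).re)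
    {X : ℝ} {M K : ℕ} (hX : X ≤ M) (hK : M < (a (K + 1)).re) {s : ℝ} (hs : 0 < s) :
    gaussianPartialSum f N p a X s
      = ∑ m ∈ (Finset.range M).filter (fun m : ℕ => (m : ℝ) + 1 ≤ X),
          (-1) ^ m * ((s : ℂ) ^ (m + 1))⁻¹ * mellinPiece f N p a K (-(m : ℂ))
        + ∑ i ∈ (Finset.range (K + 1)).filter (fun i => 1 + (a i).re ≤ X),
          ∑ n ∈ Finset.range (N i + 1), p i n * momentKernel (a i) n s := by
  set D : ℕ → ℂ := fun m => (-1) ^ m * ((s : ℂ) ^ (m + 1))⁻¹ * mellinPiece f N p a K (-(m : ℂ))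
    with hD
  set T : ℕ → ℂ := fun i => ∑ n ∈ Finset.range (N i + 1), p i n * momentKernel (a i) n s with hT
  have hiK : ∀ i, 1 + (a i).re ≤ X → i < K + 1 := by
    intro i hi
    by_contra hlt
    have := ha_mono (not_lt.1 hlt)
    simp only at this
    linarith
  have hmM : ∀ m : ℕ, (m : ℝ) + 1 ≤ X → m < M := by
    intro m hm
    have : (m : ℝ) < M := by linarith
    exact_mod_cast this
  have hset1 : {m : ℕ | (¬ ∃ n : ℕ, (m : ℂ) = a n) ∧ (m : ℝ) + 1 ≤ X}
      = ↑(((Finset.range M).filter (fun m : ℕ => (m : ℝ) + 1 ≤ X)).filter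
        (fun m : ℕ => ¬ ∃ n : ℕ, (m : ℂ) = a n)) := by
    ext m
    simp only [Set.mem_ofPred_eq, Finset.coe_filter, Finset.mem_filter, Finset.mem_range]
    exact ⟨fun hm => ⟨⟨hmM m hm.2, hm.2⟩, hm.1⟩, fun hm => ⟨hm.2, hm.1.2⟩⟩
  have hset2 : {m : ℕ | (¬ ∃ l : ℕ, (l : ℂ) = a m) ∧ 1 + (a m).re ≤ X}
      = ↑(((Finset.range (K + 1)).filter (fun i => 1 + (a i).re ≤ X)).filter
        (fun i => ¬ ∃ l : ℕ, (l : ℂ) = a i)) := by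
    ext m
    simp only [Set.mem_ofPred_eq, Finset.coe_filter, Finset.mem_filter, Finset.mem_range]
    exact ⟨fun hm => ⟨⟨hiK m hm.2, hm.2⟩, hm.1⟩, fun hm => ⟨hm.2, hm.1.2⟩⟩
  have hset3 : {m : ℕ | (∃ l : ℕ, (l : ℂ) = a m) ∧ 1 + (a m).re ≤ X}
      = ↑(((Finset.range (K + 1)).filter (fun i => 1 + (a i).re ≤ X)).filter
        (fun i => ∃ l : ℕ, (l : ℂ) = a i)) := by
    ext m
    simp only [Set.mem_ofPred_eq, Finset.coe_filter, Finset.mem_filter, Finset.mem_range]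
    exact ⟨fun hm => ⟨⟨hiK m hm.2, hm.2⟩, hm.1⟩, fun hm => ⟨hm.2, hm.1.2⟩⟩
  have hre : ∀ i (l : ℕ), (l : ℂ) = a i → (a i).re = l := fun i l hl => by rw [← hl]; simp
  rw [gaussianPartialSum, hset1, hset2, hset3, finsum_mem_coe_finset, finsum_mem_coe_finset,
    finsum_mem_coe_finset]
  have e1 : ∀ m ∈ ((Finset.range M).filter (fun m : ℕ => (m : ℝ) + 1 ≤ X)).filter
        (fun m : ℕ => ¬ ∃ n : ℕ, (m : ℂ) = a n), regularTerm f m s = D m := by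
    intro m hm
    simp only [Finset.mem_filter, Finset.mem_range] at hm
    exact regularTerm_eq h hfi ha_inj ha_mono ha_tendsto hγδ hδ hm.2 (by linarith [hm.1.2]) s
  have e2 : ∀ i ∈ ((Finset.range (K + 1)).filter (fun i => 1 + (a i).re ≤ X)).filter
        (fun i => ¬ ∃ l : ℕ, (l : ℂ) = a i), fadingTerm N p a i s = T i := by
    intro i hi
    exact fadingTerm_eq hs (hp i) (Finset.mem_filter.1 hi).2
  have e3 : ∀ i ∈ ((Finset.range (K + 1)).filter (fun i => 1 + (a i).re ≤ X)).filter
        (fun i => ∃ l : ℕ, (l : ℂ) = a i), coincidentTerm f N a i s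
          = D ⌊(a i).re⌋₊ + T i := by
    intro i hi
    simp only [Finset.mem_filter, Finset.mem_range] at hi
    obtain ⟨⟨hi1, hi2⟩, l, hl⟩ := hi
    have hr := hre i l hl
    rw [hr, Nat.floor_natCast]
    exact coincidentTerm_eq h hfi ha_inj ha_mono ha_tendsto hγδ hδ hl (Nat.lt_succ_iff.1 hi1)
      (by linarith) hs
  have e4 : ∑ i ∈ ((Finset.range (K + 1)).filter (fun i => 1 + (a i).re ≤ X)).filter
        (fun i => ∃ l : ℕ, (l : ℂ) = a i), D ⌊(a i).re⌋₊
      = ∑ m ∈ ((Finset.range M).filter (fun m : ℕ => (m : ℝ) + 1 ≤ X)).filter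
        (fun m : ℕ => ∃ n : ℕ, (m : ℂ) = a n), D m := by
    refine Finset.sum_nbij (fun i => ⌊(a i).re⌋₊) ?_ ?_ ?_ fun _ _ => rfl
    · intro i hi
      simp only [Finset.mem_filter, Finset.mem_range] at hi ⊢
      obtain ⟨⟨hi1, hi2⟩, l, hl⟩ := hi
      have hr := hre i l hl
      rw [hr, Nat.floor_natCast]
      have : (l : ℝ) + 1 ≤ X := by linarith
      exact ⟨⟨hmM l this, this⟩, i, hl⟩
    · intro i hi j hj hij
      simp only [Finset.coe_filter, Set.mem_ofPred_eq, Finset.mem_filter] at hi hj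
      obtain ⟨-, l, hl⟩ := hi
      obtain ⟨-, l', hl'⟩ := hj
      have hij : ⌊(a i).re⌋₊ = ⌊(a j).re⌋₊ := hij
      rw [hre i l hl, hre j l' hl', Nat.floor_natCast, Nat.floor_natCast] at hij
      exact ha_inj (by rw [← hl, ← hl', hij])
    · intro m hm
      simp only [Finset.coe_filter, Set.mem_ofPred_eq, Finset.mem_filter, Finset.mem_range] at hm
      obtain ⟨⟨hm1, hm2⟩, i, hi⟩ := hm
      have hr := hre i m hi
      refine ⟨i, ?_, by simp only [hr, Nat.floor_natCast]⟩
      simp only [Finset.coe_filter, Set.mem_ofPred_eq, Finset.mem_filter, Finset.mem_range]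
      have : 1 + (a i).re ≤ X := by linarith
      exact ⟨⟨hiK i this, this⟩, m, hi⟩
  rw [Finset.sum_congr rfl e1, Finset.sum_congr rfl e2, Finset.sum_congr rfl e3,
    Finset.sum_add_distrib, e4]
  have f1 := Finset.sum_filter_add_sum_filter_not
    ((Finset.range M).filter (fun m : ℕ => (m : ℝ) + 1 ≤ X)) (fun m : ℕ => ∃ n : ℕ, (m : ℂ) = a n) D
  have f2 := Finset.sum_filter_add_sum_filter_not
    ((Finset.range (K + 1)).filter (fun i => 1 + (a i).re ≤ X)) (fun i => ∃ l : ℕ, (l : ℂ) = a i) T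
  rw [← f1, ← f2]
  ring

open Classical in
lemma integral_mul_stieltjesKernel_sub_gaussianPartialSum (h : HasLogExpansion f N p a)
    (hfi : LocallyIntegrableOn f (Set.Ioi 0)) (ha_inj : Function.Injective a)
    (ha_mono : Monotone fun m => (a m).re)
    (ha_tendsto : Tendsto (fun m => (a m).re) atTop atTop) (hγδ : growthZero f < decayInfty f)
    (hγ : growthZero f < 1) (hδ : 0 < decayInfty f) (X : ℝ) :
    (fun s : ℝ => (∫ t in Set.Ioi 0, f t * stieltjesKernel s t) - gaussianPartialSum f N p a X s)
      =o[atTop] fun s : ℝ => s ^ (-X) := by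
  have hp : ∀ i, (∀ n ≤ N i, p i n = 0) ∨ -1 < (a i).re := by
    intro i
    by_cases hi : -1 < (a i).re
    · exact Or.inr hi
    · refine Or.inl (h.coeff_eq_zero hfi ha_inj ha_mono ha_tendsto (hγ.trans_le ?_))
      rw [← EReal.coe_one]
      exact EReal.coe_le_coe_iff.2 (by linarith)
  -- `M ≥ X` makes the error `s^(-(M+1))` negligible, and `K` is then large enough for the moments
  -- up to order `M`. Terms of these ranges with order above `X` are discarded in `h2` and `h3`.
  obtain ⟨M, hM⟩ := exists_nat_ge X
  obtain ⟨K, -, hK⟩ := exists_re_lt ha_tendsto M 0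
  have h1 := (h.integral_mul_stieltjesKernel_sub_isBigO hfi ha_inj ha_mono ha_tendsto hγ hδ
    hK).trans_isLittleO (isLittleO_inv_pow (X := X) (j := M + 1) (by push_cast; linarith))
  have h2 : (fun s : ℝ => ∑ m ∈ (Finset.range M).filter (fun m : ℕ => ¬ (m : ℝ) + 1 ≤ X),
      (-1) ^ m * ((s : ℂ) ^ (m + 1))⁻¹ * mellinPiece f N p a K (-(m : ℂ)))
      =o[atTop] fun s : ℝ => s ^ (-X) := by
    refine IsLittleO.fun_sum fun m hm => ?_
    have := (isBigO_const_mul_inv_pow ((-1) ^ m * mellinPiece f N p a K (-(m : ℂ)))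
      (m + 1)).trans_isLittleO (isLittleO_inv_pow (X := X) (j := m + 1) (by
        have := (Finset.mem_filter.1 hm).2
        push_cast
        linarith))
    exact this.congr_left fun s => by ring
  have h3 : (fun s : ℝ => ∑ i ∈ (Finset.range (K + 1)).filter (fun i => ¬ 1 + (a i).re ≤ X),
      ∑ n ∈ Finset.range (N i + 1), p i n * momentKernel (a i) n s)
      =o[atTop] fun s : ℝ => s ^ (-X) := by
    refine IsLittleO.fun_sum fun i hi => IsLittleO.fun_sum fun n hn => ?_
    rcases hp i with h0 | h0
    · simp only [h0 n (Nat.lt_succ_iff.1 (Finset.mem_range.1 hn)), zero_mul]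
      exact isLittleO_zero _ _
    · exact (isLittleO_momentKernel h0 n (not_le.1 (Finset.mem_filter.1 hi).2)).const_mul_left _
  refine ((h1.add h2).add h3).congr' ?_ EventuallyEq.rfl
  filter_upwards [eventually_gt_atTop 0] with s hs
  rw [gaussianPartialSum_eq h hfi ha_inj ha_mono ha_tendsto hγδ hδ hp hM hK hs]
  rw [← Finset.sum_filter_add_sum_filter_not (Finset.range M) (fun m : ℕ => (m : ℝ) + 1 ≤ X),
    ← Finset.sum_filter_add_sum_filter_not (Finset.range (K + 1)) (fun i => 1 + (a i).re ≤ X)]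
  ring

end

/-! ### Assembly of the main theorem -/

lemma avgMMSE_stdComplexGaussian_eq_integral {Ph : Measure ℂ} {fh : ℝ → ℝ}
    (hfh : IsGainDensity Ph fh) {s : ℝ} (hs : 0 ≤ s) :
    ((avgMMSE stdComplexGaussian Ph s : ℝ) : ℂ)
      = ∫ t in Set.Ioi 0, fadingFun fh t * stieltjesKernel s t := by
  rw [avgMMSE_stdComplexGaussian hfh hs, ← integral_complex_ofReal]
  refine setIntegral_congr_fun measurableSet_Ioi fun t _ => ?_
  simp only [fadingFun_eq, stieltjesKernel]
  rw [← Complex.ofReal_mul, div_eq_mul_inv]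

lemma conj_fadingFun (fh : ℝ → ℝ) (t : ℝ) :
    starRingEnd ℂ (fadingFun fh t) = fadingFun fh t := by
  rw [fadingFun_eq, Complex.conj_ofReal]

lemma HasLogExpansion.isBigO_of_lt {f : ℝ → ℂ} {N : ℕ → ℕ} {p : ℕ → ℕ → ℂ} {a : ℕ → ℂ}
    (h : HasLogExpansion f N p a) (ha_mono : Monotone fun m => (a m).re) {b : ℝ}
    (hb : b < (a 0).re) : f =O[𝓝[>] 0] fun t : ℝ => t ^ b := by
  have hlt : ∀ m, b < (a m).re := fun m => hb.trans_le (ha_mono (Nat.zero_le m))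
  have := (h.isBigO (k := 0) (hlt 1)).add (isBigO_fadingSum (N := N) (p := p) hlt 0)
  exact this.congr_left fun t => by ring

end

theorem mainTheorem6
    (PX Ph : Measure ℂ) [IsProbabilityMeasure Ph]
    (hPX : PX = pskLaw ∨ PX = pamLaw ∨ PX = qamLaw ∨ PX = stdComplexGaussian)
    (hPh : Integrable (fun z : ℂ => ‖z‖ ^ 2) Ph)
    (fh : ℝ → ℝ) (hfh : IsGainDensity Ph fh)
    (f : ℝ → ℂ) (hf : f = fadingFun fh)
    (q : ℂ) (hq : 0 ≤ q.re) (μ : ℝ) (hμ : 0 < μ)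
    (N : ℕ → ℕ) (p : ℕ → ℕ → ℂ) (a : ℕ → ℂ)
    (ha_inj : Function.Injective a)
    (ha_mono : Monotone fun m => (a m).re)
    (ha_tendsto : Tendsto (fun m => (a m).re) atTop atTop)
    (hexp : HasFadingExpansion f q μ N p a)
    (ha0 : PX ≠ stdComplexGaussian ∧ q = 0 → 0 < (a 0).re)
    (hγδ : growthZero f < decayInfty f)
    (hC : (abscissae f).Nonempty)
    (hdecay : ∃ c ∈ abscissae f, ∀ x : ℝ, c ≤ x →
      (fun y : ℝ => mellinCont f (1 - (x : ℂ) - (y : ℂ) * Complex.I))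
        =O[cocompact ℝ] fun y : ℝ => (|y| ^ 2)⁻¹) :
    IsMellinContinuation f (mellinCont f) ∧
    (q = 0 →
      (PX = pskLaw → ∀ R ∈ Set.Ioo (1 : ℝ) (min ((a 0).re + 1) 2),
        OneTermExpansion PX Ph f (1 / 2) R) ∧
      (PX = pamLaw → ∀ R ∈ Set.Ioo (1 : ℝ) (min ((a 0).re + 1) (3 / 2)),
        OneTermExpansion PX Ph f (1 / 2) R) ∧
      (PX = qamLaw → ∀ R ∈ Set.Ioo (1 : ℝ) (min ((a 0).re + 1) (3 / 2)),
        OneTermExpansion PX Ph f 1 R) ∧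
      (PX = stdComplexGaussian → ∀ X : ℝ,
        (fun snr : ℝ => ((avgMMSE PX Ph snr : ℝ) : ℂ) - gaussianPartialSum f N p a X snr)
          =o[atTop] fun snr : ℝ => snr ^ (-X))) ∧
    (q ≠ 0 →
      (PX = pskLaw → ∀ R ∈ Set.Ioo (1 : ℝ) 2, OneTermExpansion PX Ph f (1 / 2) R) ∧
      (PX = pamLaw → ∀ R ∈ Set.Ioo (1 : ℝ) (3 / 2), OneTermExpansion PX Ph f (1 / 2) R) ∧
      (PX = qamLaw → ∀ R ∈ Set.Ioo (1 : ℝ) (3 / 2), OneTermExpansion PX Ph f 1 R) ∧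
      (PX = stdComplexGaussian → ∀ k : ℕ,
        (fun snr : ℝ => ((avgMMSE PX Ph snr : ℝ) : ℂ) -
            ∑ m ∈ Finset.range (k + 1), regularTerm f m snr)
          =O[atTop] fun snr : ℝ => (snr ^ (k + 2))⁻¹)) := by
  subst hf
  have hfi := locallyIntegrableOn_fadingFun hfh hPh
  obtain ⟨hδ, hγ⟩ := abscissae_nonempty_iff hC
  by_cases hq0 : q = 0
  · subst hq0
    have hlog := hexp.hasLogExpansion
    have hcont := hlog.isMellinContinuation hfi ha_inj ha_mono ha_tendsto
    have hone : ∀ R, 1 < R → R < (a 0).re + 1 →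
        (R ≤ 2 → OneTermExpansion pskLaw Ph (fadingFun fh) (1 / 2) R) ∧
        (R ≤ 3 / 2 → OneTermExpansion pamLaw Ph (fadingFun fh) (1 / 2) R) ∧
        (R ≤ 3 / 2 → OneTermExpansion qamLaw Ph (fadingFun fh) 1 R) := by
      intro R h1 h2
      -- The gap between `R - 1` and `Re (a 0)` absorbs the logarithms of the leading term.
      obtain ⟨b, hb1, hb2⟩ := exists_between (show R - 1 < (a 0).re by linarith)
      exact oneTermExpansion_of_isBigO hfh hPh h1 hb1 (hlog.isBigO_of_lt ha_mono hb2) hδ hcont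
    refine ⟨hcont, fun _ => ⟨?_, ?_, ?_, ?_⟩, fun h => absurd rfl h⟩
    · rintro rfl R ⟨h1, h2⟩
      exact (hone R h1 (h2.trans_le (min_le_left _ _))).1 (h2.trans_le (min_le_right _ _)).le
    · rintro rfl R ⟨h1, h2⟩
      exact (hone R h1 (h2.trans_le (min_le_left _ _))).2.1 (h2.trans_le (min_le_right _ _)).le
    · rintro rfl R ⟨h1, h2⟩
      exact (hone R h1 (h2.trans_le (min_le_left _ _))).2.2 (h2.trans_le (min_le_right _ _)).le
    · rintro rfl X
      refine (integral_mul_stieltjesKernel_sub_gaussianPartialSum hlog hfi ha_inj ha_mono ha_tendsto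
        hγδ hγ hδ X).congr' ?_ EventuallyEq.rfl
      filter_upwards [eventually_ge_atTop 0] with s hs
      rw [avgMMSE_stdComplexGaussian_eq_integral hfh hs]
  -- Rapid decay permits `b = R` in the moment condition, so the only limit on `R` comes from the
  -- uniform error bounds.
  · have hO := isBigO_of_hasFadingExpansion (conj_fadingFun fh) hq hq0 hμ ha_mono ha_tendsto hexp
    have hcont := (isMellinContinuation_mellin hfi hO).mellinCont
    refine ⟨hcont, fun h => absurd h hq0, fun _ => ⟨?_, ?_, ?_, ?_⟩⟩
    · rintro rfl R ⟨h1, h2⟩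
      exact (oneTermExpansion_of_isBigO hfh hPh h1 (sub_one_lt R) (hO R) hδ hcont).1 h2.le
    · rintro rfl R ⟨h1, h2⟩
      exact (oneTermExpansion_of_isBigO hfh hPh h1 (sub_one_lt R) (hO R) hδ hcont).2.1 h2.le
    · rintro rfl R ⟨h1, h2⟩
      exact (oneTermExpansion_of_isBigO hfh hPh h1 (sub_one_lt R) (hO R) hδ hcont).2.2 h2.le
    · rintro rfl k
      exact avgMMSE_stdComplexGaussian_sub_isBigO hfh hPh hO hδ hcont k
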